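/- Let $X$ be a topological space with a sheaf $\mathcal R$ of (not necessarily commutative) rings, and let $\mathcal U=\{U_i\}_{i\in I}$ be a locally finite open cover of $X$; put $U_{i_0\ldots i_k}=U_{i_0}\cap\dots\cap U_{i_k}$. All modules are left modules. For an open set $V$ let $Cpx(V)$ be the dg-category of complexes of sheaves of $\mathcal R|_V$-modules: morphisms of degree $q$ are all homogeneous maps of degree $q$, with differential $f\mapsto d\circ f-(-1)^q f\circ d$. Let $Cpx(N_\bullet)$ be the cosimplicial dg-category of the Čech nerve: $Cpx(N_n)=\prod_{(i_0\ldots i_n)}Cpx(U_{i_0\ldots i_n})$ over all $(n+1)$-tuples of indices, and $\sigma:[n]\to[m]$ acts by $(\sigma_*K)_{i_0\ldots i_m}=K_{i_{\sigma(0)}\ldots i_{\sigma(n)}}|_{U_{i_0\ldots i_m}}$. *Cochains.* A cochain $\varphi$ of total degree $m$ from a family $(E_i)$ to a family $(F_i)$ consists of morphisms $\varphi^{k,m-k}_{i_0\ldots i_k}:E_{i_k}\to F_{i_0}$ of degree $m-k$, one for each $k\ge0$ and each admissible multi-index. Put $$(\varphi\cdot\eta)_{i_0\ldots i_n}=\sum_{p+r=n}(-1)^{qr}\varphi^{p,q}_{i_0\ldots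 i_p}\circ\eta^{r,s}_{i_p\ldots i_n},\qquad (\delta\varphi)_{i_0\ldots i_k}=\sum_{j=1}^{k-1}(-1)^j\varphi_{i_0\ldots\widehat{i_j}\ldots i_k},$$ $$(D\varphi)_{i_0\ldots i_k}=(-1)^k d(\varphi_{i_0\ldots i_k})+(\delta\varphi)_{i_0\ldots i_k}.$$ *Twisted complexes.* An object of $\mathrm{Tw}(X,\mathcal R,\mathcal U)$ consists of graded sheaves $E_i^\bullet$ of $\mathcal R$-modules on the $U_i$ and a cochain $a=\sum_{k\ge0}a^{k,1-k}$ of total degree $1$, where all multi-indices are admissible and $a^{k,1-k}_{i_0\ldots i_k}:E_{i_k}\to E_{i_0}$ is defined over $U_{i_0\ldots i_k}$, such that $\delta a+a\cdot a=0$ and, for every $i$, the chain map $a^{1,0}_{ii}$ of $(E_i,a^{0,1}_i)$ is invertible up to homotopy. Morphisms of degree $m$ from $(E,a)$ to $(F,b)$ are all cochains of total degree $m$, composed by $\cdot$, with $d\varphi=\delta\varphi+b\cdot\varphi-(-1)^m\varphi\cdot a$. *Totalization.* For a dg-category $\mathcal B$, let $\Delta_n(\mathcal B)$ be the dg-category whose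 objects are families $E_0,\dots,E_n$ of objects of $\mathcal B$ with morphisms $\phi^{k,1-k}_{i_0\ldots i_k}\in\mathrm{Hom}^{1-k}(E_{i_k},E_{i_0})$ for $k\ge1$ and $0\le i_0\le\dots\le i_k\le n$, such that $D\phi+\phi\cdot\phi=0$ and all $\phi^{1,0}_{ij}$ (including $i=j$) are homotopy invertible; its morphisms of degree $m$ are all cochains $\theta$ of total degree $m$ indexed by the weakly increasing multi-indices (with $k\ge0$), with $d\theta=D\theta+\psi\cdot\theta-(-1)^m\theta\cdot\phi$. For a cosimplicial dg-category $\mathcal B^\bullet$, let $\mathrm{Tot}(\mathcal B^\bullet)$ be the equalizer of the two dg-functors $$\prod_{[n]}\Delta_n(\mathcal B^n)\rightrightarrows\prod_{\sigma:[n]\to[m]}\Delta_n(\mathcal B^m)$$ with components $\Delta_n(\sigma_*)$ and $\sigma^*$, where $\sigma^*$ relabels: $(\sigma^*E)_i=E_{\sigma(i)}$, $(\sigma^*\phi)_{i_0\ldots i_k}=\phi_{\sigma(i_0)\ldots\sigma(i_k)}$. Call an object of $\Delta_n(\mathcal B)$ normalized if $\phi^{1,0}_{ii}=\mathrm{id}$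 for all $i$ and $\phi^{k,1-k}_{i_0\ldots i_k}=0$ whenever $k\ge2$ and some index is repeated. Call a twisted complex normalized if $a^{1,0}_{ii}=\mathrm{id}$ for all $i$ and $a^{k,1-k}_{i_0\ldots i_k}=0$ whenever $k\ge2$ and $i_l=i_{l+1}$ for some $l$. **Proposition.** (1) There is an isomorphism of dg-categories (bijective on objects and on the morphisms of each degree) $$F:\mathrm{Tw}(X,\mathcal R,\mathcal U)\longrightarrow\mathrm{Tot}(Cpx(N_\bullet))$$ with the following components in $\Delta_n(Cpx(N_n))$, over each $U_{\alpha_0\ldots\alpha_n}$. The $i$-th object attached to $(E,a)$ is the restriction of the complex $(E_{\alpha_i},a^{0,1}_{\alpha_i})$; for $k\ge1$ the morphism $\phi^{k,1-k}_{i_0\ldots i_k}$ attached to $(E,a)$ is the restriction of $a^{k,1-k}_{\alpha_{i_0}\ldots\alpha_{i_k}}$; and for $k\ge0$ the component $\theta^{k,m-k}_{i_0\ldots i_k}$ attached to a morphism $\theta$ of degree $m$ is the restriction of $\theta^{k,m-k}_{\alpha_{i_0}\ldots\alpha_{i_k}}$. Moreover, a twisted complex is normalized if and only if all the components in $\Delta_n(Cpx(N_n))$,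 $n\ge0$, of its image under $F$ are normalized. (2) For all graded sheaves $E_i$ on the $U_i$ and every cochain $a$ of total degree $1$ as above with $\delta a+a\cdot a=0$, the following two non-degeneracy conditions are equivalent: $a^{1,0}_{ii}$ is invertible up to homotopy for every $i$; and $a^{1,0}_{ij}$ is invertible up to homotopy over $U_{ij}$ for all $i,j$. -/

import Mathlib

open CategoryTheory TopologicalSpace Opposite

universe u v w t

set_option linter.unusedVariables false
set_option linter.checkUnivs false

namespace TwTot

/-- A dg-category (over `ℤ`, cohomological grading).  `comp h f g` is the composite `f ∘ g`. The
degrees of composites and differentials are pinned by equations, so that no transport along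
equalities of degrees is needed. -/
structure DGCat : Type (max (u + 1) (v + 1)) where
  Ob : Type u
  Hom : Ob → Ob → ℤ → Type v
  [grp : ∀ X Y p, AddCommGroup (Hom X Y p)]
  one : ∀ X : Ob, Hom X X 0
  comp : ∀ {X Y Z : Ob} {p q r : ℤ}, p + q = r → Hom Y Z p → Hom X Y q → Hom X Z r
  d : ∀ {X Y : Ob} {p q : ℤ}, p + 1 = q → Hom X Y p → Hom X Y q
  add_comp : ∀ {X Y Z : Ob} {p q r : ℤ} (h : p + q = r) (f f' : Hom Y Z p) (g : Hom X Y q),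
    comp h (f + f') g = comp h f g + comp h f' g
  comp_add : ∀ {X Y Z : Ob} {p q r : ℤ} (h : p + q = r) (f : Hom Y Z p) (g g' : Hom X Y q),
    comp h f (g + g') = comp h f g + comp h f g'
  comp_assoc : ∀ {X Y Z W : Ob} {p q r pq qr pqr : ℤ} (h₁ : p + q = pq) (h₂ : q + r = qr)
    (h₃ : pq + r = pqr) (h₄ : p + qr = pqr) (f : Hom Z W p) (g : Hom Y Z q) (k : Hom X Y r),
    comp h₃ (comp h₁ f g) k = comp h₄ f (comp h₂ g k)
  one_comp : ∀ {X Y : Ob} {p : ℤ} (h : 0 + p = p) (f : Hom X Y p), comp h (one Y) f = f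
  comp_one : ∀ {X Y : Ob} {p : ℤ} (h : p + 0 = p) (f : Hom X Y p), comp h f (one X) = f
  d_add : ∀ {X Y : Ob} {p q : ℤ} (h : p + 1 = q) (f f' : Hom X Y p), d h (f + f') = d h f + d h f'
  d_d : ∀ {X Y : Ob} {p q r : ℤ} (h : p + 1 = q) (h' : q + 1 = r) (f : Hom X Y p),
    d h' (d h f) = 0
  d_comp : ∀ {X Y Z : Ob} {p q r p' q' r' : ℤ} (h : p + q = r) (hp : p + 1 = p') (hq : q + 1 = q')
    (hr : r + 1 = r') (h₁ : p' + q = r') (h₂ : p + q' = r') (f : Hom Y Z p) (g : Hom X Y q),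
    d hr (comp h f g) = comp h₁ (d hp f) g + p.negOnePow • comp h₂ f (d hq g)

attribute [instance] DGCat.grp

namespace DGCat

variable (A : DGCat.{u, v})

/-- Composition as a biadditive map. -/
def compHom {X Y Z : A.Ob} {p q r : ℤ} (h : p + q = r) :
    A.Hom Y Z p →+ A.Hom X Y q →+ A.Hom X Z r :=
  AddMonoidHom.mk' (fun f => AddMonoidHom.mk' (fun g => A.comp h f g) (A.comp_add h f))
    (fun f f' => by ext g; exact A.add_comp h f f' g)

/-- The differential as an additive map. -/
def dHom {X Y : A.Ob} {p q : ℤ} (h : p + 1 = q) : A.Hom X Y p →+ A.Hom X Y q :=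
  AddMonoidHom.mk' (fun f => A.d h f) (A.d_add h)

lemma comp_zero {X Y Z : A.Ob} {p q r : ℤ} (h : p + q = r) (f : A.Hom Y Z p) :
    A.comp h f (0 : A.Hom X Y q) = 0 := map_zero (A.compHom h f)

lemma zero_comp {X Y Z : A.Ob} {p q r : ℤ} (h : p + q = r) (g : A.Hom X Y q) :
    A.comp h (0 : A.Hom Y Z p) g = 0 := by
  have := DFunLike.congr_fun (map_zero (A.compHom (X := X) (Y := Y) (Z := Z) h)) g
  exact this

lemma comp_neg {X Y Z : A.Ob} {p q r : ℤ} (h : p + q = r) (f : A.Hom Y Z p) (g : A.Hom X Y q) :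
    A.comp h f (-g) = - A.comp h f g := map_neg (A.compHom h f) g

lemma neg_comp {X Y Z : A.Ob} {p q r : ℤ} (h : p + q = r) (f : A.Hom Y Z p) (g : A.Hom X Y q) :
    A.comp h (-f) g = - A.comp h f g := DFunLike.congr_fun (map_neg (A.compHom h) f) g

lemma comp_sub {X Y Z : A.Ob} {p q r : ℤ} (h : p + q = r) (f : A.Hom Y Z p)
    (g g' : A.Hom X Y q) : A.comp h f (g - g') = A.comp h f g - A.comp h f g' :=
  map_sub (A.compHom h f) g g'

lemma sub_comp {X Y Z : A.Ob} {p q r : ℤ} (h : p + q = r) (f f' : A.Hom Y Z p)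
    (g : A.Hom X Y q) : A.comp h (f - f') g = A.comp h f g - A.comp h f' g :=
  DFunLike.congr_fun (map_sub (A.compHom h) f f') g

lemma comp_smul {X Y Z : A.Ob} {p q r : ℤ} (h : p + q = r) (e : ℤˣ) (f : A.Hom Y Z p)
    (g : A.Hom X Y q) : A.comp h f (e • g) = e • A.comp h f g := by
  rw [Units.smul_def, Units.smul_def]
  exact map_zsmul (A.compHom h f) _ g

lemma smul_comp {X Y Z : A.Ob} {p q r : ℤ} (h : p + q = r) (e : ℤˣ) (f : A.Hom Y Z p)
    (g : A.Hom X Y q) : A.comp h (e • f) g = e • A.comp h f g := by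
  rw [Units.smul_def, Units.smul_def]
  exact DFunLike.congr_fun (map_zsmul (A.compHom h) _ f) g

lemma comp_sum {X Y Z : A.Ob} {p q r : ℤ} (h : p + q = r) {κ : Type*} (s : Finset κ)
    (f : A.Hom Y Z p) (g : κ → A.Hom X Y q) :
    A.comp h f (∑ i ∈ s, g i) = ∑ i ∈ s, A.comp h f (g i) :=
  map_sum (A.compHom h f) g s

lemma sum_comp {X Y Z : A.Ob} {p q r : ℤ} (h : p + q = r) {κ : Type*} (s : Finset κ)
    (f : κ → A.Hom Y Z p) (g : A.Hom X Y q) :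
    A.comp h (∑ i ∈ s, f i) g = ∑ i ∈ s, A.comp h (f i) g := by
  have := DFunLike.congr_fun (map_sum (A.compHom (X := X) (Y := Y) (Z := Z) h) f s) g
  rw [AddMonoidHom.finsetSum_apply] at this
  exact this

lemma d_zero {X Y : A.Ob} {p q : ℤ} (h : p + 1 = q) : A.d h (0 : A.Hom X Y p) = 0 :=
  map_zero (A.dHom h)

lemma d_sub {X Y : A.Ob} {p q : ℤ} (h : p + 1 = q) (f f' : A.Hom X Y p) :
    A.d h (f - f') = A.d h f - A.d h f' := map_sub (A.dHom h) f f'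

lemma d_smul {X Y : A.Ob} {p q : ℤ} (h : p + 1 = q) (e : ℤˣ) (f : A.Hom X Y p) :
    A.d h (e • f) = e • A.d h f := by
  rw [Units.smul_def, Units.smul_def]
  exact map_zsmul (A.dHom h) _ f

lemma d_sum {X Y : A.Ob} {p q : ℤ} (h : p + 1 = q) {κ : Type*} (s : Finset κ)
    (f : κ → A.Hom X Y p) : A.d h (∑ i ∈ s, f i) = ∑ i ∈ s, A.d h (f i) :=
  map_sum (A.dHom h) f s

/-- The identity of `X`, in a degree `p` that is known to be `0`. -/
def unit (X : A.Ob) {p : ℤ} (h : p = 0) : A.Hom X X p := h ▸ A.one X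

/-- Transport of morphisms along equalities of objects. -/
def castHom {X X' Y Y' : A.Ob} {p : ℤ} (hX : X = X') (hY : Y = Y') (f : A.Hom X Y p) :
    A.Hom X' Y' p := hX ▸ hY ▸ f

/-- A degree `0` morphism is homotopy invertible if it is closed and becomes invertible in the
homotopy category `H⁰(A)`. -/
def IsHtpyInvertible {X Y : A.Ob} {p : ℤ} (hp : p = 0) (f : A.Hom X Y p) : Prop :=
  A.d (q := 1) (by omega) f = 0 ∧
  ∃ g : A.Hom Y X 0, A.d (q := 1) (by omega) g = 0 ∧
    (∃ h : A.Hom Y Y (-1), A.comp (r := 0) (by omega) f g - A.one Y = A.d (by omega) h) ∧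
    (∃ h : A.Hom X X (-1), A.comp (r := 0) (by omega) g f - A.one X = A.d (by omega) h)

end DGCat

/-- A dg-functor. -/
structure DGFunctor (A : DGCat.{u, v}) (B : DGCat.{w, t}) where
  obj : A.Ob → B.Ob
  map : ∀ {X Y : A.Ob} {p : ℤ}, A.Hom X Y p → B.Hom (obj X) (obj Y) p
  map_add : ∀ {X Y : A.Ob} {p : ℤ} (f g : A.Hom X Y p), map (f + g) = map f + map g
  map_one : ∀ X : A.Ob, map (A.one X) = B.one (obj X)
  map_comp : ∀ {X Y Z : A.Ob} {p q r : ℤ} (h : p + q = r) (f : A.Hom Y Z p) (g : A.Hom X Y q),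
    map (A.comp h f g) = B.comp h (map f) (map g)
  map_d : ∀ {X Y : A.Ob} {p q : ℤ} (h : p + 1 = q) (f : A.Hom X Y p),
    map (A.d h f) = B.d h (map f)

namespace DGFunctor

/-- A dg-functor is an isomorphism of dg-categories if it is bijective on objects and on all
graded pieces of the morphism complexes. -/
def IsIso {A : DGCat.{u, v}} {B : DGCat.{w, t}} (F : DGFunctor A B) : Prop :=
  Function.Bijective F.obj ∧
    ∀ (X Y : A.Ob) (p : ℤ), Function.Bijective (fun f : A.Hom X Y p => F.map f)

lemma map_zero {A : DGCat.{u, v}} {B : DGCat.{w, t}} (F : DGFunctor A B) {X Y : A.Ob} {p : ℤ} :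
    F.map (0 : A.Hom X Y p) = 0 :=
  _root_.map_zero (AddMonoidHom.mk' (fun f : A.Hom X Y p => F.map f) F.map_add)

lemma map_sub {A : DGCat.{u, v}} {B : DGCat.{w, t}} (F : DGFunctor A B) {X Y : A.Ob} {p : ℤ}
    (f g : A.Hom X Y p) : F.map (f - g) = F.map f - F.map g :=
  _root_.map_sub (AddMonoidHom.mk' (fun f : A.Hom X Y p => F.map f) F.map_add) f g

lemma map_neg {A : DGCat.{u, v}} {B : DGCat.{w, t}} (F : DGFunctor A B) {X Y : A.Ob} {p : ℤ}
    (f : A.Hom X Y p) : F.map (-f) = - F.map f :=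
  _root_.map_neg (AddMonoidHom.mk' (fun f : A.Hom X Y p => F.map f) F.map_add) f

lemma map_smul {A : DGCat.{u, v}} {B : DGCat.{w, t}} (F : DGFunctor A B) {X Y : A.Ob} {p : ℤ}
    (e : ℤˣ) (f : A.Hom X Y p) : F.map (e • f) = e • F.map f := by
  rw [Units.smul_def, Units.smul_def]
  exact map_zsmul (AddMonoidHom.mk' (fun f : A.Hom X Y p => F.map f) F.map_add) _ f

lemma map_sum {A : DGCat.{u, v}} {B : DGCat.{w, t}} (F : DGFunctor A B) {X Y : A.Ob} {p : ℤ}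
    {κ : Type*} (s : Finset κ) (f : κ → A.Hom X Y p) :
    F.map (∑ i ∈ s, f i) = ∑ i ∈ s, F.map (f i) :=
  _root_.map_sum (AddMonoidHom.mk' (fun f : A.Hom X Y p => F.map f) F.map_add) f s

lemma map_unit {A : DGCat.{u, v}} {B : DGCat.{w, t}} (F : DGFunctor A B) (X : A.Ob) {p : ℤ}
    (h : p = 0) : F.map (A.unit X h) = B.unit (F.obj X) h := by
  subst h; exact F.map_one X

lemma map_isHtpyInvertible {A : DGCat.{u, v}} {B : DGCat.{w, t}} (F : DGFunctor A B)
    {X Y : A.Ob} {p : ℤ} (hp : p = 0) (f : A.Hom X Y p) (hf : A.IsHtpyInvertible hp f) :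
    B.IsHtpyInvertible hp (F.map f) := by
  obtain ⟨h0, g, hg, ⟨a, ha⟩, ⟨b, hb⟩⟩ := hf
  refine ⟨by rw [← F.map_d, h0, F.map_zero], F.map g, by rw [← F.map_d, hg, F.map_zero],
    ⟨F.map a, ?_⟩, ⟨F.map b, ?_⟩⟩
  · rw [← F.map_d, ← ha, F.map_sub, F.map_comp, F.map_one]
  · rw [← F.map_d, ← hb, F.map_sub, F.map_comp, F.map_one]

lemma ext {A : DGCat.{u, v}} {B : DGCat.{w, t}} {F G : DGFunctor A B} (h : F.obj = G.obj)
    (h' : ∀ (X Y : A.Ob) (p : ℤ) (f : A.Hom X Y p),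
      B.castHom (congrFun h X) (congrFun h Y) (F.map f) = G.map f) : F = G := by
  obtain ⟨o, m, _, _, _, _⟩ := F
  obtain ⟨o', m', _, _, _, _⟩ := G
  change o = o' at h
  subst h
  obtain rfl : @m = @m' := by
    funext X Y p f
    exact h' X Y p f
  rfl

/-- The identity dg-functor. -/
def id (A : DGCat.{u, v}) : DGFunctor A A where
  obj X := X
  map f := f
  map_add _ _ := rfl
  map_one _ := rfl
  map_comp _ _ _ := rfl
  map_d _ _ := rfl

/-- The composite `G ∘ F` of dg-functors. -/
def comp {A B C : DGCat} (F : DGFunctor A B) (G : DGFunctor B C) : DGFunctor A C where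
  obj X := G.obj (F.obj X)
  map f := G.map (F.map f)
  map_add f g := by rw [F.map_add, G.map_add]
  map_one X := by rw [F.map_one, G.map_one]
  map_comp h f g := by rw [F.map_comp, G.map_comp]
  map_d h f := by rw [F.map_d, G.map_d]

end DGFunctor

/-- The category of dg-categories and dg-functors. -/
instance : Category DGCat.{u, v} where
  Hom A B := DGFunctor A B
  id A := DGFunctor.id A
  comp F G := DGFunctor.comp F G

namespace DGCat

/-- The product of a family of dg-categories. -/
def pi {κ : Type t} (A : κ → DGCat.{u, v}) : DGCat.{max t u, max t v} where
  Ob := ∀ i, (A i).Ob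
  Hom X Y p := ∀ i, (A i).Hom (X i) (Y i) p
  one X i := (A i).one (X i)
  comp h f g i := (A i).comp h (f i) (g i)
  d h f i := (A i).d h (f i)
  add_comp h f f' g := funext fun i => (A i).add_comp h _ _ _
  comp_add h f f' g := funext fun i => (A i).comp_add h _ _ _
  comp_assoc h₁ h₂ h₃ h₄ f g k := funext fun i => (A i).comp_assoc h₁ h₂ h₃ h₄ _ _ _
  one_comp h f := funext fun i => (A i).one_comp h _
  comp_one h f := funext fun i => (A i).comp_one h _
  d_add h f g := funext fun i => (A i).d_add h _ _
  d_d h h' f := funext fun i => (A i).d_d h h' _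
  d_comp h hp hq hr h₁ h₂ f g := funext fun i => (A i).d_comp h hp hq hr h₁ h₂ _ _

/-- The dg-functor between products that is given by a map of the index sets and dg-functors
between the factors. -/
def piMap {κ : Type w} {κ' : Type t} {A : κ → DGCat.{u, v}} {B : κ' → DGCat.{u, v}} (g : κ' → κ)
    (F : ∀ j, DGFunctor (A (g j)) (B j)) : DGFunctor (pi A) (pi B) where
  obj X j := (F j).obj (X (g j))
  map f j := (F j).map (f (g j))
  map_add f f' := funext fun j => (F j).map_add _ _
  map_one X := funext fun j => (F j).map_one _
  map_comp h f f' := funext fun j => (F j).map_comp h _ _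
  map_d h f := funext fun j => (F j).map_d h _

lemma piMap_comp {κ : Type w} {κ' : Type t} {κ'' : Type*} {A : κ → DGCat.{u, v}}
    {B : κ' → DGCat.{u, v}} {C : κ'' → DGCat.{u, v}} (g : κ' → κ) (g' : κ'' → κ')
    (F : ∀ j, DGFunctor (A (g j)) (B j)) (F' : ∀ k, DGFunctor (B (g' k)) (C k)) :
    (piMap g F).comp (piMap g' F') =
      piMap (A := A) (B := C) (g ∘ g') (fun k => (F (g' k)).comp (F' k)) :=
  DGFunctor.ext rfl fun _ _ _ _ => rfl

section castHom

variable (A : DGCat.{u, v})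

lemma castHom_add {X X' Y Y' : A.Ob} {p : ℤ} (hX : X = X') (hY : Y = Y') (f g : A.Hom X Y p) :
    A.castHom hX hY (f + g) = A.castHom hX hY f + A.castHom hX hY g := by
  subst hX hY; rfl

lemma castHom_zero {X X' Y Y' : A.Ob} {p : ℤ} (hX : X = X') (hY : Y = Y') :
    A.castHom hX hY (0 : A.Hom X Y p) = 0 := by
  subst hX hY; rfl

lemma castHom_neg {X X' Y Y' : A.Ob} {p : ℤ} (hX : X = X') (hY : Y = Y') (f : A.Hom X Y p) :
    A.castHom hX hY (-f) = - A.castHom hX hY f := by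
  subst hX hY; rfl

lemma castHom_one {X X' : A.Ob} (hX : X = X') : A.castHom hX hX (A.one X) = A.one X' := by
  subst hX; rfl

lemma castHom_comp {X X' Y Y' Z Z' : A.Ob} {p q r : ℤ} (hX : X = X') (hY : Y = Y')
    (hZ : Z = Z') (h : p + q = r) (f : A.Hom Y Z p) (g : A.Hom X Y q) :
    A.castHom hX hZ (A.comp h f g) = A.comp h (A.castHom hY hZ f) (A.castHom hX hY g) := by
  subst hX hY hZ; rfl

lemma castHom_d {X X' Y Y' : A.Ob} {p q : ℤ} (hX : X = X') (hY : Y = Y') (h : p + 1 = q)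
    (f : A.Hom X Y p) : A.castHom hX hY (A.d h f) = A.d h (A.castHom hX hY f) := by
  subst hX hY; rfl

end castHom

/-- The morphisms of degree `p` on which two dg-functors agree, between objects on which they
agree. -/
def eqHom {A : DGCat.{u, v}} {B : DGCat.{w, t}} (F G : DGFunctor A B)
    (X Y : {X : A.Ob // F.obj X = G.obj X}) (p : ℤ) : AddSubgroup (A.Hom X.1 Y.1 p) where
  carrier := {f | B.castHom X.2 Y.2 (F.map f) = G.map f}
  add_mem' {f g} hf hg := by
    simp only [Set.mem_ofPred_eq] at hf hg ⊢
    rw [F.map_add, castHom_add, hf, hg, G.map_add]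
  zero_mem' := by
    simp only [Set.mem_ofPred_eq]
    rw [F.map_zero, castHom_zero, G.map_zero]
  neg_mem' {f} hf := by
    simp only [Set.mem_ofPred_eq] at hf ⊢
    rw [F.map_neg, castHom_neg, hf, G.map_neg]

/-- The equalizer of two dg-functors: the sub-dg-category of `A` of the objects and the morphisms
on which `F` and `G` agree. -/
def equalizer {A : DGCat.{u, v}} {B : DGCat.{w, t}} (F G : DGFunctor A B) : DGCat.{u, v} where
  Ob := {X : A.Ob // F.obj X = G.obj X}
  Hom X Y p := eqHom F G X Y p
  one X := ⟨A.one X.1, show B.castHom X.2 X.2 (F.map (A.one X.1)) = G.map (A.one X.1) by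
    rw [F.map_one, castHom_one, G.map_one]⟩
  comp {X Y Z _ _ _} h f g := ⟨A.comp h f.1 g.1,
    show B.castHom X.2 Z.2 (F.map (A.comp h f.1 g.1)) = G.map (A.comp h f.1 g.1) by
      have hf : B.castHom Y.2 Z.2 (F.map f.1) = G.map f.1 := f.2
      have hg : B.castHom X.2 Y.2 (F.map g.1) = G.map g.1 := g.2
      rw [F.map_comp, castHom_comp B X.2 Y.2 Z.2, G.map_comp, hf, hg]⟩
  d {X Y _ _} h f := ⟨A.d h f.1,
    show B.castHom X.2 Y.2 (F.map (A.d h f.1)) = G.map (A.d h f.1) by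
      have hf : B.castHom X.2 Y.2 (F.map f.1) = G.map f.1 := f.2
      rw [F.map_d, castHom_d, G.map_d, hf]⟩
  add_comp h f f' g := Subtype.ext (A.add_comp h _ _ _)
  comp_add h f f' g := Subtype.ext (A.comp_add h _ _ _)
  comp_assoc h₁ h₂ h₃ h₄ f g k := Subtype.ext (A.comp_assoc h₁ h₂ h₃ h₄ _ _ _)
  one_comp h f := Subtype.ext (A.one_comp h _)
  comp_one h f := Subtype.ext (A.comp_one h _)
  d_add h f g := Subtype.ext (A.d_add h _ _)
  d_d h h' f := Subtype.ext (A.d_d h h' _)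
  d_comp h hp hq hr h₁ h₂ f g := Subtype.ext (A.d_comp h hp hq hr h₁ h₂ _ _)

/-- The twist of a dg-category by Maurer-Cartan elements: each new object `x` is an object of `A`
with an element `α` of degree `1` such that `d α + α ∘ α = 0`; the morphisms and their composition
are those of `A`, and the differential of `f : x → y` of degree `p` is
`d f + α_y ∘ f - (-1) ^ p f ∘ α_x`. -/
def twist (A : DGCat.{u, v}) {Ob' : Type w} (ob : Ob' → A.Ob) (α : ∀ x, A.Hom (ob x) (ob x) 1)
    (mc : ∀ x, A.d (q := 2) (by omega) (α x) + A.comp (by omega) (α x) (α x) = 0) :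
    DGCat.{w, v} where
  Ob := Ob'
  Hom x y p := A.Hom (ob x) (ob y) p
  one x := A.one (ob x)
  comp h f g := A.comp h f g
  d {x y p q} h f := A.d h f + A.comp (by omega) (α y) f - p.negOnePow • A.comp h f (α x)
  add_comp h f f' g := A.add_comp h f f' g
  comp_add h f f' g := A.comp_add h f f' g
  comp_assoc h₁ h₂ h₃ h₄ f g k := A.comp_assoc h₁ h₂ h₃ h₄ _ _ _
  one_comp h f := A.one_comp h _
  comp_one h f := A.comp_one h _
  d_add h f g := by
    rw [A.d_add, A.comp_add, A.add_comp, smul_add]; abel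
  d_d {x y p q r} h h' f := by
    have hx := A.comp_zero (X := ob x) (q := 2) (r := r) (by omega) f
    rw [← mc x, A.comp_add, ← A.comp_assoc (pq := q) (by omega) _ (by omega)] at hx
    have hy := A.zero_comp (p := 2) (r := r) (Z := ob y) (by omega) f
    rw [← mc y, A.add_comp, A.comp_assoc (qr := q) _ (by omega) _ (by omega)] at hy
    subst h
    rw [A.d_sub, A.d_add, A.d_d, A.d_smul,
      A.d_comp (p' := 2) (q' := p + 1) _ (by omega) (by omega) _ (by omega) (by omega),
      A.d_comp (p' := p + 1) (q' := 2) _ (by omega) (by omega) _ (by omega) (by omega),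
      A.comp_sub, A.comp_add, A.sub_comp, A.add_comp, A.comp_smul, A.smul_comp,
      A.comp_assoc (p := 1) (r := 1) (qr := p + 1) _ (by omega) _ (by omega)]
    rw [Int.negOnePow_succ, Int.negOnePow_one]
    rcases Int.even_or_odd p with hp | hp
    · simp only [Int.negOnePow_even p hp, one_smul, Units.neg_smul]
      refine Eq.trans ?_ ((congrArg₂ (· - ·) hy hx).trans (sub_zero 0))
      abel
    · simp only [Int.negOnePow_odd p hp, one_smul, Units.neg_smul, neg_neg]
      refine Eq.trans ?_ ((congrArg₂ (· - ·) hy hx).trans (sub_zero 0))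
      abel
  d_comp {x y z p q r p' q' r'} h hp hq hr h₁ h₂ f g := by
    subst hp hq hr h
    rw [A.d_comp (p' := p + 1) (q' := q + 1) _ (by omega) (by omega) _ (by omega) (by omega),
      A.sub_comp, A.add_comp, A.smul_comp, A.comp_sub, A.comp_add, A.comp_smul,
      A.comp_assoc (q := p) (qr := p + q) _ (by omega) _ (by omega),
      A.comp_assoc (q := 1) (qr := q + 1) _ (by omega) _ (by omega),
      A.comp_assoc (r := 1) (qr := q + 1) _ (by omega) _ (by omega),
      Int.negOnePow_add, mul_smul, smul_sub, smul_add]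
    abel

end DGCat

/-- A multi-index `(i_0, …, i_k)` with `i_0 = a` and `i_k = b`, all of whose entries satisfy
`rel i_l i_m` for `l ≤ m`. -/
@[ext]
structure Simplex {V : Type t} (rel : V → V → Prop) (k : ℕ) (a b : V) where
  v : Fin (k + 1) → V
  adm : ∀ l m, l ≤ m → rel (v l) (v m)
  first : v 0 = a
  last : v (Fin.last k) = b

namespace Simplex

variable {V : Type t} {rel : V → V → Prop} {k p r : ℕ} {a b : V}

/-- `(i_0, …, i_p)` for a multi-index `(i_0, …, i_{p + r})`. -/
def front (s : Simplex rel k a b) (h : p + r = k) :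
    Simplex rel p a (s.v ⟨p, by omega⟩) where
  v x := s.v ⟨x.1, by omega⟩
  adm l m hlm := s.adm _ _ hlm
  first := s.first
  last := rfl

/-- `(i_p, …, i_{p + r})` for a multi-index `(i_0, …, i_{p + r})`. -/
def back (s : Simplex rel k a b) (h : p + r = k) :
    Simplex rel r (s.v ⟨p, by omega⟩) b where
  v x := s.v ⟨p + x.1, by omega⟩
  adm l m hlm := s.adm _ _ (by simpa using hlm)
  first := rfl
  last := Eq.trans (congrArg s.v (Fin.ext (by simp [h]))) s.last

/-- `(i_0, …, i_{k + 1})` with the inner entry `i_{j + 1}` left out (`0 ≤ j < k`). -/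
def skip (s : Simplex rel (k + 1) a b) (j : Fin k) : Simplex rel k a b where
  v x := s.v ⟨if x.1 ≤ j.1 then x.1 else x.1 + 1, by split_ifs <;> omega⟩
  adm l m hlm := s.adm _ _ (by
    have : l.1 ≤ m.1 := hlm
    simp only [Fin.mk_le_mk]; split_ifs <;> omega)
  first := Eq.trans (congrArg s.v (Fin.ext (by simp))) s.first
  last := Eq.trans (congrArg s.v (Fin.ext (by
    have := j.2
    simp only [Fin.val_last]
    split_ifs <;> omega))) s.last

/-- The one-entry multi-index `(a)`. -/
def vertex (rel : V → V → Prop) (a : V) (h : rel a a) : Simplex rel 0 a a where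
  v _ := a
  adm _ _ _ := h
  first := rfl
  last := rfl

lemma first_eq_last (s : Simplex rel k a b) (hk : k = 0) : a = b := by
  subst hk
  exact s.first.symm.trans s.last

end Simplex

/-- The sum of `f p r` over all `p + r = n`. -/
def asum {G : Type*} [AddCommMonoid G] (n : ℕ) (f : ∀ p r : ℕ, p + r = n → G) : G :=
  ∑ x ∈ (Finset.HasAntidiagonal.antidiagonal n).attach, f x.1.1 x.1.2 (Finset.HasAntidiagonal.mem_antidiagonal.1 x.2)

section asum

variable {G : Type*} [AddCommMonoid G]

lemma asum_eq (n : ℕ) (f : ∀ p r : ℕ, p + r = n → G) :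
    asum n f = ∑ x ∈ Finset.HasAntidiagonal.antidiagonal n, if h : x.1 + x.2 = n then f x.1 x.2 h else 0 := by
  rw [← Finset.sum_attach]
  exact Finset.sum_congr rfl fun x _ => (dif_pos (Finset.HasAntidiagonal.mem_antidiagonal.1 x.2)).symm

lemma asum_congr {n : ℕ} {f g : ∀ p r : ℕ, p + r = n → G} (h : ∀ p r e, f p r e = g p r e) :
    asum n f = asum n g :=
  Finset.sum_congr rfl fun x _ => h _ _ _

lemma asum_add (n : ℕ) (f g : ∀ p r : ℕ, p + r = n → G) :
    asum n (fun p r e => f p r e + g p r e) = asum n f + asum n g :=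
  Finset.sum_add_distrib

lemma asum_succ (n : ℕ) (f : ∀ p r : ℕ, p + r = n + 1 → G) :
    asum (n + 1) f = f 0 (n + 1) (by omega) + asum n (fun p r e => f (p + 1) r (by omega)) := by
  rw [asum_eq, asum_eq, Finset.Nat.sum_antidiagonal_succ]
  congr 1
  · simp
  · refine Finset.sum_congr rfl fun x hx => ?_
    have hx := Finset.HasAntidiagonal.mem_antidiagonal.1 hx
    rw [dif_pos hx, dif_pos]

lemma asum_succ' (n : ℕ) (f : ∀ p r : ℕ, p + r = n + 1 → G) :
    asum (n + 1) f = f (n + 1) 0 (by omega) + asum n (fun p r e => f p (r + 1) (by omega)) := by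
  rw [asum_eq, asum_eq, Finset.Nat.sum_antidiagonal_succ']
  congr 1
  · simp
  · refine Finset.sum_congr rfl fun x hx => ?_
    have hx := Finset.HasAntidiagonal.mem_antidiagonal.1 hx
    rw [dif_pos hx, dif_pos]

lemma asum_zero (f : ∀ p r : ℕ, p + r = 0 → G) : asum 0 f = f 0 0 rfl := by
  rw [asum_eq]; simp

lemma asum_first (n : ℕ) (f : ∀ p r : ℕ, p + r = n → G) (hf : ∀ p r e, p ≠ 0 → f p r e = 0) :
    asum n f = f 0 n (by omega) := by
  rcases n with _ | n
  · exact asum_zero f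
  · rw [asum_succ, asum_congr (fun p r e => hf (p + 1) r _ (by omega))]
    simp [asum]

lemma asum_last (n : ℕ) (f : ∀ p r : ℕ, p + r = n → G) (hf : ∀ p r e, r ≠ 0 → f p r e = 0) :
    asum n f = f n 0 (by omega) := by
  rcases n with _ | n
  · exact asum_zero f
  · rw [asum_succ', asum_congr (fun p r e => hf p (r + 1) _ (by omega))]
    simp [asum]

lemma asum_assoc (n : ℕ) (g : ∀ p q r : ℕ, p + q + r = n → G) :
    asum n (fun x r h => asum x (fun p q h' => g p q r (by omega))) =
      asum n (fun p y h => asum y (fun q r h' => g p q r (by omega))) := by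
  unfold asum
  rw [Finset.sum_sigma', Finset.sum_sigma']
  refine Finset.sum_bij'
    (fun x _ => ⟨⟨(x.2.1.1, x.2.1.2 + x.1.1.2), ?_⟩, ⟨(x.2.1.2, x.1.1.2), ?_⟩⟩)
    (fun x _ => ⟨⟨(x.1.1.1 + x.2.1.1, x.2.1.2), ?_⟩, ⟨(x.1.1.1, x.2.1.1), ?_⟩⟩)
    ?_ ?_ ?_ ?_ ?_
  · have h1 := Finset.HasAntidiagonal.mem_antidiagonal.1 x.1.2
    have h2 := Finset.HasAntidiagonal.mem_antidiagonal.1 x.2.2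
    simp only [Finset.HasAntidiagonal.mem_antidiagonal]; omega
  · simp only [Finset.HasAntidiagonal.mem_antidiagonal]
  · have h1 := Finset.HasAntidiagonal.mem_antidiagonal.1 x.1.2
    have h2 := Finset.HasAntidiagonal.mem_antidiagonal.1 x.2.2
    simp only [Finset.HasAntidiagonal.mem_antidiagonal]; omega
  · simp only [Finset.HasAntidiagonal.mem_antidiagonal]
  · intros; simp
  · intros; simp
  · rintro ⟨⟨⟨x1, x2⟩, hx⟩, ⟨⟨y1, y2⟩, hy⟩⟩ -
    have hy' := Finset.HasAntidiagonal.mem_antidiagonal.1 hy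
    simp only at hy'
    subst hy'
    rfl
  · rintro ⟨⟨⟨x1, x2⟩, hx⟩, ⟨⟨y1, y2⟩, hy⟩⟩ -
    have hy' := Finset.HasAntidiagonal.mem_antidiagonal.1 hy
    simp only at hy'
    subst hy'
    rfl
  · intros; rfl

lemma map_asum {G H : Type*} [AddCommMonoid G] [AddCommMonoid H] (φ : G →+ H) (n : ℕ)
    (f : ∀ p r : ℕ, p + r = n → G) : φ (asum n f) = asum n (fun p r e => φ (f p r e)) :=
  map_sum φ _ _

lemma asum_sum_comm {κ : Type*} (t : Finset κ) (n : ℕ) (f : κ → ∀ p r : ℕ, p + r = n → G) :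
    ∑ j ∈ t, asum n (f j) = asum n (fun p r e => ∑ j ∈ t, f j p r e) :=
  Finset.sum_comm

end asum

namespace DGCat

lemma comp_asum (A : DGCat.{u, v}) {X Y Z : A.Ob} {p q r : ℤ} (h : p + q = r) (n : ℕ)
    (f : A.Hom Y Z p) (g : ∀ a b : ℕ, a + b = n → A.Hom X Y q) :
    A.comp h f (asum n g) = asum n fun a b e => A.comp h f (g a b e) := A.comp_sum h _ f _

lemma asum_comp (A : DGCat.{u, v}) {X Y Z : A.Ob} {p q r : ℤ} (h : p + q = r) (n : ℕ)
    (f : ∀ a b : ℕ, a + b = n → A.Hom Y Z p) (g : A.Hom X Y q) :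
    A.comp h (asum n f) g = asum n fun a b e => A.comp h (f a b e) g := A.sum_comp h _ _ g

lemma d_asum (A : DGCat.{u, v}) {X Y : A.Ob} {p q : ℤ} (h : p + 1 = q) (n : ℕ)
    (f : ∀ a b : ℕ, a + b = n → A.Hom X Y p) :
    A.d h (asum n f) = asum n fun a b e => A.d h (f a b e) := A.d_sum h _ _

end DGCat

lemma smul_asum {G : Type*} [AddCommGroup G] (e : ℤˣ) (n : ℕ) (f : ∀ p r : ℕ, p + r = n → G) :
    e • asum n f = asum n fun p r h => e • f p r h := Finset.smul_sum

/-- A system of dg-categories `cat W` indexed by an ordered set `L` of regions, with the objects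
`Ob a` over the region `dom a` for each vertex `a`, the intersections `inter` of finitely many of
these regions, and strictly functorial restriction of
objects and morphisms to smaller regions. -/
structure CoeffSystem (V : Type t) (L : Type w) [Preorder L] where
  dom : V → L
  inter : ∀ {k : ℕ}, (Fin (k + 1) → V) → L
  inter_le : ∀ {k : ℕ} (α : Fin (k + 1) → V) (x : Fin (k + 1)), inter α ≤ dom (α x)
  le_inter : ∀ {k : ℕ} (α : Fin (k + 1) → V) {W : L}, (∀ x, W ≤ dom (α x)) → W ≤ inter α
  cat : L → DGCat.{u, v}
  Ob : V → Type u
  obj : ∀ {a : V} {W : L}, W ≤ dom a → Ob a → (cat W).Ob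
  res : ∀ {a b : V} {W W' : L} (hW : W' ≤ W) {ha : W ≤ dom a} {hb : W ≤ dom b} {E : Ob a}
    {F : Ob b} {q : ℤ}, (cat W).Hom (obj ha E) (obj hb F) q →
    (cat W').Hom (obj (hW.trans ha) E) (obj (hW.trans hb) F) q
  res_add : ∀ {a b : V} {W W' : L} (hW : W' ≤ W) {ha : W ≤ dom a} {hb : W ≤ dom b} {E : Ob a}
    {F : Ob b} {q : ℤ} (f g : (cat W).Hom (obj ha E) (obj hb F) q),
    res hW (f + g) = res hW f + res hW g
  res_one : ∀ {a : V} {W W' : L} (hW : W' ≤ W) (ha : W ≤ dom a) (E : Ob a),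
    res hW ((cat W).one (obj ha E)) = (cat W').one (obj (hW.trans ha) E)
  res_comp : ∀ {a b c : V} {W W' : L} (hW : W' ≤ W) {ha : W ≤ dom a} {hb : W ≤ dom b}
    {hc : W ≤ dom c} {E : Ob a} {F : Ob b} {G : Ob c} {p q r : ℤ} (h : p + q = r)
    (f : (cat W).Hom (obj hb F) (obj hc G) p) (g : (cat W).Hom (obj ha E) (obj hb F) q),
    res hW ((cat W).comp h f g) = (cat W').comp h (res hW f) (res hW g)
  res_d : ∀ {a b : V} {W W' : L} (hW : W' ≤ W) {ha : W ≤ dom a} {hb : W ≤ dom b} {E : Ob a}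
    {F : Ob b} {p q : ℤ} (h : p + 1 = q) (f : (cat W).Hom (obj ha E) (obj hb F) p),
    res hW ((cat W).d h f) = (cat W').d h (res hW f)
  res_refl : ∀ {a b : V} {W : L} {ha : W ≤ dom a} {hb : W ≤ dom b} {E : Ob a}
    {F : Ob b} {q : ℤ} (f : (cat W).Hom (obj ha E) (obj hb F) q), res le_rfl f = f
  res_res : ∀ {a b : V} {W W' W'' : L} (hW : W' ≤ W) (hW' : W'' ≤ W') {ha : W ≤ dom a}
    {hb : W ≤ dom b} {E : Ob a} {F : Ob b} {q : ℤ} (f : (cat W).Hom (obj ha E) (obj hb F) q),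
    res hW' (res hW f) = res (hW'.trans hW) f

namespace CoeffSystem

variable {V : Type t} {L : Type w} [Preorder L] (S : CoeffSystem.{u, v} V L)
  {rel : V → V → Prop}

/-- The intersection of the regions of the entries of a multi-index. -/
def region {k : ℕ} {a b : V} (s : Simplex rel k a b) : L := S.inter s.v

lemma region_first {k : ℕ} {a b : V} (s : Simplex rel k a b) : S.region s ≤ S.dom a :=
  (S.inter_le s.v 0).trans (le_of_eq (congrArg S.dom s.first))

lemma region_last {k : ℕ} {a b : V} (s : Simplex rel k a b) : S.region s ≤ S.dom b :=
  (S.inter_le s.v (Fin.last k)).trans (le_of_eq (congrArg S.dom s.last))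

lemma region_front {k p r : ℕ} {a b : V} (s : Simplex rel k a b) (h : p + r = k) :
    S.region s ≤ S.region (s.front h) := S.le_inter _ fun x => S.inter_le s.v _

lemma region_back {k p r : ℕ} {a b : V} (s : Simplex rel k a b) (h : p + r = k) :
    S.region s ≤ S.region (s.back h) := S.le_inter _ fun x => S.inter_le s.v _

lemma region_skip {k : ℕ} {a b : V} (s : Simplex rel (k + 1) a b) (j : Fin k) :
    S.region s ≤ S.region (s.skip j) := S.le_inter _ fun x => S.inter_le s.v _

lemma le_region_vertex {a : V} (h : rel a a) :
    S.dom a ≤ S.region (Simplex.vertex rel a h) := S.le_inter _ fun _ => le_rfl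

/-- Restriction as an additive map. -/
def resHom {a b : V} {W W' : L} (hW : W' ≤ W) (ha : W ≤ S.dom a) (hb : W ≤ S.dom b) (E : S.Ob a)
    (F : S.Ob b) (q : ℤ) : (S.cat W).Hom (S.obj ha E) (S.obj hb F) q →+
    (S.cat W').Hom (S.obj (hW.trans ha) E) (S.obj (hW.trans hb) F) q :=
  AddMonoidHom.mk' (S.res hW) (S.res_add hW)

lemma res_zero {a b : V} {W W' : L} (hW : W' ≤ W) {ha : W ≤ S.dom a} {hb : W ≤ S.dom b}
    {E : S.Ob a} {F : S.Ob b} {q : ℤ} :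
    S.res hW (0 : (S.cat W).Hom (S.obj ha E) (S.obj hb F) q) = 0 :=
  map_zero (S.resHom hW ha hb E F q)

lemma res_smul {a b : V} {W W' : L} (hW : W' ≤ W) {ha : W ≤ S.dom a} {hb : W ≤ S.dom b}
    {E : S.Ob a} {F : S.Ob b} {q : ℤ} (e : ℤˣ) (f : (S.cat W).Hom (S.obj ha E) (S.obj hb F) q) :
    S.res hW (e • f) = e • S.res hW f := by
  rw [Units.smul_def, Units.smul_def]
  exact map_zsmul (S.resHom hW ha hb E F q) _ f

lemma res_sum {a b : V} {W W' : L} (hW : W' ≤ W) {ha : W ≤ S.dom a} {hb : W ≤ S.dom b}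
    {E : S.Ob a} {F : S.Ob b} {q : ℤ} {κ : Type*} (t : Finset κ)
    (f : κ → (S.cat W).Hom (S.obj ha E) (S.obj hb F) q) :
    S.res hW (∑ i ∈ t, f i) = ∑ i ∈ t, S.res hW (f i) :=
  map_sum (S.resHom hW ha hb E F q) f t

lemma res_asum {a b : V} {W W' : L} (hW : W' ≤ W) {ha : W ≤ S.dom a} {hb : W ≤ S.dom b}
    {E : S.Ob a} {F : S.Ob b} {q : ℤ} (n : ℕ)
    (f : ∀ p r, p + r = n → (S.cat W).Hom (S.obj ha E) (S.obj hb F) q) :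
    S.res hW (asum n f) = asum n fun p r e => S.res hW (f p r e) :=
  map_asum (S.resHom hW ha hb E F q) n f

/-- The cochains of total degree `m` from `E` to `F`: for all `k + q = m` and all multi-indices
`s = (i_0, …, i_k)`, a morphism of degree `q` from `E_{i_k}` to `F_{i_0}` over the intersection of
the regions of `i_0, …, i_k`. -/
def Cochain (rel : V → V → Prop) (E F : ∀ a, S.Ob a) (m : ℤ) : Type (max t v) :=
  ∀ (k : ℕ) (q : ℤ) (_ : k + q = m) (a b : V) (s : Simplex rel k a b),
    (S.cat (S.region s)).Hom (S.obj (S.region_last s) (E b)) (S.obj (S.region_first s) (F a)) q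

instance (E F : ∀ a, S.Ob a) (m : ℤ) : AddCommGroup (S.Cochain rel E F m) where
  add φ ψ k q h a b s := φ k q h a b s + ψ k q h a b s
  zero k q h a b s := 0
  neg φ k q h a b s := - φ k q h a b s
  add_assoc φ ψ χ := by funext k q h a b s; exact add_assoc _ _ _
  zero_add φ := by funext k q h a b s; exact zero_add _
  add_zero φ := by funext k q h a b s; exact add_zero _
  add_comm φ ψ := by funext k q h a b s; exact add_comm _ _
  neg_add_cancel φ := by funext k q h a b s; exact neg_add_cancel _
  nsmul n φ k q h a b s := n • φ k q h a b s
  nsmul_zero φ := by funext k q h a b s; exact zero_nsmul _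
  nsmul_succ n φ := by funext k q h a b s; exact succ_nsmul _ _
  zsmul n φ k q h a b s := n • φ k q h a b s
  zsmul_zero' φ := by funext k q h a b s; exact zero_zsmul _
  zsmul_succ' n φ := by funext k q h a b s; exact SubNegMonoid.zsmul_succ' _ _
  zsmul_neg' n φ := by funext k q h a b s; exact SubNegMonoid.zsmul_neg' _ _

variable {S}

/-- The component of a cochain at a multi-index `s`, restricted to a smaller region `W`. -/
def Cochain.ev {E F : ∀ a, S.Ob a} {m : ℤ} (φ : S.Cochain rel E F m) {k : ℕ} {q : ℤ}
    (h : k + q = m) {a b : V} (s : Simplex rel k a b) {W : L} (hW : W ≤ S.region s) :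
    (S.cat W).Hom (S.obj (hW.trans (S.region_last s)) (E b))
      (S.obj (hW.trans (S.region_first s)) (F a)) q :=
  S.res hW (φ k q h a b s)

variable (S)

/-- The Čech-type differential
`(δ φ)_{i_0 … i_{k+1}} = ∑_{j = 1}^{k} (-1) ^ j φ_{i_0 … î_j … i_{k+1}}`. -/
def delta {E F : ∀ a, S.Ob a} {m m' : ℤ} (hm : m + 1 = m') (φ : S.Cochain rel E F m) :
    S.Cochain rel E F m' := fun k q h a b s =>
  match k, h, s with
  | 0, _, _ => 0
  | k + 1, h, s => ∑ j : Fin k, ((j.1 : ℤ) + 1).negOnePow •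
      φ.ev (by push_cast at h; omega) (s.skip j) (S.region_skip s j)

/-- The internal differential `(-1) ^ k d (φ_{i_0 … i_k})`. -/
def inner {E F : ∀ a, S.Ob a} {m m' : ℤ} (hm : m + 1 = m') (φ : S.Cochain rel E F m) :
    S.Cochain rel E F m' := fun k q h a b s =>
  (k : ℤ).negOnePow • (S.cat (S.region s)).d (by omega) (φ k (m - k) (by omega) a b s)

/-- The shuffled multiplication
`(φ · η)_{i_0 … i_n} = ∑_{p + r = n} (-1) ^ (q r) φ^{p,q}_{i_0 … i_p} ∘ η^{r,s}_{i_p … i_n}`. -/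
def mul {E F G : ∀ a, S.Ob a} {m₁ m₂ m : ℤ} (hm : m₁ + m₂ = m) (φ : S.Cochain rel F G m₁)
    (η : S.Cochain rel E F m₂) : S.Cochain rel E G m := fun n q h a b s =>
  asum n fun p r hpr => ((m₁ - p) * r).negOnePow • (S.cat (S.region s)).comp (by omega)
    (φ.ev (q := m₁ - p) (by omega) (s.front hpr) (S.region_front s hpr))
    (η.ev (q := m₂ - r) (by omega) (s.back hpr) (S.region_back s hpr))

/-- The identity of the object `E_a = E_b` for `a = b`. -/
def idOn (E : ∀ a, S.Ob a) {a b : V} (hab : a = b) {W : L} (ha : W ≤ S.dom a) (hb : W ≤ S.dom b)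
    {q : ℤ} (hq : q = 0) : (S.cat W).Hom (S.obj hb (E b)) (S.obj ha (E a)) q := by
  cases hab
  exact (S.cat W).unit _ hq

/-- The unit cochain: the identity at each one-entry multi-index, and `0` at the longer ones. -/
def oneCochain (E : ∀ a, S.Ob a) : S.Cochain rel E E 0 := fun k q h a b s =>
  if hk : k = 0 then
    S.idOn E (s.first_eq_last hk) (S.region_first s) (S.region_last s) (by omega)
  else 0

variable {S}

section ev

variable {E F G : ∀ a, S.Ob a} {m m' : ℤ}

lemma ev_congr (φ : S.Cochain rel E F m) {k : ℕ} {q : ℤ}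
    (h : k + q = m) {a b : V} (s s' : Simplex rel k a b) (hs : s.v = s'.v) {W : L}
    (hW : W ≤ S.region s) (hW' : W ≤ S.region s') : φ.ev h s hW = φ.ev h s' hW' := by
  obtain rfl : s = s' := Simplex.ext hs
  rfl

lemma ev_self (φ : S.Cochain rel E F m) {k : ℕ} {q : ℤ} (h : k + q = m) {a b : V}
    (s : Simplex rel k a b) (hW : S.region s ≤ S.region s) :
    φ.ev h s hW = φ k q h a b s := S.res_refl _

lemma res_ev (φ : S.Cochain rel E F m) {k : ℕ} {q : ℤ} (h : k + q = m) {a b : V}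
    (s : Simplex rel k a b) {W W' : L} (hW : W ≤ S.region s) (hW' : W' ≤ W) :
    S.res hW' (φ.ev h s hW) = φ.ev h s (hW'.trans hW) := S.res_res _ _ _

lemma ev_add (φ ψ : S.Cochain rel E F m) {k : ℕ} {q : ℤ} (h : k + q = m) {a b : V}
    (s : Simplex rel k a b) {W : L} (hW : W ≤ S.region s) :
    Cochain.ev (φ + ψ) h s hW = φ.ev h s hW + ψ.ev h s hW := S.res_add _ _ _

lemma ev_delta_zero (hm : m + 1 = m') (φ : S.Cochain rel E F m) {q : ℤ} (h : (0 : ℕ) + q = m')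
    {a b : V} (s : Simplex rel 0 a b) {W : L} (hW : W ≤ S.region s) :
    (S.delta hm φ).ev h s hW = 0 := S.res_zero _

lemma ev_delta_succ (hm : m + 1 = m') (φ : S.Cochain rel E F m) {k : ℕ} {q : ℤ}
    (h : ((k + 1 : ℕ) : ℤ) + q = m') (h' : k + q = m)
    {a b : V} (s : Simplex rel (k + 1) a b) {W : L} (hW : W ≤ S.region s) :
    (S.delta hm φ).ev h s hW = ∑ j : Fin k, ((j.1 : ℤ) + 1).negOnePow •
      φ.ev h' (s.skip j) (hW.trans (S.region_skip s j)) := by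
  refine (S.res_sum _ _ _).trans (Finset.sum_congr rfl fun j _ => ?_)
  rw [S.res_smul, res_ev]

lemma ev_inner (hm : m + 1 = m') (φ : S.Cochain rel E F m) {k : ℕ} {q q' : ℤ} (h : k + q' = m')
    (h' : k + q = m) {a b : V} (s : Simplex rel k a b) {W : L} (hW : W ≤ S.region s) :
    (S.inner hm φ).ev h s hW = (k : ℤ).negOnePow • (S.cat W).d (by omega) (φ.ev h' s hW) := by
  obtain rfl : q = m - k := by omega
  refine (S.res_smul _ _ _).trans ?_
  rw [S.res_d]; rfl

lemma ev_mul {m₁ m₂ : ℤ} (hm : m₁ + m₂ = m) (φ : S.Cochain rel F G m₁)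
    (η : S.Cochain rel E F m₂) {n : ℕ} {q : ℤ} (h : n + q = m) {a b : V}
    (s : Simplex rel n a b) {W : L} (hW : W ≤ S.region s) :
    (S.mul hm φ η).ev h s hW =
      asum n fun p r hpr => ((m₁ - p) * r).negOnePow • (S.cat W).comp (by omega)
        (φ.ev (q := m₁ - p) (by omega) (s.front hpr) (hW.trans (S.region_front s hpr)))
        (η.ev (q := m₂ - r) (by omega) (s.back hpr) (hW.trans (S.region_back s hpr))) := by
  refine (S.res_asum _ _ _).trans (asum_congr fun p r e => ?_)
  rw [S.res_smul, S.res_comp, res_ev, res_ev]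

lemma comp_congr {m₁ m₂ : ℤ} (φ : S.Cochain rel F G m₁) (η : S.Cochain rel E F m₂) {p r : ℕ}
    {q₁ q₁' q₂ q₂' q : ℤ} (h₁ : p + q₁ = m₁) (h₁' : p + q₁' = m₁) (h₂ : r + q₂ = m₂)
    (h₂' : r + q₂' = m₂) (hq : q₁ + q₂ = q) (hq' : q₁' + q₂' = q) {a b c c' : V} (hc : c = c')
    (s : Simplex rel p a c) (s' : Simplex rel p a c') (hs : s.v = s'.v)
    (σ : Simplex rel r c b) (σ' : Simplex rel r c' b) (hσ : σ.v = σ'.v) {W : L}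
    (hW₁ : W ≤ S.region s) (hW₁' : W ≤ S.region s') (hW₂ : W ≤ S.region σ)
    (hW₂' : W ≤ S.region σ') :
    (S.cat W).comp hq (φ.ev h₁ s hW₁) (η.ev h₂ σ hW₂) =
      (S.cat W).comp hq' (φ.ev h₁' s' hW₁') (η.ev h₂' σ' hW₂') := by
  subst hc
  obtain rfl : s = s' := Simplex.ext hs
  obtain rfl : σ = σ' := Simplex.ext hσ
  obtain rfl : q₁ = q₁' := by omega
  obtain rfl : q₂ = q₂' := by omega
  rfl

lemma comp_comp_congr {H : ∀ a, S.Ob a} {m₁ m₂ m₃ : ℤ} (φ : S.Cochain rel G H m₁)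
    (η : S.Cochain rel F G m₂) (ζ : S.Cochain rel E F m₃) {p q r : ℕ} {q₁ q₂ q₃ q₂₃ q₂₃' d : ℤ}
    (h₁ : p + q₁ = m₁) (h₂ : q + q₂ = m₂) (h₃ : r + q₃ = m₃)
    (hq : q₁ + q₂₃ = d) (hq' : q₁ + q₂₃' = d) (hr : q₂ + q₃ = q₂₃) (hr' : q₂ + q₃ = q₂₃')
    {a b c c' e e' : V} (hc : c = c') (he : e = e')
    (s : Simplex rel p a c) (s' : Simplex rel p a c') (hs : s.v = s'.v)
    (σ : Simplex rel q c e) (σ' : Simplex rel q c' e') (hσ : σ.v = σ'.v)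
    (τ : Simplex rel r e b) (τ' : Simplex rel r e' b) (hτ : τ.v = τ'.v) {W : L}
    (hW₁ : W ≤ S.region s) (hW₁' : W ≤ S.region s') (hW₂ : W ≤ S.region σ)
    (hW₂' : W ≤ S.region σ') (hW₃ : W ≤ S.region τ) (hW₃' : W ≤ S.region τ') :
    (S.cat W).comp hq (φ.ev h₁ s hW₁) ((S.cat W).comp hr (η.ev h₂ σ hW₂) (ζ.ev h₃ τ hW₃)) =
      (S.cat W).comp hq' (φ.ev h₁ s' hW₁')
        ((S.cat W).comp hr' (η.ev h₂ σ' hW₂') (ζ.ev h₃ τ' hW₃')) := by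
  subst hc he
  obtain rfl : s = s' := Simplex.ext hs
  obtain rfl : σ = σ' := Simplex.ext hσ
  obtain rfl : τ = τ' := Simplex.ext hτ
  obtain rfl : q₂₃ = q₂₃' := by omega
  rfl

lemma res_idOn (E : ∀ a, S.Ob a) {a b : V} (hab : a = b) {W W' : L} (hW : W' ≤ W)
    (ha : W ≤ S.dom a) (hb : W ≤ S.dom b) {q : ℤ} (hq : q = 0) :
    S.res hW (S.idOn E hab ha hb hq) = S.idOn E hab (hW.trans ha) (hW.trans hb) hq := by
  subst hab hq
  exact S.res_one _ _ _

lemma ev_one_zero {q : ℤ} (h : (0 : ℕ) + q = 0) {a b : V} (s : Simplex rel 0 a b) {W : L}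
    (hW : W ≤ S.region s) : (S.oneCochain E).ev h s hW =
      S.idOn E (s.first_eq_last rfl) (hW.trans (S.region_first s)) (hW.trans (S.region_last s))
        (by omega) := by
  unfold Cochain.ev oneCochain
  rw [dif_pos rfl, res_idOn]

lemma ev_one_of_ne {k : ℕ} (hk : k ≠ 0) {q : ℤ} (h : k + q = 0) {a b : V}
    (s : Simplex rel k a b) {W : L} (hW : W ≤ S.region s) :
    (S.oneCochain E).ev h s hW = 0 := by
  unfold Cochain.ev oneCochain
  rw [dif_neg hk, S.res_zero]

lemma idOn_comp (φ : S.Cochain rel E F m) {k : ℕ} {q q' q₀ : ℤ} (h : k + q = m) (h' : k + q' = m)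
    {a b c : V} (hac : a = c) (s : Simplex rel k c b) (s' : Simplex rel k a b)
    (hs : s.v = s'.v) {W : L}
    (hW : W ≤ S.region s) (hW' : W ≤ S.region s') (ha : W ≤ S.dom a) (hc : W ≤ S.dom c)
    (hq : q₀ = 0) (hqq : q₀ + q = q') :
    (S.cat W).comp hqq (S.idOn F hac ha hc hq) (φ.ev h s hW) = φ.ev h' s' hW' := by
  subst hac hq
  obtain rfl : s = s' := Simplex.ext hs
  obtain rfl : q = q' := by omega
  exact (S.cat W).one_comp _ _

lemma comp_idOn (φ : S.Cochain rel E F m) {k : ℕ} {q q' q₀ : ℤ} (h : k + q = m) (h' : k + q' = m)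
    {a b c : V} (hcb : c = b) (s : Simplex rel k a c) (s' : Simplex rel k a b)
    (hs : s.v = s'.v) {W : L}
    (hW : W ≤ S.region s) (hW' : W ≤ S.region s') (hc : W ≤ S.dom c) (hb : W ≤ S.dom b)
    (hq : q₀ = 0) (hqq : q + q₀ = q') :
    (S.cat W).comp hqq (φ.ev h s hW) (S.idOn E hcb hc hb hq) = φ.ev h' s' hW' := by
  subst hcb hq
  obtain rfl : s = s' := Simplex.ext hs
  obtain rfl : q = q' := by omega
  exact (S.cat W).comp_one _ _

lemma cochain_ext {φ ψ : S.Cochain rel E F m}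
    (h : ∀ (k : ℕ) (q : ℤ) (hq : k + q = m) (a b : V) (s : Simplex rel k a b),
      φ.ev hq s le_rfl = ψ.ev hq s le_rfl) : φ = ψ := by
  funext k q hq a b s
  have := h k q hq a b s
  rwa [ev_self, ev_self] at this

end ev

section laws

variable {E F G H : ∀ a, S.Ob a} {m : ℤ}

lemma ev_smul (φ : S.Cochain rel E F m) (e : ℤˣ) {k : ℕ} {q : ℤ} (h : k + q = m) {a b : V}
    (s : Simplex rel k a b) {W : L} (hW : W ≤ S.region s) :
    Cochain.ev (e • φ) h s hW = e • φ.ev h s hW := S.res_smul _ _ _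

lemma ev_zero {k : ℕ} {q : ℤ} (h : k + q = m) {a b : V}
    (s : Simplex rel k a b) {W : L} (hW : W ≤ S.region s) :
    Cochain.ev (0 : S.Cochain rel E F m) h s hW = 0 := S.res_zero _

lemma sum_face_cancel {A : Type*} [AddCommGroup A] (k : ℕ) (T : Fin (k + 1) → Fin k → A)
    (h : ∀ (j j' : Fin (k + 1)) (i i' : Fin k), i.1 < j.1 → j'.1 = i.1 → i'.1 + 1 = j.1 →
      T j i + T j' i' = 0) : ∑ j, ∑ i, T j i = 0 := by
  rw [← Finset.sum_product' _ _ T]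
  refine Finset.sum_involution (fun x _ => if h : x.2.1 < x.1.1 then
      (⟨x.2.1, by omega⟩, ⟨x.1.1 - 1, by omega⟩)
    else (⟨x.2.1 + 1, by omega⟩, ⟨x.1.1, by omega⟩)) ?_ ?_ ?_ ?_
  · rintro ⟨j, i⟩ -
    by_cases h' : i.1 < j.1
    · simp only [dif_pos h']
      exact h _ _ _ _ h' rfl (by simp only; omega)
    · simp only [dif_neg h']
      rw [add_comm]
      exact h _ _ _ _ (by simp only; omega) rfl rfl
  · rintro ⟨j, i⟩ - - h
    by_cases h' : i.1 < j.1
    · simp only [dif_pos h', Prod.mk.injEq, Fin.ext_iff] at h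
      omega
    · simp only [dif_neg h', Prod.mk.injEq, Fin.ext_iff] at h
      omega
  · intros; simp
  · rintro ⟨j, i⟩ -
    by_cases h : i.1 < j.1
    · have : ¬ (j.1 - 1 < i.1) := by omega
      simp only [dif_pos h, dif_neg this]
      exact Prod.ext (Fin.ext (by simp only; omega)) (Fin.ext rfl)
    · have : j.1 < i.1 + 1 := by omega
      simp only [dif_neg h, dif_pos this]
      exact Prod.ext (Fin.ext rfl) (Fin.ext (by simp only; omega))

lemma delta_delta {m' m'' : ℤ} (hm : m + 1 = m') (hm' : m' + 1 = m'')
    (φ : S.Cochain rel E F m) : S.delta hm' (S.delta hm φ) = 0 := by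
  refine cochain_ext fun k q hq a b s => ?_
  rw [ev_zero]
  rcases k with _ | _ | k
  · rw [ev_delta_zero]
  · rw [ev_delta_succ (h' := by push_cast at hq ⊢; omega)]
    simp
  · rw [ev_delta_succ (h' := by push_cast at hq ⊢; omega)]
    have hk : (k : ℤ) + q = m := by push_cast at hq ⊢; omega
    have e : ∀ j ∈ (Finset.univ : Finset (Fin (k + 1))), ((j.1 : ℤ) + 1).negOnePow •
        (S.delta hm φ).ev (k := k + 1) (q := q) (by push_cast at hq ⊢; omega) (s.skip j)
          (le_rfl.trans (S.region_skip s j)) =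
        ∑ i : Fin k, (((j.1 : ℤ) + 1).negOnePow * ((i.1 : ℤ) + 1).negOnePow) •
          φ.ev hk ((s.skip j).skip i) ((S.region_skip s j).trans (S.region_skip _ i)) := by
      intro j _
      rw [ev_delta_succ (h' := hk), Finset.smul_sum]
      exact Finset.sum_congr rfl fun i _ => smul_smul _ _ _
    refine (Finset.sum_congr rfl e).trans ?_
    refine sum_face_cancel k _ fun j j' i i' h hj hi => ?_
    have e1 : ((j.1 : ℤ) + 1).negOnePow = - ((i'.1 : ℤ) + 1).negOnePow := by
      rw [← Int.negOnePow_succ]; congr 1; omega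
    have e2 : ((j'.1 : ℤ) + 1).negOnePow = ((i.1 : ℤ) + 1).negOnePow := by rw [hj]
    rw [ev_congr φ hk _ ((s.skip j').skip i') (by
      funext x
      refine congrArg s.v (Fin.ext ?_)
      simp only
      split_ifs <;> omega) _ ((S.region_skip s _).trans (S.region_skip _ _)), e1, e2, neg_mul,
      Units.neg_smul, mul_comm, neg_add_cancel]

lemma inner_inner {m' m'' : ℤ} (hm : m + 1 = m') (hm' : m' + 1 = m'')
    (φ : S.Cochain rel E F m) : S.inner hm' (S.inner hm φ) = 0 := by
  refine cochain_ext fun k q hq a b s => ?_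
  rw [ev_zero, ev_inner (q := m' - k) (h' := by omega), ev_inner (q := m - k) (h' := by omega),
    DGCat.d_smul, DGCat.d_d, smul_zero, smul_zero]

lemma delta_inner {m' m'' : ℤ} (hm : m + 1 = m') (hm' : m' + 1 = m'')
    (φ : S.Cochain rel E F m) : S.delta hm' (S.inner hm φ) + S.inner hm' (S.delta hm φ) = 0 := by
  refine cochain_ext fun k q hq a b s => ?_
  rw [ev_zero, ev_add, ev_inner (q := m' - k) (h' := by omega)]
  rcases k with _ | k
  · rw [ev_delta_zero, ev_delta_zero, DGCat.d_zero, smul_zero, add_zero]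
  · rw [ev_delta_succ (h' := by push_cast at hq ⊢; omega),
      ev_delta_succ (h' := by push_cast at hq ⊢; omega), DGCat.d_sum, Finset.smul_sum,
      ← Finset.sum_add_distrib]
    refine Finset.sum_eq_zero fun j _ => ?_
    rw [ev_inner (q := m' - (k + 1 : ℕ)) (h' := by push_cast; omega), DGCat.d_smul, smul_smul,
      smul_smul]
    push_cast
    rw [Int.negOnePow_succ (k : ℤ), neg_mul, mul_comm, Units.neg_smul, add_neg_cancel]

lemma mul_assoc' {m₁ m₂ m₃ m₁₂ m₂₃ : ℤ} (h₁ : m₁ + m₂ = m₁₂) (h₂ : m₂ + m₃ = m₂₃)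
    (h₃ : m₁₂ + m₃ = m) (h₄ : m₁ + m₂₃ = m) (φ : S.Cochain rel G H m₁)
    (η : S.Cochain rel F G m₂) (ζ : S.Cochain rel E F m₃) :
    S.mul h₃ (S.mul h₁ φ η) ζ = S.mul h₄ φ (S.mul h₂ η ζ) := by
  refine cochain_ext fun n d hn a b s => ?_
  rw [ev_mul, ev_mul]
  let g : ∀ p q r : ℕ, p + q + r = n → (S.cat (S.region s)).Hom
      (S.obj (S.region_last s) (E b)) (S.obj (S.region_first s) (H a)) d := fun p q r e =>
    ((m₁ - p) * q + (m₁ - p) * r + (m₂ - q) * r).negOnePow •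
      (S.cat (S.region s)).comp (q := m₂ - q + (m₃ - r)) (r := d) (by omega)
        (φ.ev (q := m₁ - p) (by omega) (s.front (show p + (q + r) = n by omega))
          (S.region_front s _))
        ((S.cat (S.region s)).comp rfl
          (η.ev (q := m₂ - q) (by omega) ((s.back (show p + (q + r) = n by omega)).front rfl)
            ((S.region_back s _).trans (S.region_front _ _)))
          (ζ.ev (q := m₃ - r) (by omega) ((s.back (show p + (q + r) = n by omega)).back rfl)
            ((S.region_back s _).trans (S.region_back _ _))))
  refine Eq.trans (asum_congr (g := fun x r h => asum x (fun p q h' => g p q r (by omega))) ?_)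
    ((asum_assoc n g).trans (asum_congr ?_))
  · intro x r h
    rw [ev_mul, DGCat.asum_comp, smul_asum]
    refine asum_congr fun p q h' => ?_
    subst h'
    rw [DGCat.smul_comp, smul_smul]
    refine Eq.trans (congrArg _ (DGCat.comp_assoc _ (qr := m₂ - q + (m₃ - r)) _ rfl _
      (by omega) _ _ _)) ?_
    refine congrArg₂ (· • ·) ?_ (comp_comp_congr φ η ζ _ _ _ _ _ _ _ rfl rfl _ _ rfl _ _ rfl
      _ _ ?_ _ _ _ _ _ _)
    · rw [← Int.negOnePow_add]; congr 1; subst h₁; push_cast; ring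
    · funext x
      exact congrArg s.v (Fin.ext (add_assoc _ _ _))
  · intro p y h
    rw [ev_mul, DGCat.comp_asum, smul_asum]
    refine asum_congr fun q r h' => ?_
    subst h'
    rw [DGCat.comp_smul, smul_smul]
    refine congrArg₂ (· • ·) ?_ (comp_comp_congr φ η ζ _ _ _ _ _ _ _ rfl rfl _ _ rfl _ _ rfl
      _ _ rfl _ _ _ _ _ _)
    rw [← Int.negOnePow_add]; congr 1; push_cast; ring

lemma add_mul' {m₁ m₂ : ℤ} (h : m₁ + m₂ = m) (φ φ' : S.Cochain rel F G m₁)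
    (η : S.Cochain rel E F m₂) : S.mul h (φ + φ') η = S.mul h φ η + S.mul h φ' η := by
  refine cochain_ext fun n d hn a b s => ?_
  rw [ev_add, ev_mul, ev_mul, ev_mul, ← asum_add]
  refine asum_congr fun p r e => ?_
  rw [ev_add, DGCat.add_comp, smul_add]

lemma mul_add' {m₁ m₂ : ℤ} (h : m₁ + m₂ = m) (φ : S.Cochain rel F G m₁)
    (η η' : S.Cochain rel E F m₂) : S.mul h φ (η + η') = S.mul h φ η + S.mul h φ η' := by
  refine cochain_ext fun n d hn a b s => ?_
  rw [ev_add, ev_mul, ev_mul, ev_mul, ← asum_add]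
  refine asum_congr fun p r e => ?_
  rw [ev_add, DGCat.comp_add, smul_add]

lemma one_mul' (h : 0 + m = m) (φ : S.Cochain rel E F m) :
    S.mul h (S.oneCochain F) φ = φ := by
  refine cochain_ext fun n d hn a b s => ?_
  rw [ev_mul, asum_first]
  · rw [ev_one_zero]
    refine Eq.trans (congrArg₂ (· • ·) ?_ (idOn_comp φ _ hn s.first.symm (s.back _) s
      (funext fun x => congrArg s.v (Fin.ext (zero_add _))) _ le_rfl _ _ _ _)) (one_smul ℤˣ _)
    simp
  · intro p r e hp
    rw [ev_one_of_ne hp, DGCat.zero_comp, smul_zero]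

lemma mul_one' (h : m + 0 = m) (φ : S.Cochain rel E F m) :
    S.mul h φ (S.oneCochain E) = φ := by
  refine cochain_ext fun n d hn a b s => ?_
  rw [ev_mul, asum_last]
  · rw [ev_one_zero]
    refine Eq.trans (congrArg₂ (· • ·) ?_ (comp_idOn φ _ hn s.last (s.front _) s rfl _ le_rfl
      _ _ _ _)) (one_smul ℤˣ _)
    simp
  · intro p r e hp
    rw [ev_one_of_ne hp, DGCat.comp_zero, smul_zero]

lemma delta_add {m' : ℤ} (hm : m + 1 = m') (φ ψ : S.Cochain rel E F m) :
    S.delta hm (φ + ψ) = S.delta hm φ + S.delta hm ψ := by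
  refine cochain_ext fun k q hq a b s => ?_
  rw [ev_add]
  rcases k with _ | k
  · simp only [ev_delta_zero, add_zero]
  · have hk : (k : ℤ) + q = m := by push_cast at hq; omega
    rw [ev_delta_succ (h' := hk), ev_delta_succ (h' := hk), ev_delta_succ (h' := hk),
      ← Finset.sum_add_distrib]
    exact Finset.sum_congr rfl fun j _ => by rw [ev_add, smul_add]

lemma inner_add {m' : ℤ} (hm : m + 1 = m') (φ ψ : S.Cochain rel E F m) :
    S.inner hm (φ + ψ) = S.inner hm φ + S.inner hm ψ := by
  refine cochain_ext fun k q hq a b s => ?_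
  have hk : (k : ℤ) + (m - k) = m := by omega
  rw [ev_add, ev_inner (h' := hk), ev_inner (h' := hk), ev_inner (h' := hk), ev_add,
    DGCat.d_add, smul_add]

lemma inner_mul {m₁ m₂ m₁' m₂' m' : ℤ} (h : m₁ + m₂ = m) (hp : m₁ + 1 = m₁') (hq : m₂ + 1 = m₂')
    (hr : m + 1 = m') (h₁ : m₁' + m₂ = m') (h₂ : m₁ + m₂' = m') (φ : S.Cochain rel F G m₁)
    (η : S.Cochain rel E F m₂) : S.inner hr (S.mul h φ η) =
      S.mul h₁ (S.inner hp φ) η + m₁.negOnePow • S.mul h₂ φ (S.inner hq η) := by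
  refine cochain_ext fun n d hn a b s => ?_
  rw [ev_inner (q := m - n) (h' := by omega), ev_mul, ev_add, ev_smul, ev_mul, ev_mul,
    DGCat.d_asum, smul_asum, smul_asum, ← asum_add]
  refine asum_congr fun p r e => ?_
  rw [ev_inner (k := p) (q := m₁ - p) (h' := by omega),
    ev_inner (k := r) (q := m₂ - r) (h' := by omega), DGCat.d_smul,
    DGCat.d_comp (p' := m₁' - p) (q' := m₂' - r) _ _ (by omega) (by omega) _ (by omega) (by omega),
    DGCat.smul_comp, DGCat.comp_smul, smul_add, smul_add]
  simp only [smul_smul, ← Int.negOnePow_add]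
  subst hp e
  refine congrArg₂ (· + ·) (congrArg₂ (· • ·) ?_ rfl) (congrArg₂ (· • ·) ?_ rfl)
  · congr 1; push_cast; ring
  · congr 1; push_cast; ring

lemma delta_mul {m₁ m₂ m₁' m₂' m' : ℤ} (h : m₁ + m₂ = m) (hp : m₁ + 1 = m₁') (hq : m₂ + 1 = m₂')
    (hr : m + 1 = m') (h₁ : m₁' + m₂ = m') (h₂ : m₁ + m₂' = m') (φ : S.Cochain rel F G m₁)
    (η : S.Cochain rel E F m₂) : S.delta hr (S.mul h φ η) =
      S.mul h₁ (S.delta hp φ) η + m₁.negOnePow • S.mul h₂ φ (S.delta hq η) := by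
  refine cochain_ext fun n d hn a b s => ?_
  rw [ev_add, ev_smul]
  rcases n with _ | n
  · rw [ev_delta_zero, ev_mul, ev_mul, asum_zero, asum_zero, ev_delta_zero, ev_delta_zero,
      DGCat.zero_comp, DGCat.comp_zero, smul_zero, smul_zero, smul_zero, add_zero]
  · have hn' : (n : ℤ) + d = m := by push_cast at hn; omega
    rw [ev_delta_succ (h' := hn'), ev_mul, ev_mul, asum_succ, asum_succ', ev_delta_zero,
      ev_delta_zero, DGCat.zero_comp, DGCat.comp_zero, smul_zero, smul_zero, zero_add, zero_add,
      smul_asum, ← asum_add]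
    rw [Finset.sum_congr rfl (fun j _ => by rw [ev_mul, smul_asum]), asum_sum_comm]
    refine asum_congr fun p r e => ?_
    subst e
    rw [Fin.sum_univ_add, ev_delta_succ (k := p)
        (h' := show (p : ℤ) + (m₁' - (p + 1 : ℕ)) = m₁ by push_cast; omega),
      ev_delta_succ (k := r)
        (h' := show (r : ℤ) + (m₂' - (r + 1 : ℕ)) = m₂ by push_cast; omega),
      DGCat.sum_comp, DGCat.comp_sum, Finset.smul_sum, Finset.smul_sum, Finset.smul_sum]
    refine congrArg₂ (· + ·) (Finset.sum_congr rfl fun j _ => ?_)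
      (Finset.sum_congr rfl fun j _ => ?_)
    · rw [DGCat.smul_comp, smul_smul, smul_smul]
      refine congrArg₂ (· • ·) ?_ (comp_congr φ η _ _ _ _ _ _ ?_ _ _ ?_ _ _ ?_ _ _ _ _)
      · rw [mul_comm]; subst hp; push_cast; congr 2; ring
      · refine congrArg s.v (Fin.ext ?_)
        have := j.2
        simp only [Fin.val_castAdd]
        split_ifs <;> omega
      · rfl
      · funext x
        refine congrArg s.v (Fin.ext ?_)
        have := j.2
        simp only [Fin.val_castAdd]
        split_ifs <;> omega
    · rw [DGCat.comp_smul, smul_smul, smul_smul, smul_smul]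
      refine congrArg₂ (· • ·) ?_ (comp_congr φ η _ _ _ _ _ _ ?_ _ _ ?_ _ _ ?_ _ _ _ _)
      · rw [← Int.negOnePow_add, ← Int.negOnePow_add, ← Int.negOnePow_add,
          Int.negOnePow_eq_iff]
        refine ⟨p - m₁, ?_⟩
        rw [Fin.val_natAdd]
        push_cast
        ring
      · refine congrArg s.v (Fin.ext ?_)
        simp only [Fin.val_natAdd]
        split_ifs <;> omega
      · funext x
        refine congrArg s.v (Fin.ext ?_)
        simp only [Fin.val_natAdd]
        split_ifs <;> omega
      · funext x
        refine congrArg s.v (Fin.ext ?_)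
        simp only [Fin.val_natAdd]
        split_ifs <;> omega

end laws

variable (S) in
/-- The dg-category of cochains: an object is a family `E` of objects `E_a`, a morphism of degree
`m` is a cochain of total degree `m`, the composition is the shuffled multiplication, and the
differential is
`(D φ)_{i_0 … i_k} = (-1) ^ k d (φ_{i_0 … i_k}) + ∑_{j = 1}^{k - 1} (-1) ^ j φ_{i_0 … î_j … i_k}`. -/
def cochains (rel : V → V → Prop) : DGCat where
  Ob := ∀ a, S.Ob a
  Hom E F m := S.Cochain rel E F m
  one E := S.oneCochain E
  comp h φ η := S.mul h φ η
  d h φ := S.inner h φ + S.delta h φ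
  add_comp h φ φ' η := add_mul' h φ φ' η
  comp_add h φ η η' := mul_add' h φ η η'
  comp_assoc h₁ h₂ h₃ h₄ φ η ζ := mul_assoc' h₁ h₂ h₃ h₄ φ η ζ
  one_comp h φ := one_mul' h φ
  comp_one h φ := mul_one' h φ
  d_add h φ ψ := by rw [inner_add, delta_add]; abel
  d_d h h' φ := by
    rw [inner_add, delta_add, inner_inner, delta_delta, zero_add, add_zero, add_comm,
      delta_inner]
  d_comp h hp hq hr h₁ h₂ φ η := by
    rw [inner_mul h hp hq hr h₁ h₂, delta_mul h hp hq hr h₁ h₂, add_mul', mul_add', smul_add]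
    abel

end CoeffSystem

/-! ### Sheaves of modules and their complexes -/

section Sheaves

variable {X : TopCat.{u}} (R : X.Sheaf RingCat.{v})

/-- A sheaf of left modules over the restriction of the sheaf of rings `R` to the open set `U`.
Open subsets of `U` are given as open subsets `V ≤ U` of `X`, which makes the restriction to
smaller open sets strictly functorial. -/
structure ModSheaf (U : Opens X) : Type (max u v (w + 1)) where
  obj : ∀ V : Opens X, V ≤ U → ModuleCat.{w} (R.presheaf.obj (op V))
  map : ∀ {V W : Opens X} (hV : V ≤ U) (h : W ≤ V), obj V hV →+ obj W (h.trans hV)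
  map_smul : ∀ {V W : Opens X} (hV : V ≤ U) (h : W ≤ V) (r : R.presheaf.obj (op V))
    (x : obj V hV), map hV h (r • x) = (R.presheaf.map (homOfLE h).op).hom r • map hV h x
  map_refl : ∀ {V : Opens X} (hV : V ≤ U) (x : obj V hV), map hV le_rfl x = x
  map_map : ∀ {V W Z : Opens X} (hV : V ≤ U) (h : W ≤ V) (h' : Z ≤ W) (x : obj V hV),
    map (h.trans hV) h' (map hV h x) = map hV (h'.trans h) x
  /-- compatible local sections glue uniquely -/
  glue : ∀ {κ : Type u} (C : κ → Opens X) (hC : ∀ i, C i ≤ U) (x : ∀ i, obj (C i) (hC i)),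
    (∀ i j, map (hC i) (inf_le_left : C i ⊓ C j ≤ C i) (x i) =
      map (hC j) (inf_le_right : C i ⊓ C j ≤ C j) (x j)) →
    ∃! y : obj (⨆ i, C i) (iSup_le hC), ∀ i, map (iSup_le hC) (le_iSup C i) y = x i

namespace ModSheaf

variable {R} {U : Opens X}

/-- A morphism of sheaves of modules. -/
@[ext]
structure Hom (M N : ModSheaf.{u, v, w} R U) where
  app : ∀ (V : Opens X) (hV : V ≤ U), M.obj V hV →ₗ[R.presheaf.obj (op V)] N.obj V hV
  naturality : ∀ {V W : Opens X} (hV : V ≤ U) (h : W ≤ V) (x : M.obj V hV),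
    app W (h.trans hV) (M.map hV h x) = N.map hV h (app V hV x)

instance : Category (ModSheaf.{u, v, w} R U) where
  Hom M N := Hom M N
  id M := { app := fun V hV => LinearMap.id, naturality := fun _ _ _ => rfl }
  comp f g :=
    { app := fun V hV => (g.app V hV).comp (f.app V hV)
      naturality := fun hV h x => by simp [f.naturality, g.naturality] }

instance (M N : ModSheaf.{u, v, w} R U) : AddCommGroup (M ⟶ N) where
  add f g := ⟨fun V hV => f.app V hV + g.app V hV, fun hV h x => by
    simp [f.naturality, g.naturality]⟩
  zero := ⟨fun V hV => 0, fun hV h x => by simp⟩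
  neg f := ⟨fun V hV => - f.app V hV, fun hV h x => by simp [f.naturality]⟩
  add_assoc f g h := Hom.ext (by funext V hV; exact add_assoc _ _ _)
  zero_add f := Hom.ext (by funext V hV; exact zero_add _)
  add_zero f := Hom.ext (by funext V hV; exact add_zero _)
  add_comm f g := Hom.ext (by funext V hV; exact add_comm _ _)
  neg_add_cancel f := Hom.ext (by funext V hV; exact neg_add_cancel _)
  nsmul n f := ⟨fun V hV => n • f.app V hV, fun hV h x => by simp [f.naturality]⟩
  nsmul_zero f := Hom.ext (by funext V hV; exact zero_nsmul _)
  nsmul_succ n f := Hom.ext (by funext V hV; exact succ_nsmul _ _)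
  zsmul n f := ⟨fun V hV => n • f.app V hV, fun hV h x => by simp [f.naturality]⟩
  zsmul_zero' f := Hom.ext (by funext V hV; exact zero_zsmul _)
  zsmul_succ' n f := Hom.ext (by funext V hV; exact SubNegMonoid.zsmul_succ' _ _)
  zsmul_neg' n f := Hom.ext (by funext V hV; exact SubNegMonoid.zsmul_neg' _ _)

instance : Preadditive (ModSheaf.{u, v, w} R U) where
  add_comp M N P f f' g := Hom.ext (by funext V hV; exact LinearMap.comp_add _ _ _)
  comp_add M N P f g g' := Hom.ext (by funext V hV; exact LinearMap.add_comp _ _ _)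

/-- The restriction of a sheaf of modules to a smaller open set. -/
def restrict (M : ModSheaf.{u, v, w} R U) {W : Opens X} (h : W ≤ U) : ModSheaf.{u, v, w} R W where
  obj V hV := M.obj V (hV.trans h)
  map hV h' := M.map (hV.trans h) h'
  map_smul hV h' := M.map_smul (hV.trans h) h'
  map_refl hV := M.map_refl (hV.trans h)
  map_map hV := M.map_map (hV.trans h)
  glue C hC x := M.glue C (fun i => (hC i).trans h) x

/-- The restriction of a morphism of sheaves of modules to a smaller open set. -/
def resHom {M N : ModSheaf.{u, v, w} R U} (f : M ⟶ N) {W : Opens X} (h : W ≤ U) :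
    M.restrict h ⟶ N.restrict h where
  app V hV := Hom.app f V (hV.trans h)
  naturality hV h' x := Hom.naturality f (hV.trans h) h' x

end ModSheaf

end Sheaves

/-- Homogeneous maps of degree `q` between `ℤ`-graded objects. -/
def GHom {C : Type u} [Category.{v} C] [Preadditive C] (E F : ℤ → C) (q : ℤ) : Type v :=
  ∀ p p' : ℤ, p + q = p' → (E p ⟶ F p')

instance {C : Type u} [Category.{v} C] [Preadditive C] (E F : ℤ → C) (q : ℤ) :
    AddCommGroup (GHom E F q) where
  add f g p p' h := f p p' h + g p p' h
  zero p p' h := 0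
  neg f p p' h := - f p p' h
  add_assoc f g k := by funext p p' h; exact add_assoc _ _ _
  zero_add f := by funext p p' h; exact zero_add _
  add_zero f := by funext p p' h; exact add_zero _
  add_comm f g := by funext p p' h; exact add_comm _ _
  neg_add_cancel f := by funext p p' h; exact neg_add_cancel _
  nsmul n f p p' h := n • f p p' h
  nsmul_zero f := by funext p p' h; exact zero_nsmul _
  nsmul_succ n f := by funext p p' h; exact succ_nsmul _ _
  zsmul n f p p' h := n • f p p' h
  zsmul_zero' f := by funext p p' h; exact zero_zsmul _
  zsmul_succ' n f := by funext p p' h; exact SubNegMonoid.zsmul_succ' _ _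
  zsmul_neg' n f := by funext p p' h; exact SubNegMonoid.zsmul_neg' _ _

/-- The identity in degree `0`. -/
def GHom.one {C : Type u} [Category.{v} C] [Preadditive C] (E : ℤ → C) : GHom E E 0 :=
  fun p p' h => eqToHom (by rw [← h, add_zero])

/-- The composite `f ∘ g` of homogeneous maps. -/
def GHom.comp {C : Type u} [Category.{v} C] [Preadditive C] {E F G : ℤ → C} {q₁ q₂ q : ℤ}
    (h : q₁ + q₂ = q) (f : GHom F G q₁) (g : GHom E F q₂) : GHom E G q :=
  fun p p' hp => g p (p + q₂) rfl ≫ f (p + q₂) p' (by omega)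

/-- The graded category of `ℤ`-graded objects of a preadditive category and homogeneous maps, as a
dg-category with zero differential. -/
def gradedCat (C : Type u) [Category.{v} C] [Preadditive C] : DGCat.{u, v} where
  Ob := ℤ → C
  Hom E F q := GHom E F q
  one E := GHom.one E
  comp h f g := GHom.comp h f g
  d h f := 0
  add_comp h f f' g := by funext p p' hp; exact Preadditive.comp_add _ _ _ _ _ _
  comp_add h f g g' := by funext p p' hp; exact Preadditive.add_comp _ _ _ _ _ _
  comp_assoc {E F G H q₁ q₂ q₃ q₁₂ q₂₃ q} h₁ h₂ h₃ h₄ f g k := by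
    funext p p' hp
    have key : ∀ x y (hx : x = y) (e : p + q₃ + q₂ = x) (e' : p + q₃ + q₂ = y) (e₁ : x + q₁ = p')
        (e₂ : y + q₁ = p'),
        k p (p + q₃) rfl ≫ g (p + q₃) x e ≫ f x p' e₁ =
          (k p (p + q₃) rfl ≫ g (p + q₃) y e') ≫ f y p' e₂ := by
      rintro x y rfl e e' e₁ e₂
      rw [Category.assoc]
    exact key _ _ (by omega) _ _ _ _
  one_comp {E F q} h f := by
    funext p p' hp
    subst hp
    exact Category.comp_id _
  comp_one {E F q} h f := by
    funext p p' hp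
    have key : ∀ x (hx : p + 0 = x) (e : x + q = p') (e' : E p = E x),
        eqToHom e' ≫ f x p' e = f p p' hp := by
      rintro x hx e e'
      obtain rfl : p = x := by omega
      simp
    exact key _ rfl _ _
  d_add h f f' := (add_zero 0).symm
  d_d h h' f := rfl
  d_comp {E F G p q r p' q' r'} h hp hq hr h₁ h₂ f g := by
    have e₁ : GHom.comp h₁ (0 : GHom F G p') g = 0 := by
      funext a b e; exact Limits.comp_zero
    have e₂ : GHom.comp h₂ f (0 : GHom E F q') = 0 := by
      funext a b e; exact Limits.zero_comp
    rw [e₁, e₂, smul_zero, add_zero]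

/-! ### The dg-category of complexes -/

section Complexes

variable {X : TopCat.{u}} (R : X.Sheaf RingCat.{v})

/-- A complex of sheaves of left `R`-modules on the open set `U`. -/
structure Cplx (U : Opens X) where
  E : ℤ → ModSheaf.{u, v, w} R U
  d : GHom E E 1
  d_comp_d : GHom.comp (q := 2) (by omega) d d = 0

/-- The dg-category `Cpx(U)` of complexes of sheaves of left `R`-modules on `U`: the morphisms of
degree `q` are all homogeneous maps of degree `q`, with the differential
`f ↦ d ∘ f - (-1) ^ q f ∘ d`. -/
def cpx (U : Opens X) : DGCat :=
  (gradedCat (ModSheaf.{u, v, w} R U)).twist (Ob' := Cplx R U) Cplx.E Cplx.d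
    (fun K => (zero_add _).trans K.d_comp_d)

variable {R}

/-- The restriction of a homogeneous map to a smaller open set. -/
def GHom.restrict {U W : Opens X} (h : W ≤ U) {E F : ℤ → ModSheaf.{u, v, w} R U} {q : ℤ}
    (f : GHom E F q) : GHom (fun n => (E n).restrict h) (fun n => (F n).restrict h) q :=
  fun p p' e => ModSheaf.resHom (f p p' e) h

lemma GHom.restrict_one {U W : Opens X} (h : W ≤ U) (E : ℤ → ModSheaf.{u, v, w} R U) :
    (GHom.one E).restrict h = GHom.one (fun n => (E n).restrict h) := by
  funext p p' e
  obtain rfl : p = p' := by omega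
  rfl

lemma GHom.restrict_add {U W : Opens X} (h : W ≤ U) {E F : ℤ → ModSheaf.{u, v, w} R U} {q : ℤ}
    (f g : GHom E F q) : (f + g).restrict h = f.restrict h + g.restrict h := rfl

lemma GHom.restrict_zero {U W : Opens X} (h : W ≤ U) {E F : ℤ → ModSheaf.{u, v, w} R U} {q : ℤ} :
    (0 : GHom E F q).restrict h = 0 := rfl

lemma GHom.restrict_sub {U W : Opens X} (h : W ≤ U) {E F : ℤ → ModSheaf.{u, v, w} R U} {q : ℤ}
    (f g : GHom E F q) : (f - g).restrict h = f.restrict h - g.restrict h :=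
  map_sub (AddMonoidHom.mk' (GHom.restrict (E := E) (F := F) (q := q) h) (restrict_add h)) f g

lemma GHom.restrict_smul {U W : Opens X} (h : W ≤ U) {E F : ℤ → ModSheaf.{u, v, w} R U} {q : ℤ}
    (e : ℤˣ) (f : GHom E F q) : (e • f).restrict h = e • f.restrict h := by
  rw [Units.smul_def, Units.smul_def]
  exact map_zsmul (AddMonoidHom.mk' (GHom.restrict (E := E) (F := F) (q := q) h)
    (restrict_add h)) _ f

lemma GHom.restrict_comp {U W : Opens X} (h : W ≤ U) {E F G : ℤ → ModSheaf.{u, v, w} R U}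
    {q₁ q₂ q : ℤ} (e : q₁ + q₂ = q) (f : GHom F G q₁) (g : GHom E F q₂) :
    (GHom.comp e f g).restrict h = GHom.comp e (f.restrict h) (g.restrict h) := rfl

/-- The restriction of a complex to a smaller open set. -/
def Cplx.restrict {U : Opens X} (K : Cplx.{u, v, w} R U) {W : Opens X} (h : W ≤ U) :
    Cplx.{u, v, w} R W where
  E n := (K.E n).restrict h
  d := K.d.restrict h
  d_comp_d := congrArg (GHom.restrict h) K.d_comp_d

/-- The restriction dg-functor `Cpx(U) → Cpx(W)` for `W ≤ U`. -/
def cpxRes {U W : Opens X} (h : W ≤ U) : DGFunctor (cpx.{u, v, w} R U) (cpx.{u, v, w} R W) where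
  obj K := K.restrict h
  map f := GHom.restrict h f
  map_add f g := GHom.restrict_add h f g
  map_one K := GHom.restrict_one h K.E
  map_comp e f g := GHom.restrict_comp h e f g
  map_d {K K' p q} e f := by
    refine (GHom.restrict_sub h _ _).trans (congrArg₂ (· - ·) ?_ ?_)
    · exact (GHom.restrict_add h _ _).trans (congrArg₂ (· + ·) rfl
        (GHom.restrict_comp h ((add_comm 1 p).trans e) _ _))
    · exact (GHom.restrict_smul h _ _).trans (congrArg _ (GHom.restrict_comp h e _ _))

lemma cpxRes_id (U : Opens X) : cpxRes (le_refl U) = DGFunctor.id (cpx.{u, v, w} R U) :=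
  DGFunctor.ext rfl fun _ _ _ _ => rfl

lemma cpxRes_comp {U V W : Opens X} (h : V ≤ U) (h' : W ≤ V) :
    (cpxRes h).comp (cpxRes h') = cpxRes.{u, v, w} (R := R) (h'.trans h) :=
  DGFunctor.ext rfl fun _ _ _ _ => rfl

end Complexes

/-! ### The Čech nerve, and twisted complexes -/

section Twisted

variable {X : TopCat.{u}} (R : X.Sheaf RingCat.{v}) {ι : Type t} (U : ι → Opens X)

/-- The intersection `U_{i_0 … i_n}` for a multi-index `(i_0, …, i_n)`. -/
def inter {n : ℕ} (α : Fin (n + 1) → ι) : Opens X :=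
  ⟨{x | ∀ l, x ∈ U (α l)}, by
    have h : {x | ∀ l, x ∈ U (α l)} = ⋂ l, (U (α l) : Set X) := by ext; simp
    rw [h]
    exact isOpen_iInter_of_finite fun l => (U (α l)).isOpen⟩

lemma inter_le {n m : ℕ} (σ : Fin (n + 1) →o Fin (m + 1)) (β : Fin (m + 1) → ι) :
    inter U β ≤ inter U (β ∘ σ) := fun _ hx l => hx (σ l)

/-- The dg-category `Cpx(N_n)`: the product of the `Cpx(U_{i_0 … i_n})` over all multi-indices
`(i_0, …, i_n)`. -/
def nerveCat (n : ℕ) : DGCat :=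
  DGCat.pi fun α : Fin (n + 1) → ι => cpx.{u, v, w} R (inter U α)

/-- The dg-functor `Cpx(N_n) → Cpx(N_m)` of a monotone map `σ : [n] → [m]`: it sends `(K_α)_α` to
the family with the entry `K_{β ∘ σ}`, restricted to `U_β`, at `β = (i_0, …, i_m)`. -/
def nerveMap {n m : ℕ} (σ : Fin (n + 1) →o Fin (m + 1)) :
    DGFunctor (nerveCat.{u, v, w} R U n) (nerveCat.{u, v, w} R U m) :=
  DGCat.piMap (fun β => β ∘ σ) fun β => cpxRes (inter_le U σ β)

lemma nerveMap_id (n : ℕ) :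
    nerveMap.{u, v, w} R U (OrderHom.id : Fin (n + 1) →o Fin (n + 1)) =
      DGFunctor.id (nerveCat.{u, v, w} R U n) :=
  DGFunctor.ext rfl fun _ _ _ _ => rfl

lemma nerveMap_comp {n m l : ℕ} (σ : Fin (n + 1) →o Fin (m + 1)) (τ : Fin (m + 1) →o Fin (l + 1)) :
    nerveMap.{u, v, w} R U (τ.comp σ) =
      (nerveMap.{u, v, w} R U σ).comp (nerveMap.{u, v, w} R U τ) :=
  ((DGCat.piMap_comp _ _ _ _).trans (congrArg (DGCat.piMap (fun β => (β ∘ τ) ∘ σ)) (funext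
    fun β => cpxRes_comp (inter_le U σ (β ∘ τ)) (inter_le U τ β)))).symm

/-- The cosimplicial dg-category `Cpx(N_•)` of the Čech nerve of the family `U`. -/
def cpxNerve : CosimplicialObject DGCat where
  obj n := nerveCat.{u, v, w} R U n.len
  map σ := nerveMap.{u, v, w} R U σ.toOrderHom
  map_id n := nerveMap_id R U n.len
  map_comp σ τ := nerveMap_comp R U σ.toOrderHom τ.toOrderHom

/-- The graded sheaves of `R`-modules on the open sets of the family `U` and on their
intersections. -/
def cechSystem : CoeffSystem ι (Opens X) where
  dom := U
  inter α := inter U α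
  inter_le α x := fun _ hy => hy x
  le_inter α _ h := fun _ hy x => h x hy
  cat W := gradedCat (ModSheaf.{u, v, w} R W)
  Ob i := ℤ → ModSheaf.{u, v, w} R (U i)
  obj h E n := (E n).restrict h
  res {_ _ _ _} hW {ha hb E F q} f := GHom.restrict (E := fun n => (E n).restrict ha)
    (F := fun n => (F n).restrict hb) hW f
  res_add := by intros; exact GHom.restrict_add _ _ _
  res_one hW ha E := GHom.restrict_one _ _
  res_comp := by
    intro _ _ _ _ _ _ _ _ _ _ _ _ _ _ _ h f g
    exact GHom.restrict_comp _ h _ _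
  res_d := by intros; rfl
  res_refl := by intros; rfl
  res_res := by intros; rfl

/-- No condition on the entries of a multi-index. -/
def anyRel : ι → ι → Prop := fun _ _ => True

/-- Graded sheaves `E_i` of `R`-modules on the `U_i`, and `a = ∑_{k ≥ 0} a^{k,1-k}` with
`a^{k,1-k}_{i_0 … i_k} : E_{i_k} → E_{i_0}` of degree `1 - k` over `U_{i_0 … i_k}`, subject to the
Maurer-Cartan equation `δ a + a · a = 0`. -/
structure PreTwisted where
  E : ∀ i, (cechSystem.{u, v, w} R U).Ob i
  a : (cechSystem R U).Cochain anyRel E E 1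
  mc : (cechSystem R U).delta (m' := 2) (by omega) a +
    (cechSystem R U).mul (m := 2) (by omega) a a = 0

variable {R U}

namespace PreTwisted

/-- The complex `(E_i, a^{0,1}_i)` on `U_i`. -/
def cplx (T : PreTwisted.{u, v, w} R U) (i : ι) : Cplx.{u, v, w} R (U i) where
  E := T.E i
  d := T.a.ev (k := 0) (q := 1) (by omega) (Simplex.vertex anyRel i trivial)
    ((cechSystem R U).le_region_vertex trivial)
  d_comp_d := by
    have h := congrArg (fun c => CoeffSystem.Cochain.ev c (k := 0) (q := 2) (by omega)
      (Simplex.vertex anyRel i trivial) ((cechSystem R U).le_region_vertex trivial)) T.mc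
    replace h : CoeffSystem.Cochain.ev (S := cechSystem.{u, v, w} R U) _ _ _ _ =
      CoeffSystem.Cochain.ev 0 _ _ _ := h
    rw [CoeffSystem.ev_add, CoeffSystem.ev_delta_zero, zero_add, CoeffSystem.ev_mul, asum_zero,
      CoeffSystem.ev_zero] at h
    have e : ((1 - ((0 : ℕ) : ℤ)) * ((0 : ℕ) : ℤ)).negOnePow = 1 := rfl
    rw [e, one_smul] at h
    exact h

/-- The map `a^{1,0}_{i_0 i_1}` over `U_{i_0 i_1}` is invertible up to homotopy, as a chain map
between the restrictions of the complexes `(E_i, a^{0,1}_i)`. -/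
def InvertibleAt (T : PreTwisted.{u, v, w} R U) {i j : ι} (s : Simplex anyRel 1 i j) : Prop :=
  (cpx.{u, v, w} R ((cechSystem.{u, v, w} R U).region s)).IsHtpyInvertible (p := 0) rfl
    (X := (T.cplx j).restrict ((cechSystem.{u, v, w} R U).region_last s))
    (Y := (T.cplx i).restrict ((cechSystem.{u, v, w} R U).region_first s)) (T.a 1 0 (by omega) i j s)

/-- The non-degeneracy condition: every `a^{1,0}_{i i}` is invertible up to homotopy. -/
def Nondegenerate (T : PreTwisted.{u, v, w} R U) : Prop :=
  ∀ (i : ι) (s : Simplex anyRel 1 i i), T.InvertibleAt s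

/-- All `a^{1,0}_{i i}` are identities, and all `a^{k,1-k}_{i_0 … i_k}` with `k ≥ 2` and two equal
neighbours among the indices vanish. -/
def IsNormalized (T : PreTwisted.{u, v, w} R U) : Prop :=
  (∀ (i : ι) (s : Simplex anyRel 1 i i), T.a 1 0 (by omega) i i s =
    GHom.one (fun n => (T.E i n).restrict ((cechSystem R U).region_first s))) ∧
  ∀ (k : ℕ) (q : ℤ) (h : k + q = 1) (i j : ι) (s : Simplex anyRel k i j), 2 ≤ k →
    (∃ l : Fin k, s.v l.castSucc = s.v l.succ) → T.a k q h i j s = 0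

end PreTwisted

variable (R U)

/-- A twisted complex. -/
structure TwistedComplex extends PreTwisted.{u, v, w} R U where
  nondeg : toPreTwisted.Nondegenerate

/-- The dg-category `Tw(X, R, U)` of twisted complexes: the morphisms are all cochains, their
composition is the shuffled multiplication, and the differential of `φ : (E, a) → (F, b)` is
`δ φ + b · φ - (-1) ^ |φ| φ · a`. -/
def Tw : DGCat :=
  ((cechSystem.{u, v, w} R U).cochains anyRel).twist (Ob' := TwistedComplex.{u, v, w} R U)
    (fun T => T.E) (fun T => T.a) (fun T => by
      have h : (cechSystem R U).inner (m' := 2) (by omega) T.a = 0 := by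
        funext k q h i j s
        exact smul_zero ((k : ℤ).negOnePow)
      exact (congrArg (· + (cechSystem R U).mul (m := 2) (by omega) T.a T.a)
        ((congrArg (· + (cechSystem R U).delta (m' := 2) (by omega) T.a) h).trans
          (zero_add _))).trans T.mc)

end Twisted

/-! ### The simplicial resolution and the totalization -/

section Totalization

/-- The constant system with value the dg-category `B`, on the vertices `0, …, n`. -/
def constSystem (B : DGCat.{u, v}) (n : ℕ) : CoeffSystem (Fin (n + 1)) PUnit.{1} where
  dom _ := PUnit.unit
  inter _ := PUnit.unit
  inter_le _ _ := le_rfl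
  le_inter _ _ _ := le_rfl
  cat _ := B
  Ob _ := B.Ob
  obj _ E := E
  res {_ _ _ _} _ {_ _ _ _ _} f := f
  res_add := by intros; rfl
  res_one := by intros; rfl
  res_comp := by intros; rfl
  res_d := by intros; rfl
  res_refl := by intros; rfl
  res_res := by intros; rfl

/-- The order relation on the vertices `0, …, n`: the multi-indices are the weakly increasing
ones. -/
def leRel (n : ℕ) : Fin (n + 1) → Fin (n + 1) → Prop := fun i j => i ≤ j

/-- The dg-category of all families `φ^{k,q}_{i_0 … i_k} : E_{i_k} → F_{i_0}` of morphisms of `B`,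
indexed by `0 ≤ i_0 ≤ … ≤ i_k ≤ n`, with the differential `D` and the shuffled multiplication. -/
def simplexCochains (B : DGCat.{u, v}) (n : ℕ) : DGCat.{u, v} :=
  (constSystem B n).cochains (leRel n)

/-- An object of `Δ_n(B)`: objects `E_0, …, E_n` of `B` and `φ^{k,1-k}_{i_0 … i_k} : E_{i_k} →
E_{i_0}` of degree `1 - k` for `k ≥ 1` and `0 ≤ i_0 ≤ … ≤ i_k ≤ n`, subject to the Maurer-Cartan
equation `D φ + φ · φ = 0`, with all `φ^{1,0}_{i j}` (including `i = j`) homotopy invertible. The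
components with `k = 0` are not part of the data and are set to `0`. -/
structure SimplexObj (B : DGCat.{u, v}) (n : ℕ) where
  E : ∀ i, (constSystem B n).Ob i
  φ : (constSystem B n).Cochain (leRel n) E E 1
  φ_zero : ∀ (q : ℤ) (h : (0 : ℕ) + q = 1) (i j : Fin (n + 1)) (s : Simplex (leRel n) 0 i j),
    φ 0 q h i j s = 0
  mc : (constSystem B n).inner (m' := 2) (by omega) φ +
    (constSystem B n).delta (m' := 2) (by omega) φ +
    (constSystem B n).mul (m := 2) (by omega) φ φ = 0
  inv : ∀ (i j : Fin (n + 1)) (s : Simplex (leRel n) 1 i j),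
    B.IsHtpyInvertible (p := 0) rfl (X := E j) (Y := E i) (φ 1 0 (by omega) i j s)

/-- All `φ^{1,0}_{i i}` are identities, and all `φ^{k,1-k}_{i_0 … i_k}` with `k ≥ 2` and a repeated
index vanish. -/
def SimplexObj.IsNormalized {B : DGCat.{u, v}} {n : ℕ} (x : SimplexObj B n) : Prop :=
  (∀ (i : Fin (n + 1)) (s : Simplex (leRel n) 1 i i), x.φ 1 0 (by omega) i i s = B.one (x.E i)) ∧
  ∀ (k : ℕ) (q : ℤ) (h : k + q = 1) (i j : Fin (n + 1)) (s : Simplex (leRel n) k i j), 2 ≤ k →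
    ¬ Function.Injective s.v → x.φ k q h i j s = 0

/-- The dg-category `Δ_n(B)`: the differential of `θ : (E, φ) → (F, ψ)` of degree `m` is
`D θ + ψ · θ - (-1) ^ m θ · φ`. -/
def simplexCat (B : DGCat.{u, v}) (n : ℕ) : DGCat.{max u v, v} :=
  (simplexCochains B n).twist (Ob' := SimplexObj B n) SimplexObj.E SimplexObj.φ SimplexObj.mc

/-- A dg-functor induces a dg-functor between the dg-categories of cochains. -/
def cochainsMap {B C : DGCat.{u, v}} (F : DGFunctor B C) (n : ℕ) :
    DGFunctor (simplexCochains B n) (simplexCochains C n) where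
  obj E i := F.obj (E i)
  map φ k q h i j s := F.map (φ k q h i j s)
  map_add φ ψ := by
    funext k q h i j s
    exact F.map_add _ _
  map_one E := by
    funext k q h i j s
    by_cases hk : k = 0
    · subst hk
      obtain rfl := s.first_eq_last rfl
      obtain rfl : q = 0 := by omega
      exact F.map_one _
    · change F.map ((constSystem B n).oneCochain E k q h i j s) =
        (constSystem C n).oneCochain (fun i => F.obj (E i)) k q h i j s
      unfold CoeffSystem.oneCochain
      rw [dif_neg hk, dif_neg hk]
      exact F.map_zero
  map_comp {E E' E'' _ _ _} e φ η := by
    funext k q h i j s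
    change F.map ((constSystem B n).mul e φ η k q h i j s) = (constSystem C n).mul
      (E := fun i => F.obj (E i)) (F := fun i => F.obj (E' i)) (G := fun i => F.obj (E'' i)) e
      (fun k q h i j s => F.map (φ k q h i j s)) (fun k q h i j s => F.map (η k q h i j s))
      k q h i j s
    unfold CoeffSystem.mul asum
    refine (F.map_sum _ _).trans (Finset.sum_congr rfl fun x _ => ?_)
    exact (F.map_smul _ _).trans (congrArg _ (F.map_comp _ _ _))
  map_d e φ := by
    funext k q h i j s
    refine (F.map_add _ _).trans (congrArg₂ (· + ·) ?_ ?_)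
    · exact (F.map_smul _ _).trans (congrArg _ (F.map_d _ _))
    · rcases k with _ | k
      · exact F.map_zero
      · exact (F.map_sum _ _).trans (Finset.sum_congr rfl fun x _ => F.map_smul _ _)

/-- The multi-index `(σ(i_0), …, σ(i_k))`. -/
def Simplex.mapOrder {n m k : ℕ} (σ : Fin (n + 1) →o Fin (m + 1)) {i j : Fin (n + 1)}
    (s : Simplex (leRel n) k i j) : Simplex (leRel m) k (σ i) (σ j) where
  v x := σ (s.v x)
  adm l l' h := σ.monotone (s.adm l l' h)
  first := congrArg σ s.first
  last := congrArg σ s.last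

/-- A monotone map `σ : [n] → [m]` induces a dg-functor between the dg-categories of cochains. -/
def cochainsPull (B : DGCat.{u, v}) {n m : ℕ} (σ : Fin (n + 1) →o Fin (m + 1)) :
    DGFunctor (simplexCochains B m) (simplexCochains B n) where
  obj E i := E (σ i)
  map φ k q h i j s := φ k q h (σ i) (σ j) (s.mapOrder σ)
  map_add φ ψ := rfl
  map_one E := by
    funext k q h i j s
    by_cases hk : k = 0
    · subst hk
      obtain rfl := s.first_eq_last rfl
      rfl
    · change (constSystem B m).oneCochain E k q h _ _ (s.mapOrder σ) =
        (constSystem B n).oneCochain (fun i => E (σ i)) k q h i j s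
      unfold CoeffSystem.oneCochain
      rw [dif_neg hk, dif_neg hk]
      rfl
  map_comp e φ η := rfl
  map_d e φ := by
    funext k q h i j s
    rcases k with _ | k <;> rfl

lemma DGFunctor.map_mc {A : DGCat.{u, v}} {B : DGCat.{w, t}} (F : DGFunctor A B) {X : A.Ob}
    (α : A.Hom X X 1)
    (h : A.d (q := 2) (by omega) α + A.comp (by omega) α α = 0) :
    B.d (q := 2) (by omega) (F.map α) + B.comp (by omega) (F.map α) (F.map α) = 0 := by
  rw [← F.map_d, ← F.map_comp, ← F.map_add, h, F.map_zero]

/-- The dg-functor `Δ_n(F) : Δ_n(B) → Δ_n(C)` of a dg-functor `F : B → C`. -/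
def simplexMap {B C : DGCat.{u, v}} (F : DGFunctor B C) (n : ℕ) :
    DGFunctor (simplexCat B n) (simplexCat C n) where
  obj (x : SimplexObj _ _) := show SimplexObj _ _ from
    { E := fun i => F.obj (x.E i)
      φ := fun k q h i j s => F.map (x.φ k q h i j s)
      φ_zero := fun q h i j s => (congrArg F.map (x.φ_zero q h i j s)).trans F.map_zero
      mc := (cochainsMap F n).map_mc (X := x.E) x.φ x.mc
      inv := fun i j s => F.map_isHtpyInvertible rfl _ (x.inv i j s) }
  map {x y p} θ := (cochainsMap F n).map (X := SimplexObj.E x) (Y := SimplexObj.E y) θ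
  map_add θ θ' := (cochainsMap F n).map_add _ _
  map_one x := (cochainsMap F n).map_one _
  map_comp e θ θ' := (cochainsMap F n).map_comp e _ _
  map_d {x y p q} e θ := by
    refine ((cochainsMap F n).map_sub _ _).trans (congrArg₂ (· - ·) ?_ ?_)
    · exact ((cochainsMap F n).map_add _ _).trans (congrArg₂ (· + ·)
        ((cochainsMap F n).map_d _ _) ((cochainsMap F n).map_comp _ _ _))
    · exact ((cochainsMap F n).map_smul _ _).trans (congrArg _ ((cochainsMap F n).map_comp _ _ _))

/-- The dg-functor `σ^* : Δ_m(B) → Δ_n(B)` of a monotone map `σ : [n] → [m]`. -/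
def simplexPull (B : DGCat.{u, v}) {n m : ℕ} (σ : Fin (n + 1) →o Fin (m + 1)) :
    DGFunctor (simplexCat B m) (simplexCat B n) where
  obj (x : SimplexObj _ _) := show SimplexObj _ _ from
    { E := fun i => x.E (σ i)
      φ := fun k q h i j s => x.φ k q h (σ i) (σ j) (s.mapOrder σ)
      φ_zero := fun q h i j s => x.φ_zero q h _ _ _
      mc := (cochainsPull B σ).map_mc (X := x.E) x.φ x.mc
      inv := fun i j s => x.inv _ _ (s.mapOrder σ) }
  map {x y p} θ := (cochainsPull B σ).map (X := SimplexObj.E x) (Y := SimplexObj.E y) θ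
  map_add θ θ' := (cochainsPull B σ).map_add _ _
  map_one x := (cochainsPull B σ).map_one _
  map_comp e θ θ' := (cochainsPull B σ).map_comp e _ _
  map_d {x y p q} e θ := by
    refine ((cochainsPull B σ).map_sub _ _).trans (congrArg₂ (· - ·) ?_ ?_)
    · exact ((cochainsPull B σ).map_add _ _).trans (congrArg₂ (· + ·)
        ((cochainsPull B σ).map_d _ _) ((cochainsPull B σ).map_comp _ _ _))
    · exact ((cochainsPull B σ).map_smul _ _).trans
        (congrArg _ ((cochainsPull B σ).map_comp _ _ _))

variable (B : CosimplicialObject DGCat.{u, v})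

/-- `∏_{[n]} Δ_n(B^n)`. -/
def totSource : DGCat.{max u v, v} := DGCat.pi fun n : SimplexCategory => simplexCat (B.obj n) n.len

/-- `∏_{σ : [n] → [m]} Δ_n(B^m)`. -/
def totTarget : DGCat.{max u v, v} :=
  DGCat.pi fun σ : (Σ n m : SimplexCategory, n ⟶ m) => simplexCat (B.obj σ.2.1) σ.1.len

/-- The dg-functor with the components `Δ_n(σ_*) : Δ_n(B^n) → Δ_n(B^m)`. -/
def totLeft : DGFunctor (totSource B) (totTarget B) :=
  DGCat.piMap (fun σ => σ.1) fun σ => simplexMap (B.map σ.2.2) σ.1.len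

/-- The dg-functor with the components `σ^* : Δ_m(B^m) → Δ_n(B^m)`. -/
def totRight : DGFunctor (totSource B) (totTarget B) :=
  DGCat.piMap (fun σ => σ.2.1) fun σ => simplexPull (B.obj σ.2.1) σ.2.2.toOrderHom

/-- The totalization of a cosimplicial dg-category. -/
def Tot : DGCat.{max u v, v} := DGCat.equalizer (totLeft B) (totRight B)

namespace Tot

variable {B}

/-- The component in `Δ_n(B^n)` of an object of the totalization. -/
def simplexObj (x : (Tot B).Ob) (n : SimplexCategory) : SimplexObj (B.obj n) n.len := x.1 n

/-- The object `E_i` of `B^n` that belongs to an object of the totalization. -/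
def vertex (x : (Tot B).Ob) (n : SimplexCategory) (i : Fin (n.len + 1)) : (B.obj n).Ob :=
  (simplexObj x n).E i

/-- The morphism `φ^{k,q}_{i_0 … i_k}` of `B^n` that belongs to an object of the totalization. -/
def phi (x : (Tot B).Ob) (n : SimplexCategory) (k : ℕ) (q : ℤ) (h : k + q = 1)
    {i j : Fin (n.len + 1)} (s : Simplex (leRel n.len) k i j) :
    (B.obj n).Hom (vertex x n j) (vertex x n i) q :=
  (simplexObj x n).φ k q h i j s

/-- The morphism `θ^{k,q}_{i_0 … i_k}` of `B^n` that belongs to a morphism `θ` of degree `m` of the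
totalization. -/
def theta {x y : (Tot B).Ob} {m : ℤ} (θ : (Tot B).Hom x y m) (n : SimplexCategory) (k : ℕ) (q : ℤ)
    (h : k + q = m) {i j : Fin (n.len + 1)} (s : Simplex (leRel n.len) k i j) :
    (B.obj n).Hom (vertex x n j) (vertex y n i) q :=
  (show (constSystem (B.obj n) n.len).Cochain (leRel n.len) _ _ m from θ.1 n) k q h i j s

end Tot

end Totalization

/-! ### Comparison of the data -/

section Comparison

variable {X : TopCat.{u}} {R : X.Sheaf RingCat.{v}} {ι : Type t} {U : ι → Opens X}

/-- The multi-index `(α(i_0), …, α(i_k))`. -/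
def Simplex.relabel {n k : ℕ} (α : Fin (n + 1) → ι) {i j : Fin (n + 1)}
    (s : Simplex (leRel n) k i j) : Simplex (anyRel (ι := ι)) k (α i) (α j) where
  v x := α (s.v x)
  adm _ _ _ := trivial
  first := congrArg α s.first
  last := congrArg α s.last

/-- The objects of `Cpx(N_n)` attached to `T`: the `i`-th one is, over `U_{α_0 … α_n}`, the
restriction of the complex `(E_{α_i}, a^{0,1}_{α_i})`. -/
def PreTwisted.vertices (T : PreTwisted.{u, v, w} R U) (n : ℕ) (i : Fin (n + 1)) :
    (nerveCat.{u, v, w} R U n).Ob :=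
  fun α => (T.cplx (α i)).restrict fun _ hx => hx i

/-- The morphisms of `Cpx(N_n)` attached to a Čech cochain `c`: the one at `(i_0, …, i_k)` is, over
`U_{α_0 … α_n}`, the restriction of `c_{α_{i_0} … α_{i_k}}`. -/
def spread {T T' : PreTwisted.{u, v, w} R U} {m : ℤ}
    (c : (cechSystem.{u, v, w} R U).Cochain anyRel T.E T'.E m) (n k : ℕ) (q : ℤ) (h : k + q = m)
    {i j : Fin (n + 1)} (s : Simplex (leRel n) k i j) :
    (nerveCat.{u, v, w} R U n).Hom (T.vertices n j) (T'.vertices n i) q :=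
  fun α => c.ev h (s.relabel α) (W := inter U α) fun _ hx l => hx (s.v l)

end Comparison

end TwTot

/-! Three observations make the two sides the same data.

Inner differential. The differential of `Cpx(V)` is the graded commutator with the differentials of
the complexes, viewed as degree one endomorphisms of graded sheaves. An object of `Δ_n` has
complexes as vertices and components `φ^{k,1-k}` only for `k ≥ 1`; adding the differentials as
components with `k = 0` turns `D φ + φ · φ = 0` into `δ a + a · a = 0`
(`DGCat.InnerDifferential.mc_eq`), and likewise identifies the differentials of morphisms
(`DGCat.InnerDifferential.twist_d_eq`).

Universal simplices. A weakly increasing multi-index in `[n]` of length `k + 1` is a monotone map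
`[k] → [n]`, and it is the image of `(0, …, k)` under itself. So a family of simplicial cochains
compatible with all monotone maps is determined by its components at the universal simplices `(0, …,
k)` over the tuples in `ι`, and these may be arbitrary: they form a Čech cochain
(`spreadHom_collapse`, `spreadHom_injective`). In the same way the vertices over `[n]` are pulled
back from `[0]`, hence are restrictions of one complex on each `U_i`.

Non-degeneracy. `Δ_n` requires every edge to be homotopy invertible, a twisted complex only the
edges `a_{ii}`. The Maurer-Cartan equation at two entries says that `a_{ij}` is closed, and at `(i,
j, i)` that `a_{ij} a_{ji}` is homotopic to `a_{ii}`. With the roles of `i` and `j` exchanged,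
`a_{ij}` has a left and a right inverse up to homotopy (`PreTwisted.Nondegenerate.invertibleAt`).
This is part (2), and it also puts the image of a twisted complex in the totalization.

For normalization, a tuple with two equal neighbours is `α ∘ σ` with `σ` a monotone surjection that
is not injective. The component of `a` there is read off at the degenerate multi-index `σ` over
`U_α`, and surjectivity of `σ` means that `U_α` is the whole intersection belonging to the tuple.

Restriction of module sheaves is strictly functorial, so most compatibilities hold definitionally;
the remaining work is transport along equalities of objects. -/

namespace TwTot

/-! ### Transport along equalities of objects -/

/-- The component of a morphism in a product of dg-categories, as an additive map. -/
def DGCat.piEval {κ : Type t} (A : κ → DGCat.{u, v}) (X Y : (DGCat.pi A).Ob) (p : ℤ) (i : κ) :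
    (DGCat.pi A).Hom X Y p →+ (A i).Hom (X i) (Y i) p :=
  AddMonoidHom.mk' (fun f => f i) fun _ _ => rfl

lemma DGCat.pi_sum_apply {κ : Type t} (A : κ → DGCat.{u, v}) {X Y : (DGCat.pi A).Ob} {p : ℤ}
    {τ : Type*} (S : Finset τ) (f : τ → (DGCat.pi A).Hom X Y p) (i : κ) :
    (∑ x ∈ S, f x) i = ∑ x ∈ S, (f x i : (A i).Hom (X i) (Y i) p) :=
  map_sum (DGCat.piEval A X Y p i) f S

lemma DGCat.pi_asum_apply {κ : Type t} (A : κ → DGCat.{u, v}) {X Y : (DGCat.pi A).Ob} {p : ℤ}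
    (n : ℕ) (f : ∀ a b : ℕ, a + b = n → (DGCat.pi A).Hom X Y p) (i : κ) :
    asum n f i = asum n fun a b h => (f a b h i : (A i).Hom (X i) (Y i) p) :=
  map_asum (DGCat.piEval A X Y p i) n f

/-- Morphisms of the totalization are compared only after a transport in a large product; this moves
the transport into one factor. -/
lemma DGCat.castHom_pi_apply {κ : Type t} (A : κ → DGCat.{u, v}) {X X' Y Y' : (DGCat.pi A).Ob}
    {p : ℤ} (hX : X = X') (hY : Y = Y') (f : (DGCat.pi A).Hom X Y p) (i : κ) :
    (DGCat.pi A).castHom hX hY f i = (A i).castHom (congrFun hX i) (congrFun hY i) (f i) := by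
  subst hX hY; rfl

/-- The equalities `hx`, `hy` concern vertices together with Maurer-Cartan data, but a single
component only sees the two end vertices of its multi-index. -/
lemma castHom_simplexCat_apply {B : DGCat.{u, v}} {n : ℕ} {x x' y y' : SimplexObj B n} {m : ℤ}
    (hx : x = x') (hy : y = y') (θ : (constSystem B n).Cochain (leRel n) x.E y.E m) (k : ℕ) (q : ℤ)
    (h : k + q = m) (i j : Fin (n + 1)) (s : Simplex (leRel n) k i j) :
    (show (constSystem B n).Cochain (leRel n) x'.E y'.E m from
      (simplexCat B n).castHom hx hy θ) k q h i j s =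
      B.castHom (congrArg (fun z : SimplexObj B n => z.E j) hx)
        (congrArg (fun z : SimplexObj B n => z.E i) hy) (θ k q h i j s) := by
  subst hx hy; rfl

lemma SimplexObj.castHom_φ {B : DGCat.{u, v}} {n : ℕ} {x x' : SimplexObj B n} (hx : x = x')
    (k : ℕ) (q : ℤ) (h : k + q = 1) (i j : Fin (n + 1)) (s : Simplex (leRel n) k i j) :
    B.castHom (congrArg (fun z : SimplexObj B n => z.E j) hx)
      (congrArg (fun z : SimplexObj B n => z.E i) hx) (x.φ k q h i j s) = x'.φ k q h i j s := by
  subst hx; rfl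

lemma SimplexObj.ext_castHom {B : DGCat.{u, v}} {n : ℕ} {x x' : SimplexObj B n} (hE : x.E = x'.E)
    (hφ : ∀ (k : ℕ) (q : ℤ) (h : k + q = 1) (i j : Fin (n + 1)) (s : Simplex (leRel n) k i j),
      B.castHom (congrFun hE j) (congrFun hE i) (x.φ k q h i j s) = x'.φ k q h i j s) : x = x' := by
  obtain ⟨E, φ, _, _, _⟩ := x
  obtain ⟨E', φ', _, _, _⟩ := x'
  change E = E' at hE
  subst hE
  obtain rfl : φ = φ' := by
    funext k q h i j s
    exact hφ k q h i j s
  rfl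

/-- Trades a propositional equality of vertices for a presentation of `x` whose vertices are
literally the prescribed ones. In the proof of surjectivity this removes the transports once and for
all. -/
lemma SimplexObj.exists_eq_mk {B : DGCat.{u, v}} {n : ℕ} (x : SimplexObj B n)
    (E : ∀ i, (constSystem B n).Ob i) (hE : x.E = E) :
    ∃ φ h₀ hmc hinv, x = ⟨E, φ, h₀, hmc, hinv⟩ := by
  subst hE
  exact ⟨x.φ, x.φ_zero, x.mc, x.inv, rfl⟩

/-! ### Dg-categories with inner differential -/

/-- Degree one endomorphisms `δ` of square zero such that the differential of the dg-category is
the graded commutator with `δ`. -/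
structure DGCat.InnerDifferential (B : DGCat.{u, v}) where
  δ : ∀ X : B.Ob, B.Hom X X 1
  d_eq : ∀ {X Y : B.Ob} {p q : ℤ} (h : p + 1 = q) (f : B.Hom X Y p),
    B.d h f = B.comp (by omega) (δ Y) f - p.negOnePow • B.comp h f (δ X)
  δ_comp_δ : ∀ X : B.Ob, B.comp (r := 2) (by omega) (δ X) (δ X) = 0

/-- The inner differential of a product. -/
def DGCat.InnerDifferential.pi {κ : Type t} {A : κ → DGCat.{u, v}}
    (D : ∀ i, (A i).InnerDifferential) : (DGCat.pi A).InnerDifferential where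
  δ X i := (D i).δ (X i)
  d_eq h f := by
    funext i
    exact (D i).d_eq h (f i)
  δ_comp_δ X := funext fun i => (D i).δ_comp_δ (X i)

/-- The differential of the dg-category of complexes is inner. -/
def cpxInner {X : TopCat.{u}} (R : X.Sheaf RingCat.{v}) (U : Opens X) :
    (cpx.{u, v, w} R U).InnerDifferential where
  δ K := K.d
  -- The complexes are a twist of graded sheaves, whose own differential is zero: up to that zero
  -- summand, the twisted differential is already the commutator.
  d_eq {K L p q} h f := congrArg (fun z : GHom K.E L.E q => z -
    p.negOnePow • (show GHom K.E L.E q from GHom.comp h f K.d)) (zero_add _)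
  δ_comp_δ K := K.d_comp_d

namespace DGCat.InnerDifferential

variable {B : DGCat.{u, v}} (D : B.InnerDifferential) {n : ℕ}

/-- The morphism `δ : E_b → E_a` for `a = b`. -/
def δOn (E : ∀ i, (constSystem B n).Ob i) {a b : Fin (n + 1)} (hab : a = b) {q : ℤ} (hq : q = 1) :
    B.Hom (E b) (E a) q := by
  cases hab
  cases hq
  exact D.δ (E a)

/-- The cochain with the component `δ` at each one-entry multi-index, and `0` at the longer ones. -/
def cochain (E : ∀ i, (constSystem B n).Ob i) : (constSystem B n).Cochain (leRel n) E E 1 :=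
  fun k q h a b s => if hk : k = 0 then D.δOn E (s.first_eq_last hk) (by omega) else 0

lemma cochain_of_ne (E : ∀ i, (constSystem B n).Ob i) {k : ℕ} (hk : k ≠ 0) {q : ℤ} (h : k + q = 1)
    {a b : Fin (n + 1)} (s : Simplex (leRel n) k a b) : D.cochain E k q h a b s = 0 :=
  dif_neg hk

/-- In a product the inner endpoint and the degree match the expected ones only propositionally;
this and the next lemma absorb both discrepancies. -/
lemma δOn_comp {E F : ∀ i, (constSystem B n).Ob i} {m : ℤ}
    (φ : (constSystem B n).Cochain (leRel n) E F m) {k : ℕ} {q q' q₀ : ℤ} (h : k + q = m) (h' : k + q' = m) {a b c : Fin (n + 1)} (hac : a = c)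
    (s : Simplex (leRel n) k c b) (s' : Simplex (leRel n) k a b) (hs : s.v = s'.v) {r : ℤ}
    (hq : q₀ = 1) (hqq : q₀ + q = r) :
    B.comp hqq (D.δOn F hac hq) (φ k q h c b s) =
      B.comp (X := E b) (show 1 + q' = r by omega) (D.δ (F a)) (φ k q' h' a b s') := by
  subst hac hq
  obtain rfl : s = s' := Simplex.ext hs
  obtain rfl : q = q' := by omega
  rfl

lemma comp_δOn {E F : ∀ i, (constSystem B n).Ob i} {m : ℤ}
    (φ : (constSystem B n).Cochain (leRel n) E F m) {k : ℕ} {q q' q₀ : ℤ} (h : k + q = m) (h' : k + q' = m) {a b c : Fin (n + 1)} (hcb : c = b)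
    (s : Simplex (leRel n) k a c) (s' : Simplex (leRel n) k a b) (hs : s.v = s'.v) {r : ℤ}
    (hq : q₀ = 1) (hqq : q + q₀ = r) :
    B.comp hqq (φ k q h a c s) (D.δOn E hcb hq) =
      B.comp (Z := F a) (show q' + 1 = r by omega) (φ k q' h' a b s') (D.δ (E b)) := by
  subst hcb hq
  obtain rfl : s = s' := Simplex.ext hs
  obtain rfl : q = q' := by omega
  rfl

/-- Only the summand `p = 0`, `r = k` survives, and its sign `(-1) ^ (q r)` with `q = 1` is `(-1) ^
k`. In `mul_cochain` the surviving summand has `r = 0` and no sign. -/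
lemma cochain_mul {E F : ∀ i, (constSystem B n).Ob i} {m m' : ℤ} (hm : 1 + m = m')
    (φ : (constSystem B n).Cochain (leRel n) E F m) {k : ℕ} {q : ℤ} (h : k + q = m')
    {a b : Fin (n + 1)} (s : Simplex (leRel n) k a b) :
    (constSystem B n).mul hm (D.cochain F) φ k q h a b s = (k : ℤ).negOnePow •
      ((constSystem B n).cat ((constSystem B n).region s)).comp
        (Z := (constSystem B n).obj ((constSystem B n).region_first s) (F a))
        (show 1 + (m - k) = q by omega) (D.δ (F a)) (φ k (m - k) (by omega) a b s) := by
  refine (asum_first _ _ ?_).trans ?_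
  · intro p r e hp
    refine (congrArg _ ?_).trans (smul_zero _)
    exact (congrArg (fun z => B.comp _ z _) (D.cochain_of_ne F hp (by omega) _)).trans
      (B.zero_comp _ _)
  · refine congrArg₂ (· • ·) (by simp) ?_
    exact D.δOn_comp φ _ _ s.first.symm (s.back (zero_add k)) s
      (funext fun x => congrArg s.v (Fin.ext (zero_add _))) (by simp) _

lemma mul_cochain {E F : ∀ i, (constSystem B n).Ob i} {m m' : ℤ} (hm : m + 1 = m')
    (φ : (constSystem B n).Cochain (leRel n) E F m) {k : ℕ} {q : ℤ} (h : k + q = m')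
    {a b : Fin (n + 1)} (s : Simplex (leRel n) k a b) :
    (constSystem B n).mul hm φ (D.cochain E) k q h a b s =
      B.comp (Z := F a) (show (m - k) + 1 = q by omega) (φ k (m - k) (by omega) a b s)
        (D.δ (E b)) := by
  refine (asum_last _ _ ?_).trans ?_
  · intro p r e hp
    refine (congrArg _ ?_).trans (smul_zero _)
    exact (congrArg (fun z => B.comp _ _ z) (D.cochain_of_ne E hp (by omega) _)).trans
      (B.comp_zero _ _)
  · refine Eq.trans (congrArg₂ (· • ·) (by simp) ?_) (one_smul ℤˣ _)
    exact D.comp_δOn φ _ _ s.last (s.front (add_zero k)) s rfl (by simp) _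

lemma cochain_mul_cochain (E : ∀ i, (constSystem B n).Ob i) :
    (constSystem B n).mul (m := 2) (by omega) (D.cochain E) (D.cochain E) = 0 := by
  funext k q h a b s
  rw [D.cochain_mul]
  refine (congrArg _ ?_).trans (smul_zero _)
  by_cases hk : k = 0
  · subst hk
    obtain rfl := s.first_eq_last rfl
    obtain rfl : q = 2 := by omega
    exact D.δ_comp_δ (E a)
  · exact (congrArg (fun z => B.comp _ _ z) (D.cochain_of_ne E hk _ _)).trans (B.comp_zero _ _)

/-- Leaving out an inner entry keeps both ends, so at least two entries remain, and there the
cochain vanishes. -/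
lemma delta_cochain (E : ∀ i, (constSystem B n).Ob i) :
    (constSystem B n).delta (m' := 2) (by omega) (D.cochain E) = 0 := by
  funext k q h a b s
  rcases k with _ | k
  · rfl
  · refine Finset.sum_eq_zero fun j _ => ?_
    refine (congrArg _ ?_).trans (smul_zero _)
    exact D.cochain_of_ne E (by have := j.2; omega) (by push_cast at h; omega) _

/-- The component has degree `m - k`, so `(-1) ^ k` times its commutator with the differentials has
the signs `(-1) ^ k` and `-(-1) ^ m`: precisely those produced by the two shuffled products. -/
lemma inner_eq {E F : ∀ i, (constSystem B n).Ob i} {m m' : ℤ} (hm : m + 1 = m')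
    (φ : (constSystem B n).Cochain (leRel n) E F m) :
    (constSystem B n).inner hm φ =
      (constSystem B n).mul (show 1 + m = m' by omega) (D.cochain F) φ -
      m.negOnePow • (constSystem B n).mul hm φ (D.cochain E) := by
  funext k q h a b s
  rw [sub_eq_add_neg]
  change _ = (constSystem B n).mul _ (D.cochain F) φ k q h a b s +
    -(m.negOnePow • (constSystem B n).mul hm φ (D.cochain E) k q h a b s)
  rw [D.cochain_mul, D.mul_cochain]
  refine (congrArg _ (D.d_eq _ _)).trans ?_
  -- Stated in an arbitrary group, so that it applies to the morphism group up to unfolding.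
  have key : ∀ {G : Type v} [AddCommGroup G] (x y : G), (k : ℤ).negOnePow •
      (x - (m - k).negOnePow • y) = (k : ℤ).negOnePow • x + -(m.negOnePow • y) := by
    intro G _ x y
    rw [← sub_eq_add_neg, smul_sub, smul_smul, ← Int.negOnePow_add, add_sub_cancel]
  exact key _ _

end DGCat.InnerDifferential

/-! ### Čech cochains as compatible families of simplicial cochains -/

section Spread

variable {X : TopCat.{u}} {R : X.Sheaf RingCat.{v}} {ι : Type t} {U : ι → Opens X}

/-- The multi-index `(0, …, k)`. -/
def Simplex.universal (k : ℕ) : Simplex (leRel k) k 0 (Fin.last k) where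
  v x := x
  adm _ _ h := h
  first := rfl
  last := rfl

/-- The objects of `Cpx(N_n)` attached to a family `K` of complexes: the `i`-th one is, over
`U_{α_0 … α_n}`, the restriction of `K_{α_i}`. -/
def cplxVertices (K : ∀ i, Cplx.{u, v, w} R (U i)) (n : ℕ) :
    ∀ i, (constSystem (nerveCat.{u, v, w} R U n) n).Ob i :=
  fun i α => (K (α i)).restrict fun _ hx => hx i

/-- The graded sheaves underlying a family of complexes. -/
def gradedSheaves (K : ∀ i, Cplx.{u, v, w} R (U i)) : ∀ i, (cechSystem.{u, v, w} R U).Ob i :=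
  fun i => (K i).E

/-- The Čech cochains between the graded sheaves underlying two families of complexes. -/
abbrev CechCochain (K L : ∀ i, Cplx.{u, v, w} R (U i)) (m : ℤ) :=
  (cechSystem.{u, v, w} R U).Cochain anyRel (gradedSheaves K) (gradedSheaves L) m

/-- The cochains of `Δ_n(Cpx(N_n))` between the objects attached to two families of complexes. -/
abbrev NerveCochain (K L : ∀ i, Cplx.{u, v, w} R (U i)) (n : ℕ) (m : ℤ) :=
  (constSystem (nerveCat.{u, v, w} R U n) n).Cochain (leRel n) (cplxVertices K n)
    (cplxVertices L n) m

variable {K L M : ∀ i, Cplx.{u, v, w} R (U i)} {m : ℤ}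

/-- The simplicial cochain attached to a Čech cochain, as an additive map. -/
def spreadHom (K L : ∀ i, Cplx.{u, v, w} R (U i)) (n : ℕ) (m : ℤ) :
    CechCochain K L m →+ NerveCochain K L n m :=
  AddMonoidHom.mk' (fun c k q h i j s α => c.ev h (s.relabel α) (W := inter U α)
    fun _ hx l => hx (s.v l)) (fun _ _ => rfl)

/-- Relabelling a multi-index commutes strictly with cutting it into front and back, and restriction
commutes strictly with composition. Once both products are evaluated at `α`, they agree term by
term. -/
lemma spreadHom_mul {m₁ m₂ : ℤ} (hm : m₁ + m₂ = m) (c : CechCochain L M m₁)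
    (c' : CechCochain K L m₂) (n : ℕ) :
    spreadHom K M n m ((cechSystem R U).mul hm c c') =
      (constSystem (nerveCat R U n) n).mul hm (spreadHom L M n m₁ c) (spreadHom K L n m₂ c') := by
  funext k q h i j s α
  refine (CoeffSystem.ev_mul hm c c' h (s.relabel α) _).trans ?_
  refine Eq.trans ?_ (DGCat.pi_asum_apply (fun α : Fin (n + 1) → ι => cpx.{u, v, w} R (inter U α))
    (X := cplxVertices K n j) (Y := cplxVertices M n i) (p := q) _ _ α).symm
  rfl

lemma spreadHom_delta {m' : ℤ} (hm : m + 1 = m') (c : CechCochain K L m) (n : ℕ) :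
    spreadHom K L n m' ((cechSystem R U).delta hm c) =
      (constSystem (nerveCat R U n) n).delta hm (spreadHom K L n m c) := by
  funext k q h i j s α
  rcases k with _ | k
  · rfl
  · refine (CoeffSystem.ev_delta_succ hm c h (by push_cast at h; omega) (s.relabel α) _).trans ?_
    refine Eq.trans ?_ (DGCat.pi_sum_apply (fun α : Fin (n + 1) → ι => cpx.{u, v, w} R (inter U α))
      (X := cplxVertices K n j) (Y := cplxVertices L n i) (p := q) _ _ α).symm
    refine Finset.sum_congr rfl fun x _ => ?_
    rfl

lemma spreadHom_one (K : ∀ i, Cplx.{u, v, w} R (U i)) (n : ℕ) :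
    spreadHom K K n 0 ((cechSystem R U).oneCochain (gradedSheaves K)) =
      (constSystem (nerveCat R U n) n).oneCochain (rel := leRel n) (cplxVertices K n) := by
  funext k q h i j s α
  by_cases hk : k = 0
  · subst hk
    obtain rfl := s.first_eq_last rfl
    obtain rfl : q = 0 := by omega
    exact CoeffSystem.ev_one_zero (S := cechSystem R U) (E := gradedSheaves K) h (s.relabel α) _
  · refine (CoeffSystem.ev_one_of_ne (S := cechSystem R U) (E := gradedSheaves K) hk h
      (s.relabel α) _).trans ?_
    exact (congrFun (show (constSystem (nerveCat R U n) n).oneCochain (cplxVertices K n) k q h i j s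
      = 0 from dif_neg hk) α).symm

/-- Compatibility of a family of simplicial cochains with the monotone maps `[n] → [n']`. -/
def IsCompatible (η : ∀ n, NerveCochain K L n m) : Prop :=
  ∀ (n n' : ℕ) (σ : Fin (n + 1) →o Fin (n' + 1)) (k : ℕ) (q : ℤ) (h : k + q = m)
    (i j : Fin (n + 1)) (s : Simplex (leRel n) k i j),
    (nerveMap R U σ).map (η n k q h i j s) = η n' k q h (σ i) (σ j) (s.mapOrder σ)

/-- Relabelling first by `σ` and then by `β` is relabelling by `β ∘ σ`, and two successive
restrictions are one. -/
lemma isCompatible_spreadHom (c : CechCochain K L m) : IsCompatible fun n => spreadHom K L n m c :=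
  fun _ _ _ _ _ _ _ _ _ => rfl

/-- The Čech cochain given by the components of a family at the multi-indices `(0, …, k)`. -/
def collapse (η : ∀ n, NerveCochain K L n m) : CechCochain K L m := fun k q h a b s => by
  -- The tuple `v` itself serves as the index of a factor of `Cpx(N_k)`; its open set `U_v` is the
  -- one over which the Čech component is required.
  obtain ⟨v, adm, rfl, rfl⟩ := s
  exact η k k q h 0 (Fin.last k) (Simplex.universal k) v

/-- A weakly increasing multi-index `v` is a monotone map `[k] → [n]` that takes `(0, …, k)` to `v`,
so compatibility with this map is the whole claim. -/
lemma spreadHom_collapse {η : ∀ n, NerveCochain K L n m} (hη : IsCompatible η) (n : ℕ) :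
    spreadHom K L n m (collapse η) = η n := by
  funext k q h i j s α
  obtain ⟨v, adm, rfl, rfl⟩ := s
  exact congrFun (hη k n ⟨v, adm⟩ k q h 0 (Fin.last k) (Simplex.universal k)) α

/-- The component of `c` at `v` is that of its spread over `[k]` at the universal simplex and the
tuple `v`. -/
lemma spreadHom_injective {c c' : CechCochain K L m}
    (h : ∀ n, spreadHom K L n m c = spreadHom K L n m c') : c = c' := by
  funext k q hq a b s
  obtain ⟨v, adm, rfl, rfl⟩ := s
  exact congrFun (congrFun (congrFun (congrFun (congrFun (congrFun (congrFun (h k) k) q) hq) 0)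
    (Fin.last k)) (Simplex.universal k)) v

/-- The differential of `Cpx(N_n)` is inner. -/
def nerveInner (R : X.Sheaf RingCat.{v}) (U : ι → Opens X) (n : ℕ) :
    (nerveCat.{u, v, w} R U n).InnerDifferential :=
  DGCat.InnerDifferential.pi fun α => cpxInner R (inter U α)

/-- The differential of a restricted complex is the restricted differential. -/
lemma isCompatible_cochain (K : ∀ i, Cplx.{u, v, w} R (U i)) :
    IsCompatible fun n => (nerveInner R U n).cochain (cplxVertices K n) := by
  intro n n' σ k q h i j s
  by_cases hk : k = 0
  · subst hk
    obtain rfl := s.first_eq_last rfl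
    obtain rfl : q = 1 := by omega
    rfl
  · refine (congrArg (nerveMap R U σ).map
      ((nerveInner R U n).cochain_of_ne (cplxVertices K n) hk h s)).trans ?_
    exact (nerveMap R U σ).map_zero.trans
      ((nerveInner R U n').cochain_of_ne (cplxVertices K n') hk h (s.mapOrder σ)).symm

end Spread

/-! ### Homotopies -/

namespace DGCat

variable (B : DGCat.{u, v})

/-- Two morphisms of degree `0` are homotopic if their difference is a coboundary. -/
def Homotopic {X Y : B.Ob} (f g : B.Hom X Y 0) : Prop :=
  ∃ h : B.Hom X Y (-1), f - g = B.d (by omega) h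

variable {B}

lemma Homotopic.symm {X Y : B.Ob} {f g : B.Hom X Y 0} (h : B.Homotopic f g) :
    B.Homotopic g f := by
  obtain ⟨h, e⟩ := h
  refine ⟨-h, ?_⟩
  rw [← neg_sub, e]
  exact (map_neg (B.dHom _) h).symm

lemma Homotopic.trans {X Y : B.Ob} {f g k : B.Hom X Y 0} (h : B.Homotopic f g)
    (h' : B.Homotopic g k) : B.Homotopic f k := by
  obtain ⟨h, e⟩ := h
  obtain ⟨h', e'⟩ := h'
  exact ⟨h + h', by rw [B.d_add, ← e, ← e', sub_add_sub_cancel]⟩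

lemma Homotopic.comp_left {X Y Z : B.Ob} {f g : B.Hom X Y 0} (h : B.Homotopic f g)
    {k : B.Hom Y Z 0} (hk : B.d (q := 1) (by omega) k = 0) :
    B.Homotopic (B.comp (r := 0) (by omega) k f) (B.comp (by omega) k g) := by
  obtain ⟨h, e⟩ := h
  refine ⟨B.comp (by omega) k h, ?_⟩
  rw [B.d_comp (p' := 1) (q' := 0) _ (by omega) (by omega) _ (by omega) (by omega), hk,
    B.zero_comp, ← B.comp_sub, e]
  exact ((zero_add _).trans (one_smul ℤˣ _)).symm

lemma Homotopic.comp_right {X Y Z : B.Ob} {f g : B.Hom Y Z 0} (h : B.Homotopic f g)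
    {k : B.Hom X Y 0} (hk : B.d (q := 1) (by omega) k = 0) :
    B.Homotopic (B.comp (r := 0) (by omega) f k) (B.comp (by omega) g k) := by
  obtain ⟨h, e⟩ := h
  refine ⟨B.comp (by omega) h k, ?_⟩
  rw [B.d_comp (p' := 0) (q' := 1) _ (by omega) (by omega) _ (by omega) (by omega), hk,
    B.comp_zero, smul_zero, ← B.sub_comp, e]
  exact (add_zero _).symm

lemma d_comp_eq_zero {X Y Z : B.Ob} {f : B.Hom Y Z 0} {g : B.Hom X Y 0}
    (hf : B.d (q := 1) (by omega) f = 0) (hg : B.d (q := 1) (by omega) g = 0) :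
    B.d (q := 1) (by omega) (B.comp (r := 0) (by omega) f g) = 0 := by
  rw [B.d_comp (p' := 1) (q' := 1) _ (by omega) (by omega) _ (by omega) (by omega), hf, hg,
    B.zero_comp, B.comp_zero, smul_zero, add_zero]

/-- A closed morphism whose composites with a closed morphism `g` in both orders are homotopic to
homotopy invertible morphisms is homotopy invertible. -/
lemma isHtpyInvertible_of_homotopic {X Y : B.Ob} {f : B.Hom X Y 0} {g : B.Hom Y X 0}
    {a : B.Hom Y Y 0} {b : B.Hom X X 0} (hf : B.d (q := 1) (by omega) f = 0)
    (hg : B.d (q := 1) (by omega) g = 0) (ha : B.IsHtpyInvertible rfl a)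
    (hb : B.IsHtpyInvertible rfl b) (hfg : B.Homotopic (B.comp (by omega) f g) a)
    (hgf : B.Homotopic (B.comp (by omega) g f) b) : B.IsHtpyInvertible rfl f := by
  obtain ⟨-, a', ha', haa', -⟩ := ha
  obtain ⟨-, b', hb', -, hb'b⟩ := hb
  have hr := d_comp_eq_zero hg ha'
  have hl := d_comp_eq_zero hb' hg
  have h₁ : B.Homotopic (B.comp (r := 0) (by omega) f (B.comp (r := 0) (by omega) g a'))
      (B.one Y) := by
    rw [← B.comp_assoc (pq := 0) (by omega) (by omega) (by omega) (by omega)]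
    exact (hfg.comp_right ha').trans haa'
  have h₂ : B.Homotopic (B.comp (r := 0) (by omega) (B.comp (r := 0) (by omega) b' g) f)
      (B.one X) := by
    rw [B.comp_assoc (qr := 0) (by omega) (by omega) (by omega) (by omega)]
    exact (hgf.comp_left hb').trans hb'b
  -- The right inverse `g a'` and the left inverse `b' g` are homotopic, as both are homotopic to
  -- `b' g f g a'`.
  have h₃ : B.Homotopic (B.comp (r := 0) (by omega) g a') (B.comp (r := 0) (by omega) b' g) := by
    have e₁ := h₂.comp_right hr
    have e₂ := h₁.comp_left hl
    rw [B.one_comp, B.comp_assoc (qr := 0) (by omega) (by omega) (by omega) (by omega)] at e₁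
    rw [B.comp_one] at e₂
    exact e₁.symm.trans e₂
  exact ⟨hf, _, hr, h₁, (h₃.comp_right hf).trans h₂⟩

end DGCat

/-! ### The Maurer-Cartan equation in low degrees -/

section LowDegrees

variable {B : DGCat.{u, v}} {n : ℕ} {E : ∀ i, (constSystem B n).Ob i}
  {φ : (constSystem B n).Cochain (leRel n) E E 1}

/-- At two entries there is no inner entry to leave out, and each summand of `φ · φ` contains a
component with `k = 0`, which vanishes by `h₀`. Only the internal differential is left. -/
lemma d_edge_eq_zero
    (h₀ : ∀ (q : ℤ) (h : (0 : ℕ) + q = 1) (i j : Fin (n + 1)) (s : Simplex (leRel n) 0 i j),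
      φ 0 q h i j s = 0)
    (hmc : (constSystem B n).inner (m' := 2) (by omega) φ +
      (constSystem B n).delta (m' := 2) (by omega) φ +
      (constSystem B n).mul (m := 2) (by omega) φ φ = 0)
    {i j : Fin (n + 1)} (s : Simplex (leRel n) 1 i j) :
    ((constSystem B n).cat ((constSystem B n).region s)).d (q := 1) (by omega)
      (φ 1 0 (by omega) i j s) = 0 := by
  have h : (constSystem B n).inner (m' := 2) (by omega) φ 1 1 (by omega) i j s +
      (constSystem B n).delta (m' := 2) (by omega) φ 1 1 (by omega) i j s +
      (constSystem B n).mul (m := 2) (by omega) φ φ 1 1 (by omega) i j s = 0 :=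
    congrFun (congrFun (congrFun (congrFun (congrFun (congrFun hmc 1) 1) (by omega)) i) j) s
  have e₁ : (constSystem B n).delta (m' := 2) (by omega) φ 1 1 (by omega) i j s = 0 := by
    exact Finset.sum_empty
  have e₂ : (constSystem B n).mul (m := 2) (by omega) φ φ 1 1 (by omega) i j s = 0 := by
    unfold CoeffSystem.mul asum
    refine Finset.sum_eq_zero ?_
    rintro ⟨⟨p, r⟩, hpr⟩ -
    have hpr' : p + r = 1 := Finset.HasAntidiagonal.mem_antidiagonal.1 hpr
    refine (congrArg _ ?_).trans (smul_zero _)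
    obtain ⟨rfl, rfl⟩ | ⟨rfl, rfl⟩ : (p = 0 ∧ r = 1) ∨ (p = 1 ∧ r = 0) := by omega
    · exact (congrArg (fun z => B.comp _ z _) (h₀ _ (by simp) _ _ _)).trans (B.zero_comp _ _)
    · exact (congrArg (fun z => B.comp _ _ z) (h₀ _ (by simp) _ _ _)).trans (B.comp_zero _ _)
  rw [e₁, e₂, add_zero, add_zero] at h
  have h' := (smul_eq_zero_iff_eq _).1 h
  exact h'

/-- At three entries the vanishing of the components with `k = 0` leaves only `p = r = 1` in `φ ·
φ`, with sign `+`, while `δ` contributes the single inner face with sign `-`. So `φ^{2,-1}` is a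
homotopy that measures the failure of the cocycle condition for the edges. -/
lemma d_triangle_eq
    (h₀ : ∀ (q : ℤ) (h : (0 : ℕ) + q = 1) (i j : Fin (n + 1)) (s : Simplex (leRel n) 0 i j),
      φ 0 q h i j s = 0)
    (hmc : (constSystem B n).inner (m' := 2) (by omega) φ +
      (constSystem B n).delta (m' := 2) (by omega) φ +
      (constSystem B n).mul (m := 2) (by omega) φ φ = 0)
    {i j : Fin (n + 1)} (s : Simplex (leRel n) 2 i j) :
    ((constSystem B n).cat ((constSystem B n).region s)).d (q := 0) (by omega)
        (φ 2 (-1) (by omega) i j s) =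
      φ.ev (q := 0) (by omega) (s.skip 0) ((constSystem B n).region_skip s 0) -
        ((constSystem B n).cat ((constSystem B n).region s)).comp (r := 0) (by omega)
          (φ.ev (q := 0) (by omega) (s.front (p := 1) (r := 1) rfl)
            ((constSystem B n).region_front s _))
          (φ.ev (q := 0) (by omega) (s.back (p := 1) (r := 1) rfl)
            ((constSystem B n).region_back s _)) := by
  have h : (constSystem B n).inner (m' := 2) (by omega) φ 2 0 (by omega) i j s +
      (constSystem B n).delta (m' := 2) (by omega) φ 2 0 (by omega) i j s +
      (constSystem B n).mul (m := 2) (by omega) φ φ 2 0 (by omega) i j s = 0 :=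
    congrFun (congrFun (congrFun (congrFun (congrFun (congrFun hmc 2) 0) (by omega)) i) j) s
  have e₀ : (constSystem B n).inner (m' := 2) (by omega) φ 2 0 (by omega) i j s =
      ((constSystem B n).cat ((constSystem B n).region s)).d (q := 0) (by omega)
        (φ 2 (-1) (by omega) i j s) :=
    one_smul ℤˣ _
  have e₁ : (constSystem B n).delta (m' := 2) (by omega) φ 2 0 (by omega) i j s =
      - φ.ev (q := 0) (by omega) (s.skip 0) ((constSystem B n).region_skip s 0) := by
    refine (Fin.sum_univ_one _).trans ?_
    refine (Units.neg_smul 1 _).trans (congrArg _ (one_smul ℤˣ _))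
  have e₂ : (constSystem B n).mul (m := 2) (by omega) φ φ 2 0 (by omega) i j s =
      ((constSystem B n).cat ((constSystem B n).region s)).comp (r := 0) (by omega)
        (φ.ev (q := 0) (by omega) (s.front (p := 1) (r := 1) rfl)
          ((constSystem B n).region_front s _))
        (φ.ev (q := 0) (by omega) (s.back (p := 1) (r := 1) rfl)
          ((constSystem B n).region_back s _)) := by
    refine (asum_succ _ _).trans ?_
    refine (congrArg₂ (· + ·) ?_
      ((asum_succ' _ _).trans (congrArg₂ (· + ·) ?_ (asum_zero _)))).trans
      ((zero_add _).trans ((zero_add _).trans (one_smul ℤˣ _)))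
    · refine (congrArg _ ?_).trans (smul_zero _)
      exact (congrArg (fun z => B.comp _ z _) (h₀ _ (by simp) _ _ _)).trans (B.zero_comp _ _)
    · refine (congrArg _ ?_).trans (smul_zero _)
      exact (congrArg (fun z => B.comp _ _ z) (h₀ _ (by simp) _ _ _)).trans (B.comp_zero _ _)
  rw [e₀, e₁, e₂] at h
  have key : ∀ {G : Type v} [AddCommGroup G] (x y z : G), x + -y + z = 0 → x = y - z := by
    intro G _ x y z hz
    rw [← sub_eq_add_neg, sub_add_eq_add_sub, sub_eq_zero] at hz
    exact eq_sub_of_add_eq hz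
  exact key _ _ _ h

end LowDegrees

/-! ### The simplicial cochains attached to a twisted complex -/

/-- The cochain with its components at the one-entry multi-indices replaced by `0`. -/
def truncate {B : DGCat.{u, v}} {n : ℕ} {E F : ∀ i, (constSystem B n).Ob i} {m : ℤ}
    (c : (constSystem B n).Cochain (leRel n) E F m) : (constSystem B n).Cochain (leRel n) E F m :=
  fun k q h i j s => if k = 0 then 0 else c k q h i j s

lemma truncate_of_ne {B : DGCat.{u, v}} {n : ℕ} {E F : ∀ i, (constSystem B n).Ob i} {m : ℤ}
    (c : (constSystem B n).Cochain (leRel n) E F m) {k : ℕ} (hk : k ≠ 0) (q : ℤ) (h : k + q = m)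
    (i j : Fin (n + 1)) (s : Simplex (leRel n) k i j) :
    truncate c k q h i j s = c k q h i j s := if_neg hk

namespace PreTwisted

variable {X : TopCat.{u}} {R : X.Sheaf RingCat.{v}} {ι : Type t} {U : ι → Opens X}
  (T : PreTwisted.{u, v, w} R U)

/-- The cochain `a`, between the graded sheaves underlying the complexes `(E_i, a^{0,1}_i)`. -/
def cochain : CechCochain T.cplx T.cplx 1 := T.a

lemma cochain_mc : (cechSystem R U).delta (m' := 2) (by omega) T.cochain +
    (cechSystem R U).mul (m := 2) (by omega) T.cochain T.cochain = 0 := T.mc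

/-- The restrictions of the components `a^{k,1-k}` with `k ≥ 1`. -/
def nerveCochain (n : ℕ) : NerveCochain T.cplx T.cplx n 1 :=
  truncate (spreadHom T.cplx T.cplx n 1 T.cochain)

/-- The part of `a` lost by truncation is `a^{0,1}`, which by the construction of `T.cplx` is the
differential of the complexes. -/
lemma spreadHom_cochain (n : ℕ) : spreadHom T.cplx T.cplx n 1 T.cochain =
    T.nerveCochain n + (nerveInner R U n).cochain (cplxVertices T.cplx n) := by
  funext k q h i j s
  change _ = T.nerveCochain n k q h i j s +
    (nerveInner R U n).cochain (cplxVertices T.cplx n) k q h i j s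
  by_cases hk : k = 0
  · subst hk
    obtain rfl : q = 1 := by omega
    refine Eq.trans ?_ (zero_add _).symm
    obtain rfl := s.first_eq_last rfl
    obtain rfl : s = Simplex.vertex (leRel n) i le_rfl :=
      Simplex.ext (funext fun x => (congrArg s.v (Fin.ext (by omega) : x = 0)).trans s.first)
    rfl
  · rw [DGCat.InnerDifferential.cochain_of_ne _ _ hk, add_zero]
    exact (truncate_of_ne _ hk q h i j s).symm

end PreTwisted

/-! ### Absorbing the internal differential into the Maurer-Cartan cochain -/

section

variable {B : DGCat.{u, v}} (D : B.InnerDifferential) {n : ℕ}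

/-- The Maurer-Cartan equation in a dg-category with inner differential: the differential can be
absorbed into the cochain. -/
lemma DGCat.InnerDifferential.mc_eq {E : ∀ i, (constSystem B n).Ob i}
    (φ : (constSystem B n).Cochain (leRel n) E E 1) :
    (constSystem B n).inner (m' := 2) (by omega) φ +
      (constSystem B n).delta (m' := 2) (by omega) φ +
      (constSystem B n).mul (m := 2) (by omega) φ φ =
    (constSystem B n).delta (m' := 2) (by omega) (φ + D.cochain E) +
      (constSystem B n).mul (m := 2) (by omega) (φ + D.cochain E) (φ + D.cochain E) := by
  -- In total degree one the graded commutator is a sum of two products, namely the cross terms in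
  -- the square of `φ + D.cochain E`.
  rw [D.inner_eq, CoeffSystem.delta_add, CoeffSystem.add_mul', CoeffSystem.mul_add',
    CoeffSystem.mul_add', D.cochain_mul_cochain, D.delta_cochain, Int.negOnePow_one,
    Units.neg_smul, one_smul]
  abel

/-- The internal differential is the commutator with `D.cochain`, and its two terms join `ψ` and
`φ`. The right-hand side has the shape of the differential of morphisms of twisted complexes. -/
lemma DGCat.InnerDifferential.twist_d_eq {E F : ∀ i, (constSystem B n).Ob i}
    (φ : (constSystem B n).Cochain (leRel n) E E 1) (ψ : (constSystem B n).Cochain (leRel n) F F 1)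
    {m m' : ℤ} (hm : m + 1 = m') (hm' : 1 + m = m')
    (θ : (constSystem B n).Cochain (leRel n) E F m) :
    (constSystem B n).inner hm θ + (constSystem B n).delta hm θ +
      (constSystem B n).mul hm' ψ θ - m.negOnePow • (constSystem B n).mul hm θ φ =
    (constSystem B n).delta hm θ + (constSystem B n).mul hm' (ψ + D.cochain F) θ -
      m.negOnePow • (constSystem B n).mul hm θ (φ + D.cochain E) := by
  rw [D.inner_eq, CoeffSystem.add_mul', CoeffSystem.mul_add', smul_add]
  abel

end

namespace PreTwisted

variable {X : TopCat.{u}} {R : X.Sheaf RingCat.{v}} {ι : Type t} {U : ι → Opens X}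
  (T : PreTwisted.{u, v, w} R U)

/-- With the differentials absorbed, the left-hand side is the spread of `δ a + a · a`. -/
lemma nerveCochain_mc (n : ℕ) :
    (constSystem (nerveCat R U n) n).inner (m' := 2) (by omega) (T.nerveCochain n) +
      (constSystem (nerveCat R U n) n).delta (m' := 2) (by omega) (T.nerveCochain n) +
      (constSystem (nerveCat R U n) n).mul (m := 2) (by omega) (T.nerveCochain n)
        (T.nerveCochain n) = 0 := by
  rw [(nerveInner R U n).mc_eq, ← T.spreadHom_cochain, ← spreadHom_delta, ← spreadHom_mul,
    ← map_add, T.cochain_mc, map_zero]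

lemma nerveCochain_zero (n : ℕ) (q : ℤ) (h : (0 : ℕ) + q = 1) (i j : Fin (n + 1))
    (s : Simplex (leRel n) 0 i j) : T.nerveCochain n 0 q h i j s = 0 := rfl

/-! ### The two non-degeneracy conditions -/

/-- The restriction of the complex `(E_i, a^{0,1}_i)` to `W ≤ U_i`. -/
def objOver (i : ι) {W : Opens X} (h : W ≤ U i) : (cpx.{u, v, w} R W).Ob := (T.cplx i).restrict h

/-- The restriction of `a^{1,0}_{i j}` to an open subset `W` of `U_{i j}`. -/
def edge {i j : ι} (s : Simplex anyRel 1 i j) {W : Opens X} (hi : W ≤ U i) (hj : W ≤ U j)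
    (hW : W ≤ (cechSystem.{u, v, w} R U).region s) :
    (cpx.{u, v, w} R W).Hom (T.objOver j hj) (T.objOver i hi) 0 :=
  T.a.ev (k := 1) (q := 0) (by omega) s hW

lemma isHtpyInvertible_edge {i j : ι} {s : Simplex anyRel 1 i j} (h : T.InvertibleAt s)
    {W : Opens X} (hi : W ≤ U i) (hj : W ≤ U j) (hW : W ≤ (cechSystem.{u, v, w} R U).region s) :
    (cpx.{u, v, w} R W).IsHtpyInvertible rfl (T.edge s hi hj hW) :=
  (cpxRes hW).map_isHtpyInvertible rfl
    (T.edge s ((cechSystem.{u, v, w} R U).region_first s)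
      ((cechSystem.{u, v, w} R U).region_last s) le_rfl) h

/-- The Maurer-Cartan equation at the edge `(0, 1)` of `[1]` over the tuple `(i, j)`, restricted to
`W`. Non-degeneracy plays no role. -/
lemma d_edge {i j : ι} (s : Simplex anyRel 1 i j) {W : Opens X} (hi : W ≤ U i) (hj : W ≤ U j)
    (hW : W ≤ (cechSystem.{u, v, w} R U).region s) :
    (cpx.{u, v, w} R W).d (q := 1) (by omega) (T.edge s hi hj hW) = 0 := by
  obtain ⟨v, adm, rfl, rfl⟩ := s
  have h := congrFun (d_edge_eq_zero (T.nerveCochain_zero 1) (T.nerveCochain_mc 1)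
    (Simplex.universal 1)) v
  have h' := congrArg (GHom.restrict hW) h
  exact ((cpxRes hW).map_d (q := 1) (by omega) (T.edge ⟨v, adm, rfl, rfl⟩
    ((cechSystem.{u, v, w} R U).region_first _) ((cechSystem.{u, v, w} R U).region_last _)
    le_rfl)).symm.trans h'

/-- The homotopy is `a^{2,-1}_{iji}`, whose inner face is `(i, i)`. -/
lemma homotopic_edge {i j : ι} {W : Opens X} (hi : W ≤ U i) (hj : W ≤ U j)
    (s : Simplex anyRel 1 i j) (s' : Simplex anyRel 1 j i) (r : Simplex anyRel 1 i i)
    (hs : W ≤ (cechSystem.{u, v, w} R U).region s) (hs' : W ≤ (cechSystem.{u, v, w} R U).region s')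
    (hr : W ≤ (cechSystem.{u, v, w} R U).region r) :
    (cpx.{u, v, w} R W).Homotopic
      ((cpx.{u, v, w} R W).comp (by omega) (T.edge s hi hj hs) (T.edge s' hj hi hs'))
      (T.edge r hi hi hr) := by
  -- The index set carries no order, so `(i, j, i)` is realized as the universal simplex of `[2]`
  -- over this tuple, where `d_triangle_eq` applies.
  let α : Fin 3 → ι := ![i, j, i]
  let τ := Simplex.universal 2
  have hα : W ≤ inter U α := by
    intro x hx l
    fin_cases l
    exacts [hi hx, hj hx, hi hx]
  -- A two-entry multi-index is determined by its ends, so `s`, `s'`, `r` may be taken to be the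
  -- faces of the triangle.
  have hsub : ∀ {a b : ι} (x y : Simplex (anyRel (ι := ι)) 1 a b), x = y := by
    intro a b x y
    refine Simplex.ext (funext fun l => ?_)
    fin_cases l
    exacts [x.first.trans y.first.symm, x.last.trans y.last.symm]
  obtain rfl := hsub ((τ.front (p := 1) (r := 1) rfl).relabel α) s
  obtain rfl := hsub ((τ.back (p := 1) (r := 1) rfl).relabel α) s'
  obtain rfl := hsub ((τ.skip 0).relabel α) r
  let f : (cpx.{u, v, w} R (inter U α)).Hom (T.objOver i fun _ hx => hx 2)
    (T.objOver i fun _ hx => hx 0) (-1) :=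
    T.nerveCochain 2 2 (-1) (by omega) 0 (Fin.last 2) τ α
  let f₀₁ : (cpx.{u, v, w} R (inter U α)).Hom (T.objOver j fun _ hx => hx 1)
    (T.objOver i fun _ hx => hx 0) 0 :=
    T.edge ((τ.front (p := 1) (r := 1) rfl).relabel α) _ _ fun _ hx l => hx (τ.v _)
  let f₁₂ : (cpx.{u, v, w} R (inter U α)).Hom (T.objOver i fun _ hx => hx 2)
    (T.objOver j fun _ hx => hx 1) 0 :=
    T.edge ((τ.back (p := 1) (r := 1) rfl).relabel α) _ _ fun _ hx l => hx (τ.v _)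
  let f₀₂ : (cpx.{u, v, w} R (inter U α)).Hom (T.objOver i fun _ hx => hx 2)
    (T.objOver i fun _ hx => hx 0) 0 :=
    T.edge ((τ.skip 0).relabel α) _ _ fun _ hx l => hx (τ.v _)
  have h : (cpx.{u, v, w} R (inter U α)).d (q := 0) (by omega) f =
      f₀₂ - (cpx.{u, v, w} R (inter U α)).comp (r := 0) (by omega) f₀₁ f₁₂ :=
    congrFun (d_triangle_eq (T.nerveCochain_zero 2) (T.nerveCochain_mc 2) τ) α
  refine DGCat.Homotopic.symm ⟨(cpxRes hα).map f, Eq.trans ?_ ((cpxRes hα).map_d (q := 0) _ f)⟩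
  rw [h]
  exact ((cpxRes hα).map_sub f₀₂
    ((cpx.{u, v, w} R (inter U α)).comp (r := 0) (by omega) f₀₁ f₁₂)).symm

/-- If all `a^{1,0}_{i i}` are homotopy invertible, then so are all `a^{1,0}_{i j}`. -/
lemma Nondegenerate.invertibleAt {T : PreTwisted.{u, v, w} R U} (h : T.Nondegenerate) {i j : ι}
    (s : Simplex anyRel 1 i j) : T.InvertibleAt s := by
  have pair : ∀ a b : ι, Simplex (anyRel (ι := ι)) 1 a b := fun a b =>
    ⟨![a, b], fun _ _ _ => trivial, rfl, rfl⟩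
  have hi := (cechSystem.{u, v, w} R U).region_first s
  have hj := (cechSystem.{u, v, w} R U).region_last s
  have key : ∀ {a b : ι} (r : Simplex (anyRel (ι := ι)) 1 a b) {W : Opens X}, W ≤ U a → W ≤ U b →
      W ≤ (cechSystem.{u, v, w} R U).region r := by
    intro a b r W ha hb x hx l
    fin_cases l
    · exact r.first.symm ▸ ha hx
    · exact r.last.symm ▸ hb hx
  -- Here `f = a_{ij}` and `g = a_{ji}`; the composites are homotopic to `a_{ii}` and `a_{jj}`,
  -- which are invertible by assumption.
  exact DGCat.isHtpyInvertible_of_homotopic (B := cpx.{u, v, w} R _)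
    (f := T.edge s hi hj le_rfl) (g := T.edge (pair j i) hj hi (key _ hj hi))
    (T.d_edge _ _ _ _) (T.d_edge _ _ _ _)
    (T.isHtpyInvertible_edge (h i (pair i i)) hi hi (key _ hi hi))
    (T.isHtpyInvertible_edge (h j (pair j j)) hj hj (key _ hj hj))
    (T.homotopic_edge _ _ _ _ _ _ _ _) (T.homotopic_edge _ _ _ _ _ _ _ _)

end PreTwisted

/-! ### The comparison functor -/

lemma DGCat.pi_isHtpyInvertible {κ : Type t} {A : κ → DGCat.{u, v}} {X Y : (DGCat.pi A).Ob} {p : ℤ}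
    (hp : p = 0) (f : (DGCat.pi A).Hom X Y p)
    (h : ∀ i, (A i).IsHtpyInvertible hp (f i : (A i).Hom (X i) (Y i) p)) :
    (DGCat.pi A).IsHtpyInvertible hp f := by
  choose h₀ g hg h₁ h₂ using h
  choose a ha using h₁
  choose b hb using h₂
  exact ⟨funext h₀, g, funext hg, ⟨a, funext ha⟩, ⟨b, funext hb⟩⟩

section Comparison

variable {X : TopCat.{u}} {R : X.Sheaf RingCat.{v}} {ι : Type t} {U : ι → Opens X}

lemma isCompatible_nerveCochain (T : PreTwisted.{u, v, w} R U) : IsCompatible T.nerveCochain := by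
  intro n n' σ k q h i j s
  by_cases hk : k = 0
  · subst hk
    exact (nerveMap R U σ).map_zero
  · refine (congrArg (nerveMap R U σ).map
      (truncate_of_ne (spreadHom T.cplx T.cplx n 1 T.cochain) hk q h i j s)).trans ?_
    exact (truncate_of_ne (spreadHom T.cplx T.cplx n' 1 T.cochain) hk q h (σ i) (σ j)
      (s.mapOrder σ)).symm

namespace TwistedComplex

/-- The object of `Δ_n(Cpx(N_n))` attached to a twisted complex. -/
def simplexObj (T : TwistedComplex.{u, v, w} R U) (n : ℕ) :
    SimplexObj (nerveCat.{u, v, w} R U n) n where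
  E := cplxVertices T.cplx n
  φ := T.nerveCochain n
  φ_zero := T.nerveCochain_zero n
  mc := T.nerveCochain_mc n
  -- An edge of `[n]` over `α` may join different indices of the cover, so invertibility of the
  -- `a_{ii}` alone does not suffice: part (2) is needed.
  inv i j s := DGCat.pi_isHtpyInvertible (A := fun α : Fin (n + 1) → ι => cpx R (inter U α)) rfl _
    fun α => T.isHtpyInvertible_edge (T.nondeg.invertibleAt (s.relabel α)) (W := inter U α)
      (fun _ hx => hx i) (fun _ hx => hx j) (fun _ hx l => hx (s.v l))

/-- The object of the totalization attached to a twisted complex. -/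
def totObj (T : TwistedComplex.{u, v, w} R U) : (Tot (cpxNerve.{u, v, w} R U)).Ob :=
  ⟨fun n => T.simplexObj n.len, by
    funext σ
    refine SimplexObj.ext_castHom rfl fun k q h i j s => ?_
    exact isCompatible_nerveCochain T.toPreTwisted _ _ σ.2.2.toOrderHom k q h i j s⟩

/-- The transport in the equalizer condition is invisible on components: the vertices that it
identifies are definitionally equal, since restriction of complexes is strict. -/
lemma mem_eqHom_iff {T T' : TwistedComplex.{u, v, w} R U} {m : ℤ}
    (η : ∀ n : SimplexCategory, NerveCochain T.cplx T'.cplx n.len m) :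
    (totTarget (cpxNerve.{u, v, w} R U)).castHom T.totObj.2 T'.totObj.2
      ((totLeft (cpxNerve R U)).map (X := T.totObj.1) (Y := T'.totObj.1) η) =
      (totRight (cpxNerve R U)).map (X := T.totObj.1) (Y := T'.totObj.1) η ↔
    IsCompatible fun n => η (SimplexCategory.mk n) := by
  have key : ∀ (σ : Σ n m : SimplexCategory, n ⟶ m) (k : ℕ) (q : ℤ) (h : k + q = m)
      (i j : Fin (σ.1.len + 1)) (s : Simplex (leRel σ.1.len) k i j),
      (show (constSystem (nerveCat.{u, v, w} R U σ.2.1.len) σ.1.len).Cochain (leRel σ.1.len)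
        (fun i => cplxVertices T.cplx σ.2.1.len (σ.2.2.toOrderHom i))
        (fun i => cplxVertices T'.cplx σ.2.1.len (σ.2.2.toOrderHom i)) m from
        (totTarget (cpxNerve.{u, v, w} R U)).castHom T.totObj.2 T'.totObj.2
      ((totLeft (cpxNerve R U)).map (X := T.totObj.1) (Y := T'.totObj.1) η) σ) k q h i j s =
      (nerveMap R U σ.2.2.toOrderHom).map (η σ.1 k q h i j s) := by
    intro σ k q h i j s
    refine (congrFun (congrFun (congrFun (congrFun (congrFun (congrFun
      (DGCat.castHom_pi_apply _ T.totObj.2 T'.totObj.2 _ σ) k) q) h) i) j) s).trans ?_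
    exact castHom_simplexCat_apply _ _ _ k q h i j s
  constructor
  · intro H n n' σ k q h i j s
    refine (key ⟨_, _, SimplexCategory.mkHom σ⟩ k q h i j s).symm.trans ?_
    rw [H]
    rfl
  · intro H
    funext σ k q h i j s
    exact (key σ k q h i j s).trans (H _ _ σ.2.2.toOrderHom k q h i j s)

/-- The morphism of the totalization attached to a morphism of twisted complexes. -/
def totMap {T T' : TwistedComplex.{u, v, w} R U} {m : ℤ} (θ : (Tw.{u, v, w} R U).Hom T T' m) :
    (Tot (cpxNerve.{u, v, w} R U)).Hom T.totObj T'.totObj m :=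
  ⟨fun n => spreadHom T.cplx T'.cplx n.len m θ,
    (mem_eqHom_iff _).2 (isCompatible_spreadHom (K := T.cplx) (L := T'.cplx) θ)⟩

/-- For twisted complexes the coefficients are graded sheaves without differential, and `a^{0,1}`
acts through the products; in `Δ_n` it acts through the internal differential. `twist_d_eq`
reconciles the two. -/
lemma twist_d_spreadHom {T T' : TwistedComplex.{u, v, w} R U} {m m' : ℤ} (hm : m + 1 = m')
    (θ : CechCochain T.cplx T'.cplx m) (n : ℕ) :
    spreadHom T.cplx T'.cplx n m' ((Tw.{u, v, w} R U).d (X := T) (Y := T') hm θ) =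
      (simplexCat (nerveCat.{u, v, w} R U n) n).d (X := T.simplexObj n) (Y := T'.simplexObj n) hm
        (spreadHom T.cplx T'.cplx n m θ) := by
  have e : @Eq (CechCochain T.cplx T'.cplx m') ((Tw.{u, v, w} R U).d (X := T) (Y := T') hm θ)
      ((cechSystem R U).delta hm θ + (cechSystem R U).mul (by omega) T'.cochain θ -
        m.negOnePow • (cechSystem R U).mul hm θ T.cochain) := by
    have h : (cechSystem R U).inner hm θ = 0 := by
      funext k q h i j s
      exact smul_zero ((k : ℤ).negOnePow)
    have h' : (cechSystem R U).inner hm θ + (cechSystem R U).delta hm θ +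
        (cechSystem R U).mul (by omega) T'.cochain θ -
          m.negOnePow • (cechSystem R U).mul hm θ T.cochain =
        (cechSystem R U).delta hm θ + (cechSystem R U).mul (by omega) T'.cochain θ -
          m.negOnePow • (cechSystem R U).mul hm θ T.cochain := by rw [h, zero_add]
    exact h'
  refine (congrArg (spreadHom T.cplx T'.cplx n m') e).trans ?_
  refine Eq.trans ?_ ((nerveInner R U n).twist_d_eq (T.nerveCochain n) (T'.nerveCochain n) hm
    (by omega) (spreadHom T.cplx T'.cplx n m θ)).symm
  rw [← T.spreadHom_cochain, ← T'.spreadHom_cochain, ← spreadHom_mul, ← spreadHom_mul,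
    ← spreadHom_delta, map_sub, map_add, Units.smul_def, Units.smul_def, map_zsmul]

end TwistedComplex

variable (R U) in
/-- The comparison functor from twisted complexes to the totalization. -/
def comparison : DGFunctor (Tw.{u, v, w} R U) (Tot (cpxNerve.{u, v, w} R U)) where
  obj T := TwistedComplex.totObj T
  map θ := TwistedComplex.totMap θ
  map_add {T T' m} θ θ' := Subtype.ext (funext fun n =>
    map_add (spreadHom (PreTwisted.cplx (TwistedComplex.toPreTwisted T))
      (PreTwisted.cplx (TwistedComplex.toPreTwisted T')) n.len m) θ θ')
  map_one T := Subtype.ext (funext fun n =>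
    spreadHom_one (PreTwisted.cplx (TwistedComplex.toPreTwisted T)) n.len)
  map_comp {T T' T'' _ _ _} h θ θ' := Subtype.ext (funext fun n =>
    spreadHom_mul (K := PreTwisted.cplx (TwistedComplex.toPreTwisted T))
      (L := PreTwisted.cplx (TwistedComplex.toPreTwisted T'))
      (M := PreTwisted.cplx (TwistedComplex.toPreTwisted T'')) h θ θ' n.len)
  map_d h θ := Subtype.ext (funext fun n => TwistedComplex.twist_d_spreadHom h θ n.len)

/-! ### Bijectivity on morphisms and on objects -/

/-- A morphism of the totalization is a compatible family of simplicial cochains, and `collapse` is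
inverse to spreading. -/
lemma comparison_map_bijective (T T' : TwistedComplex.{u, v, w} R U) (m : ℤ) :
    Function.Bijective fun θ : (Tw.{u, v, w} R U).Hom T T' m => (comparison R U).map θ := by
  constructor
  · intro θ θ' h
    refine spreadHom_injective (K := T.cplx) (L := T'.cplx) fun n => ?_
    exact congrFun (congrArg Subtype.val h) (SimplexCategory.mk n)
  · intro η
    have hη := (TwistedComplex.mem_eqHom_iff (T := T) (T' := T') η.1).1 η.2
    exact ⟨collapse (K := T.cplx) (L := T'.cplx) _, Subtype.ext (funext fun n =>
      spreadHom_collapse hη n.len)⟩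


end Comparison

/-! ### Bijectivity on objects -/

section Objects

variable {X : TopCat.{u}} {R : X.Sheaf RingCat.{v}} {ι : Type t} {U : ι → Opens X}

lemma Cplx.d_eq_of_mk_eq {W : Opens X} {E : ℤ → ModSheaf.{u, v, w} R W} {d d' : GHom E E 1}
    {hd : GHom.comp (q := 2) (by omega) d d = 0} {hd' : GHom.comp (q := 2) (by omega) d' d' = 0}
    (hE : (⟨E, d, hd⟩ : Cplx R W) = ⟨E, d', hd'⟩) : d = d' := by
  simpa using hE

/-- Transport along an equality of complexes with the same underlying graded sheaf is trivial. -/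
lemma castHom_cpx {W : Opens X} {E F : ℤ → ModSheaf.{u, v, w} R W} {d d' : GHom E E 1}
    {e e' : GHom F F 1} {hd : GHom.comp (q := 2) (by omega) d d = 0}
    {hd' : GHom.comp (q := 2) (by omega) d' d' = 0} {he : GHom.comp (q := 2) (by omega) e e = 0}
    {he' : GHom.comp (q := 2) (by omega) e' e' = 0} (hE : (⟨E, d, hd⟩ : Cplx R W) = ⟨E, d', hd'⟩)
    (hF : (⟨F, e, he⟩ : Cplx R W) = ⟨F, e', he'⟩) {q : ℤ} (f : GHom E F q) :
    @Eq (GHom E F q) ((cpx.{u, v, w} R W).castHom hE hF f) f := by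
  obtain rfl : d = d' := Cplx.d_eq_of_mk_eq hE
  obtain rfl : e = e' := Cplx.d_eq_of_mk_eq hF
  rfl

lemma isHtpyInvertible_castHom {B : DGCat.{u, v}} {x x' y y' : B.Ob} {p : ℤ} (hp : p = 0)
    (hx : x = x') (hy : y = y') (f : B.Hom x y p) (hf : B.IsHtpyInvertible hp f) :
    B.IsHtpyInvertible hp (B.castHom hx hy f) := by
  subst hx hy
  exact hf

lemma DGCat.IsHtpyInvertible.apply {κ : Type t} {A : κ → DGCat.{u, v}} {x y : (DGCat.pi A).Ob}
    {p : ℤ} {hp : p = 0} {f : (DGCat.pi A).Hom x y p} (h : (DGCat.pi A).IsHtpyInvertible hp f)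
    (i : κ) : (A i).IsHtpyInvertible hp (f i : (A i).Hom (x i) (y i) p) := by
  obtain ⟨h₀, g, hg, ⟨a, ha⟩, ⟨b, hb⟩⟩ := h
  exact ⟨congrFun h₀ i, g i, congrFun hg i, ⟨a i, congrFun ha i⟩, ⟨b i, congrFun hb i⟩⟩

/-- Lets an object over `U_{i…i}` be moved back to `U_i`; restricting there and back changes
nothing. -/
lemma le_inter_const (i : ι) {n : ℕ} : U i ≤ inter U fun _ : Fin (n + 1) => i := fun _ hx _ => hx

lemma cplx_eq_of_simplexObj_eq {T T' : TwistedComplex.{u, v, w} R U}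
    (h : T.simplexObj 0 = T'.simplexObj 0) : T.cplx = T'.cplx := by
  funext i
  have h' : (T.cplx i).restrict (W := inter U fun _ : Fin 1 => i) (fun _ hx => hx 0) =
      (T'.cplx i).restrict (W := inter U fun _ : Fin 1 => i) (fun _ hx => hx 0) :=
    congrFun (congrArg (fun z : SimplexObj (nerveCat.{u, v, w} R U 0) 0 => z.E 0) h) fun _ => i
  exact congrArg (fun z => Cplx.restrict z (le_inter_const i)) h'

/-- The vertices over `[0]` give the complexes, hence `E` and `a^{0,1}`; the higher components of
`a` are those at the universal simplices. -/
lemma comparison_obj_injective : Function.Injective (comparison.{u, v, w} R U).obj := by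
  intro T T' h
  have hx : ∀ n, T.simplexObj n = T'.simplexObj n := fun n =>
    congrFun (congrArg Subtype.val h) (SimplexCategory.mk n)
  have hc := cplx_eq_of_simplexObj_eq (hx 0)
  obtain ⟨⟨E, a, mc⟩, nd⟩ := T
  obtain ⟨⟨E', a', mc'⟩, nd'⟩ := T'
  obtain rfl : E = E' := funext fun i => congrArg Cplx.E (congrFun hc i)
  obtain rfl : a = a' := by
    funext k q hq i j s
    obtain ⟨v, adm, rfl, rfl⟩ := s
    by_cases hk : k = 0
    · subst hk
      obtain rfl : q = 1 := by omega
      obtain ⟨i, rfl⟩ : ∃ i, v = fun _ => i :=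
        ⟨v 0, funext fun x => congrArg v (Fin.ext (by omega))⟩
      -- The truncated cochain is zero at `k = 0`, so `a^{0,1}` has to be recovered from the
      -- differentials of the vertices.
      have hd := Cplx.d_eq_of_mk_eq (congrFun hc i)
      exact congrArg (GHom.restrict (W := inter U fun _ : Fin 1 => i) fun _ hx => hx 0) hd
    · have h₁ := congrFun (SimplexObj.castHom_φ (hx k) k q hq 0 (Fin.last k)
        (Simplex.universal k)) v
      have h₂ := (DGCat.castHom_pi_apply _ _ _ _ v).symm.trans h₁
      -- The two complexes at each end already have the same graded sheaf, so the transport does not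
      -- change the map.
      have h₃ := (castHom_cpx _ _ _).symm.trans h₂
      refine Eq.trans ?_ (h₃.trans ?_)
      · exact (congrFun (truncate_of_ne (spreadHom _ _ k 1 (PreTwisted.cochain ⟨E, a, mc⟩)) hk q hq
          0 (Fin.last k) (Simplex.universal k)) v).symm
      · exact congrFun (truncate_of_ne (spreadHom _ _ k 1 (PreTwisted.cochain ⟨E, a', mc'⟩)) hk q hq
          0 (Fin.last k) (Simplex.universal k)) v
  rfl

lemma IsCompatible.add {K L : ∀ i, Cplx.{u, v, w} R (U i)} {m : ℤ}
    {η η' : ∀ n, NerveCochain K L n m}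
    (h : IsCompatible η) (h' : IsCompatible η') : IsCompatible fun n => η n + η' n :=
  fun n n' σ k q hq i j s => ((nerveMap R U σ).map_add _ _).trans
    (congrArg₂ (· + ·) (h n n' σ k q hq i j s) (h' n n' σ k q hq i j s))

/-! ### Descent of compatible simplicial data to twisted complexes -/

section Descent

variable {K : ∀ i, Cplx.{u, v, w} R (U i)} {φ : ∀ n, NerveCochain K K n 1}

lemma spreadHom_collapse_add_cochain (hφ : IsCompatible φ) (n : ℕ) :
    spreadHom K K n 1 (collapse fun n => φ n + (nerveInner R U n).cochain (cplxVertices K n)) =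
      φ n + (nerveInner R U n).cochain (cplxVertices K n) :=
  spreadHom_collapse (hφ.add (isCompatible_cochain K)) n

/-- The twisted complex, up to non-degeneracy, with the complexes `K_i` and the compatible
simplicial cochains `φ`. -/
def descend (hφ : IsCompatible φ)
    (hmc : ∀ n, (constSystem (nerveCat.{u, v, w} R U n) n).inner (m' := 2) (by omega) (φ n) +
      (constSystem (nerveCat R U n) n).delta (m' := 2) (by omega) (φ n) +
      (constSystem (nerveCat R U n) n).mul (m := 2) (by omega) (φ n) (φ n) = 0) :
    PreTwisted.{u, v, w} R U where
  E := gradedSheaves K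
  a := collapse fun n => φ n + (nerveInner R U n).cochain (cplxVertices K n)
  mc := by
    -- The equation can be tested after spreading to every `[n]`, where `mc_eq` turns it into the
    -- Maurer-Cartan equation for `φ n`.
    refine spreadHom_injective fun n => ?_
    rw [map_add, map_zero, spreadHom_delta, spreadHom_mul, spreadHom_collapse_add_cochain hφ,
      ← (nerveInner R U n).mc_eq, hmc]

lemma descend_a_apply (hφ : IsCompatible φ)
    (hmc : ∀ n, (constSystem (nerveCat.{u, v, w} R U n) n).inner (m' := 2) (by omega) (φ n) +
      (constSystem (nerveCat R U n) n).delta (m' := 2) (by omega) (φ n) +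
      (constSystem (nerveCat R U n) n).mul (m := 2) (by omega) (φ n) (φ n) = 0)
    {k : ℕ} (hk : k ≠ 0) (q : ℤ) (h : k + q = 1) (v : Fin (k + 1) → ι) :
    (descend hφ hmc).a k q h (v 0) (v (Fin.last k)) ⟨v, fun _ _ _ => trivial, rfl, rfl⟩ =
      φ k k q h 0 (Fin.last k) (Simplex.universal k) v := by
  have e : (φ k + (nerveInner R U k).cochain (cplxVertices K k)) k q h 0 (Fin.last k)
      (Simplex.universal k) = φ k k q h 0 (Fin.last k) (Simplex.universal k) :=
    (congrArg _ ((nerveInner R U k).cochain_of_ne (cplxVertices K k) hk h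
      (Simplex.universal k))).trans (add_zero _)
  exact congrFun e v

/-- As `φ` vanishes at `k = 0`, the component `a^{0,1}` of the descended cochain consists of the
inserted differentials of `K`, and nothing else. -/
lemma descend_cplx (hφ : IsCompatible φ)
    (h₀ : ∀ (n : ℕ) (q : ℤ) (h : (0 : ℕ) + q = 1) (i j : Fin (n + 1)) (s : Simplex (leRel n) 0 i j),
      φ n 0 q h i j s = 0)
    (hmc : ∀ n, (constSystem (nerveCat.{u, v, w} R U n) n).inner (m' := 2) (by omega) (φ n) +
      (constSystem (nerveCat R U n) n).delta (m' := 2) (by omega) (φ n) +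
      (constSystem (nerveCat R U n) n).mul (m := 2) (by omega) (φ n) (φ n) = 0) :
    (descend hφ hmc).cplx = K := by
  funext i
  have e : (φ 0 + (nerveInner R U 0).cochain (cplxVertices K 0)) 0 1 (by omega) 0 (Fin.last 0)
      (Simplex.universal 0) = (nerveInner R U 0).δ (cplxVertices K 0 0) :=
    (congrArg (· + _) (h₀ 0 1 (by omega) 0 0 (Simplex.universal 0))).trans (zero_add _)
  have e' := congrArg (GHom.restrict (le_inter_const (n := 0) i)) (congrFun e fun _ => i)
  have key : ∀ {L L' : Cplx.{u, v, w} R (U i)} (hE : L.E = L'.E), HEq L.d L'.d → L = L' := by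
    rintro ⟨E, d, _⟩ ⟨E', d', _⟩ hE hd
    change E = E' at hE
    subst hE
    obtain rfl := eq_of_heq hd
    rfl
  exact key rfl (heq_of_eq e')

end Descent

/-- The equalizer condition for the maps `[0] → [n]` makes all vertices restrictions of one family
`K`. For general `σ` it makes the cochains compatible, so that they descend. -/
lemma comparison_obj_surjective : Function.Surjective (comparison.{u, v, w} R U).obj := by
  intro x
  let y : ∀ n : ℕ, SimplexObj (nerveCat.{u, v, w} R U n) n := fun n => x.1 (SimplexCategory.mk n)
  have hx : ∀ (n n' : ℕ) (σ : Fin (n + 1) →o Fin (n' + 1)),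
      (simplexMap (nerveMap R U σ) n).obj (y n) = (simplexPull (nerveCat R U n') σ).obj (y n') :=
    fun n n' σ => congrFun x.2
      ⟨SimplexCategory.mk n, SimplexCategory.mk n', SimplexCategory.mkHom σ⟩
  let K : ∀ i, Cplx.{u, v, w} R (U i) := fun i =>
    Cplx.restrict ((y 0).E 0 fun _ => i) (le_inter_const i)
  have hE : ∀ n, (y n).E = cplxVertices K n := by
    intro n
    funext i α
    -- The map `[0] → [n]` with value `i` sends the tuple `α` to `(α_i)`.
    exact (congrFun (congrArg (fun z : SimplexObj (nerveCat.{u, v, w} R U n) 0 => z.E 0)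
      (hx 0 n ⟨fun _ => i, fun _ _ _ => le_rfl⟩)) α).symm
  choose φ h₀ hmc hinv hy using fun n => (y n).exists_eq_mk _ (hE n)
  have hφ : IsCompatible φ := by
    intro n n' σ k q h i j s
    have e := hx n n' σ
    rw [hy, hy] at e
    exact SimplexObj.castHom_φ e k q h i j s
  have hK := descend_cplx hφ h₀ hmc
  have nd : (descend hφ hmc).Nondegenerate := by
    have inv : ∀ (i j : ι) (s : Simplex anyRel 1 i j), (descend hφ hmc).InvertibleAt s := by
      intro i j s
      obtain ⟨v, adm, rfl, rfl⟩ := s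
      have e := DGCat.IsHtpyInvertible.apply (hinv 1 0 1 (Simplex.universal 1)) v
      -- The given edge is invertible between restrictions of `K`, whereas the claim concerns the
      -- complexes of the descended object, which equal `K` only propositionally. Their graded
      -- sheaves coincide, so `castHom_cpx` removes the transport.
      have hX := congrArg (fun z : ∀ i, Cplx.{u, v, w} R (U i) => cplxVertices z 1 1 v) hK.symm
      have hY := congrArg (fun z : ∀ i, Cplx.{u, v, w} R (U i) => cplxVertices z 1 0 v) hK.symm
      have e' := isHtpyInvertible_castHom (B := cpx.{u, v, w} R (inter U v)) rfl hX hY _ e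
      refine Eq.mp (congrArg (DGCat.IsHtpyInvertible (cpx.{u, v, w} R (inter U v)) rfl) ?_) e'
      exact (castHom_cpx hX hY _).trans
        (descend_a_apply hφ hmc one_ne_zero 0 (by omega) v).symm
    exact fun i s => inv i i s
  refine ⟨⟨descend hφ hmc, nd⟩, Subtype.ext (funext fun n => ?_)⟩
  refine Eq.trans ?_ (hy n.len).symm
  refine SimplexObj.ext_castHom (congrArg (fun z => cplxVertices z n.len) hK)
    fun k q h i j s => ?_
  funext α
  refine (DGCat.castHom_pi_apply _ _ _ _ α).trans ?_
  by_cases hk : k = 0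
  · subst hk
    exact (DGCat.castHom_zero _ _ _).trans (congrFun (h₀ n.len q h i j s) α).symm
  · refine (castHom_cpx _ _ _).trans ?_
    refine (congrFun (truncate_of_ne _ hk q h i j s) α).trans ?_
    have e : (φ n.len + (nerveInner R U n.len).cochain (cplxVertices K n.len)) k q h i j s =
        φ n.len k q h i j s :=
      (congrArg _ ((nerveInner R U n.len).cochain_of_ne (cplxVertices K n.len) hk h s)).trans
        (add_zero _)
    refine Eq.trans ?_ (congrFun e α)
    exact congrFun (congrFun (congrFun (congrFun (congrFun (congrFun (congrFun
      (spreadHom_collapse_add_cochain hφ n.len) k) q) h) i) j) s) α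

end Objects

/-! ### Normalized objects -/

section Normalized

variable {X : TopCat.{u}} {R : X.Sheaf RingCat.{v}} {ι : Type t} {U : ι → Opens X}

/-- A weakly increasing sequence without equal neighbours is strictly increasing. This links the two
notions of normalization: any repetition in `Δ_n`, equal neighbours for twisted complexes. -/
lemma Simplex.exists_adjacent_eq {n k : ℕ} {i j : Fin (n + 1)} (s : Simplex (leRel n) k i j)
    (h : ¬ Function.Injective s.v) : ∃ l : Fin k, s.v l.castSucc = s.v l.succ := by
  by_contra! hne
  refine h (StrictMono.injective (Fin.strictMono_iff_lt_succ.2 fun l => ?_))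
  exact lt_of_le_of_ne (s.adm _ _ (Fin.castSucc_lt_succ).le) (hne l)

/-- A map with two equal neighbouring values factors through a monotone surjection that identifies
the two neighbours. -/
lemma exists_factor_of_adjacent_eq {n : ℕ} (v : Fin (n + 2) → ι) (l : Fin (n + 1))
    (hl : v l.castSucc = v l.succ) :
    ∃ (σ : Fin (n + 2) →o Fin (n + 1)) (α : Fin (n + 1) → ι),
      v = (fun x => α (σ x)) ∧ Function.Surjective σ ∧ σ l.castSucc = σ l.succ := by
  let σ : Fin (n + 2) →o Fin (n + 1) :=
    ⟨fun x => ⟨if x.1 ≤ l.1 then x.1 else x.1 - 1, by split_ifs <;> omega⟩, fun x y hxy => by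
      have : x.1 ≤ y.1 := hxy
      simp only [Fin.mk_le_mk]
      split_ifs <;> omega⟩
  -- A section of the codegeneracy `σ` that omits only the value `l + 1`; the equality of neighbours
  -- is needed just at that entry.
  let δ : Fin (n + 1) → Fin (n + 2) := fun y =>
    ⟨if y.1 ≤ l.1 then y.1 else y.1 + 1, by split_ifs <;> omega⟩
  have hσ : ∀ x, (σ x).1 = if x.1 ≤ l.1 then x.1 else x.1 - 1 := fun _ => rfl
  have hδ : ∀ y, (δ y).1 = if y.1 ≤ l.1 then y.1 else y.1 + 1 := fun _ => rfl
  have hl' : σ l.castSucc = σ l.succ := Fin.ext (by rw [hσ, hσ]; simp)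
  refine ⟨σ, v ∘ δ, funext fun x => ?_, fun y => ⟨δ y, Fin.ext ?_⟩, hl'⟩
  · by_cases hx : x = l.succ
    · subst hx
      rw [← hl']
      refine hl.symm.trans (congrArg v (Fin.ext ?_))
      rw [hδ, hσ]
      simp
    · have hx' : x.1 ≠ l.1 + 1 := fun e => hx (Fin.ext e)
      refine congrArg v (Fin.ext ?_)
      rw [hδ, hσ]
      split_ifs <;> omega
  · rw [hσ, hδ]
    split_ifs <;> omega

lemma TwistedComplex.simplexObj_φ_apply (T : TwistedComplex.{u, v, w} R U) {n k : ℕ} (hk : k ≠ 0)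
    (q : ℤ) (h : k + q = 1) {i j : Fin (n + 1)} (s : Simplex (leRel n) k i j) :
    (T.simplexObj n).φ k q h i j s =
      spread (T := T.toPreTwisted) (T' := T.toPreTwisted) T.a n k q h s :=
  truncate_of_ne _ hk q h i j s

/-- A repetition in a weakly increasing multi-index occurs at neighbours, and relabelling by `α`
keeps these equal. -/
lemma TwistedComplex.isNormalized_simplexObj {T : TwistedComplex.{u, v, w} R U}
    (hT : T.toPreTwisted.IsNormalized) (n : ℕ) : (T.simplexObj n).IsNormalized := by
  refine ⟨fun i s => (T.simplexObj_φ_apply one_ne_zero 0 (by omega) s).trans (funext fun α => ?_),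
    fun k q h i j s hk hs => (T.simplexObj_φ_apply (by omega) q h s).trans (funext fun α => ?_)⟩
  · exact (congrArg (GHom.restrict (show inter U α ≤ (cechSystem.{u, v, w} R U).region
      (s.relabel α) from fun _ hx l => hx (s.v l))) (hT.1 (α i) (s.relabel α))).trans
      (GHom.restrict_one _ _)
  · obtain ⟨l, hl⟩ := s.exists_adjacent_eq hs
    exact congrArg (GHom.restrict (show inter U α ≤ (cechSystem.{u, v, w} R U).region
      (s.relabel α) from fun _ hx l => hx (s.v l)))
      (hT.2 k q h (α i) (α j) (s.relabel α) hk ⟨l, congrArg α hl⟩)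

/-- Universal simplices are of no use here, since their entries are distinct even over a tuple with
repetitions. The component of `a` must be read at a degenerate multi-index of a smaller `[n]`. -/
lemma TwistedComplex.isNormalized_of_simplexObj {T : TwistedComplex.{u, v, w} R U}
    (hT : ∀ n, (T.simplexObj n).IsNormalized) : T.toPreTwisted.IsNormalized := by
  constructor
  · intro i s
    -- The degenerate edge `(0, 0)` of `[0]` over the tuple `(i)`.
    let r : Simplex (leRel 0) 1 0 0 := ⟨fun _ => 0, fun _ _ _ => le_rfl, rfl, rfl⟩
    obtain rfl : r.relabel (fun _ => i) = s := by
      refine Simplex.ext (funext fun l => ?_)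
      fin_cases l
      exacts [s.first.symm, s.last.symm]
    have e := congrFun ((T.simplexObj_φ_apply one_ne_zero 0 (by omega) r).symm.trans
      ((hT 0).1 0 r)) fun _ => i
    exact (congrArg (GHom.restrict (show inter U (fun _ : Fin 2 => i) ≤
      inter U fun _ : Fin 1 => i from fun _ hx _ => hx 0)) e).trans (GHom.restrict_one _ _)
  · rintro k q h i j ⟨v, adm, rfl, rfl⟩ hk ⟨l, hl⟩
    obtain ⟨n, rfl⟩ : ∃ n, k = n + 1 := ⟨k - 1, by omega⟩
    obtain ⟨σ, α, rfl, hσ, hσl⟩ := exists_factor_of_adjacent_eq v l hl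
    let r : Simplex (leRel n) (n + 1) (σ 0) (σ (Fin.last (n + 1))) :=
      ⟨σ, fun _ _ h => σ.monotone h, rfl, rfl⟩
    have hr : ¬ Function.Injective r.v := fun hr =>
      absurd (hr hσl) (Fin.castSucc_lt_succ).ne
    have e := congrFun ((T.simplexObj_φ_apply (by omega) q h r).symm.trans
      ((hT n).2 (n + 1) q h _ _ r hk hr)) α
    -- Since `σ` is onto, the vanishing over `U_α` covers the whole open set on which the component
    -- of `a` lives.
    have hle : inter U (fun x => α (σ x)) ≤ inter U α := by
      intro x hx y
      obtain ⟨z, rfl⟩ := hσ y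
      exact hx z
    exact congrArg (GHom.restrict hle) e

end Normalized

end TwTot

theorem proposition9 {X : TopCat.{u}} (R : X.Sheaf RingCat.{v}) {ι : Type t} (U : ι → Opens X)
    (hcov : ⨆ i, U i = ⊤) (hfin : LocallyFinite fun i => (U i : Set X)) :
    (∃ F : TwTot.DGFunctor (TwTot.Tw.{u, v, w} R U) (TwTot.Tot (TwTot.cpxNerve.{u, v, w} R U)),
      F.IsIso ∧
      (∃ hE : ∀ (T : TwTot.TwistedComplex.{u, v, w} R U) (n : SimplexCategory)
          (i : Fin (n.len + 1)),
          TwTot.Tot.vertex (F.obj T) n i = T.toPreTwisted.vertices n.len i,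
        (∀ (T : TwTot.TwistedComplex.{u, v, w} R U) (n : SimplexCategory) (k : ℕ) (q : ℤ)
          (h : k + q = 1) (i j : Fin (n.len + 1))
          (s : TwTot.Simplex (TwTot.leRel n.len) k i j), 1 ≤ k →
          TwTot.DGCat.castHom _ (hE T n j) (hE T n i) (TwTot.Tot.phi (F.obj T) n k q h s) =
            TwTot.spread (T := T.toPreTwisted) (T' := T.toPreTwisted) T.a n.len k q h s) ∧
        (∀ (T T' : TwTot.TwistedComplex.{u, v, w} R U) (m : ℤ)
          (θ : (TwTot.Tw.{u, v, w} R U).Hom T T' m) (n : SimplexCategory) (k : ℕ) (q : ℤ)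
          (h : k + q = m) (i j : Fin (n.len + 1))
          (s : TwTot.Simplex (TwTot.leRel n.len) k i j),
          TwTot.DGCat.castHom _ (hE T n j) (hE T' n i) (TwTot.Tot.theta (F.map θ) n k q h s) =
            TwTot.spread (T := T.toPreTwisted) (T' := T'.toPreTwisted) θ n.len k q h s)) ∧
      (∀ T : TwTot.TwistedComplex.{u, v, w} R U,
        T.toPreTwisted.IsNormalized ↔
          ∀ n : SimplexCategory, (TwTot.Tot.simplexObj (F.obj T) n).IsNormalized)) ∧
    (∀ T : TwTot.PreTwisted.{u, v, w} R U,
      T.Nondegenerate ↔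
        ∀ (i j : ι) (s : TwTot.Simplex TwTot.anyRel 1 i j), T.InvertibleAt s) := by
  refine ⟨⟨TwTot.comparison R U, ⟨⟨TwTot.comparison_obj_injective, TwTot.comparison_obj_surjective⟩,
    fun T T' m => TwTot.comparison_map_bijective T T' m⟩, ⟨fun T n i => rfl, ?_, ?_⟩, ?_⟩, ?_⟩
  -- The equalities of vertices hold by `rfl`, so the transports along them reduce away.
  · intro T n k q h i j s hk
    exact T.simplexObj_φ_apply (by omega) q h s
  · intro T T' m θ n k q h i j s
    rfl
  · exact fun T => ⟨fun hT n => T.isNormalized_simplexObj hT n.len, fun hT =>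
      T.isNormalized_of_simplexObj fun n => hT (SimplexCategory.mk n)⟩
  · exact fun T => ⟨fun hT i j s => hT.invertibleAt s, fun hT i s => hT i i s⟩
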